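/- Conventions. A left regular band is a semigroup $B$ with $x^2=x$ and $xyx=xy$ for all $x,y\in B$; a right regular band satisfies $x^2=x$ and $xyx=yx$ instead; a regular band is a subdirect product of a left regular band and a right regular band. For a left regular band monoid $B$, order $B$ by $x\le y \iff yx=x$, let $\Lambda(B)=\{Bb\mid b\in B\}$ be the set of principal left ideals, for each $Y\in\Lambda(B)$ fix $e_Y\in B$ with $Be_Y=Y$, and put $\partial e_YB=e_YB\setminus\{e_Y\}$. $\Delta(P)$ denotes the order complex of a poset $P$ and $\widetilde H^{\,i}(K;\Bbbk)$ the reduced simplicial cohomology of a simplicial complex $K$ with coefficients in $\Bbbk$, where $\widetilde H^{-1}(\emptyset;\Bbbk)=\Bbbk$ and $\widetilde H^{-1}(K;\Bbbk)=0$ for $K\neq\emptyset$. For a monoid $M$ and a left $\mathbb ZM$-module $V$ let $H^n(M,V)=\operatorname{Ext}^n_{\mathbb ZM}(\mathbb Z,V)$, where $\mathbb Z$ is the trivial module, and for a commutative unital ring $\Bbbk$ let \[\operatorname{cd}_{\Bbbk}M=\sup\{n\ge 0\mid H^n(M,V)\neq 0\text{ for some left }\Bbbk M\text{-module }V\}\in\mathbb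 N\cup\{\infty\}\] (with $\sup\emptyset=0$), and $\operatorname{cd}M=\operatorname{cd}_{\mathbb Z}M$. The $\Bbbk$-Leray number of a finite simplicial complex $K$ with vertex set $V$ is \[L_{\Bbbk}(K)=\min\{d\ge 0\mid \widetilde H^{\,i}(K[W];\Bbbk)=0\text{ for all } i\ge d\text{ and all } W\subseteq V\},\] where $K[W]$ is the subcomplex induced by $W$. For a finite simple graph $\Gamma=(V,E)$, the free partially commutative left regular band $B(\Gamma)$ is the left regular band monoid presented by $\langle V\mid xy=yx\text{ if }\{x,y\}\in E\rangle$, and $\mathsf{Cliq}(\Gamma)$ is the clique complex of $\Gamma$. Theorem. (1) Let $B$ be a finite left regular band monoid and $\Bbbk\neq 0$ a commutative ring with unit. Then $\operatorname{cd}_{\Bbbk}B$ is finite and is the largest $n\ge 0$ such that $\widetilde H^{\,n-1}(\Delta(\partial e_YB);\Bbbk)\neq 0$ for some $Y\in\Lambda(B)$. (2) Let $\Gamma$ be a finite simple graph and $\Bbbk$ a commutative ring with unit. Then $\operatorname{cd}_{\Bbbk}B(\Gamma)=L_{\Bbbk}(\mathsf{Cliq}(\Gamma))$. Moreover $\operatorname{cd}B(\Gamma)\le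 1$ if and only if $\Gamma$ is chordal, that is, $\Gamma$ has no induced cycle on four or more vertices. (3) For all integers $m,n\ge 0$ there is a finite regular band monoid $B$ with $\operatorname{cd}B=m$ and $\operatorname{cd}B^{op}=n$. -/

import Mathlib

open CategoryTheory CategoryTheory.Abelian
open scoped MonoidAlgebra

universe u v w

/-! ### Left regular bands -/

/-- A left regular band: the identities `x² = x` and `xyx = xy` hold. -/
class IsLeftRegularBand (B : Type v) [Mul B] : Prop where
  mul_self : ∀ x : B, x * x = x
  mul_mul_self : ∀ x y : B, x * y * x = x * y

/-- A right regular band: the identities `x² = x` and `xyx = yx` hold. -/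
class IsRightRegularBand (B : Type v) [Mul B] : Prop where
  mul_self : ∀ x : B, x * x = x
  mul_mul_self : ∀ x y : B, x * y * x = y * x

/-- A regular band: a subdirect product of a left regular band and a right regular band. -/
def IsRegularBand (B : Type v) [Mul B] : Prop :=
  ∃ (L R : Type v) (_ : Semigroup L) (_ : Semigroup R) (f : B →ₙ* L) (g : B →ₙ* R),
    IsLeftRegularBand L ∧ IsRightRegularBand R ∧
    Function.Surjective f ∧ Function.Surjective g ∧ Function.Injective fun b => (f b, g b)

/-- The natural partial order of a left regular band: `x ≤ y` if and only if `yx = x`. -/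
@[reducible] def lrbPartialOrder (B : Type v) [Monoid B] [IsLeftRegularBand B] :
    PartialOrder B where
  le x y := y * x = x
  le_refl x := IsLeftRegularBand.mul_self x
  le_trans x y z hxy hyz := by
    rw [← (show y * x = x from hxy), ← mul_assoc, (show z * y = y from hyz)]
  le_antisymm x y hxy hyx := by
    have hxy' : y * x = x := hxy
    have hyx' : x * y = y := hyx
    calc x = y * x := hxy'.symm
      _ = x * y * x := by rw [hyx']
      _ = x * y := IsLeftRegularBand.mul_mul_self x y
      _ = y := hyx'

/-- The principal left ideal `Bb`. -/
def principalLeftIdeal {B : Type v} [Mul B] (b : B) : Set B := {x | ∃ a : B, x = a * b}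

/-- The support semilattice `Λ(B) = {Bb ∣ b ∈ B}`. -/
def supportSemilattice (B : Type v) [Mul B] : Set (Set B) := Set.range principalLeftIdeal

/-- The boundary `∂eB = eB \ {e}` of the principal right ideal `eB`. -/
def boundary {B : Type v} [Mul B] (e : B) : Set B := {x | (∃ a : B, x = e * a) ∧ x ≠ e}

/-! ### Simplicial complexes and their reduced cohomology -/

/-- The order complex of a poset: its simplices are the nonempty finite chains. -/
def orderComplex (P : Type v) [PartialOrder P] : AbstractSimplicialComplex P where
  faces := {s | s.Nonempty ∧ IsChain (· ≤ ·) (s : Set P)}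
  isRelLowerSet_faces := fun _ hs =>
    ⟨hs.1, fun _ hts ht => ⟨ht, hs.2.mono (Finset.coe_subset.mpr hts)⟩⟩
  singleton_mem x := ⟨Finset.singleton_nonempty x, by simp [IsChain]⟩

/-- The order complex `Δ(∂eB)`, for the natural partial order of the left regular band `B`. -/
def boundaryComplex {B : Type v} [Monoid B] [IsLeftRegularBand B] (e : B) :
    AbstractSimplicialComplex (boundary e) :=
  letI : PartialOrder B := lrbPartialOrder B
  orderComplex (boundary e)

/-- The clique complex of a simple graph: its simplices are the nonempty finite cliques. -/
def cliqueComplex {V : Type v} (Γ : SimpleGraph V) : AbstractSimplicialComplex V where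
  faces := {s | s.Nonempty ∧ Γ.IsClique (s : Set V)}
  isRelLowerSet_faces := fun _ hs =>
    ⟨hs.1, fun _ hts ht => ⟨ht, hs.2.subset (Finset.coe_subset.mpr hts)⟩⟩
  singleton_mem x := ⟨Finset.singleton_nonempty x, by simp [SimpleGraph.IsClique]⟩

namespace AbstractSimplicialComplex

variable {V : Type v}

/-- The subcomplex `K[W]` induced by a set `W` of vertices. -/
def induced (K : AbstractSimplicialComplex V) (W : Set V) : AbstractSimplicialComplex W where
  faces := {s | s.map (Function.Embedding.subtype (· ∈ W)) ∈ K.faces}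
  isRelLowerSet_faces := fun _ hs =>
    ⟨Finset.map_nonempty.mp (K.isRelLowerSet_faces hs).1, fun _ hts ht =>
      (K.isRelLowerSet_faces hs).2 (Finset.map_subset_map.mpr hts) (ht.map)⟩
  singleton_mem x := by
    simpa using K.singleton_mem (x : V)

/-- `(x₀, …, xₙ₋₁)` lists, without repetition, the vertices of a simplex of `K`;
the empty list (`n = 0`) is admitted and stands for the empty simplex of dimension `-1`. -/
def IsOrderedSimplex (K : AbstractSimplicialComplex V) {n : ℕ} (x : Fin n → V) : Prop :=
  Function.Injective x ∧ (n = 0 ∨ ∃ s ∈ K.faces, (s : Set V) = Set.range x)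

variable (k : Type u) [CommRing k]

/-- The augmented simplicial cochains of `K` in dimension `n - 1`, that is, the `k`-dual of the
module of oriented `(n - 1)`-chains: functions on ordered simplices that change by the sign of the
permutation when the vertices are permuted (extended by `0` to all other lists of vertices).
In dimension `-1` this is `k`. -/
def cochainSubmodule (K : AbstractSimplicialComplex V) (n : ℕ) : Submodule k ((Fin n → V) → k) where
  carrier := {c | (∀ x, ¬ K.IsOrderedSimplex x → c x = 0) ∧
    ∀ (x : Fin n → V) (σ : Equiv.Perm (Fin n)),
      c (x ∘ σ) = ((Equiv.Perm.sign σ : ℤˣ) : ℤ) • c x}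
  add_mem' := fun {a b} ha hb => ⟨fun x hx => by simp [ha.1 x hx, hb.1 x hx],
    fun x σ => by simp only [Pi.add_apply, ha.2 x σ, hb.2 x σ, smul_add]⟩
  zero_mem' := ⟨fun _ _ => rfl, fun _ _ => by simp⟩
  smul_mem' := fun r a ha => ⟨fun x hx => by simp [ha.1 x hx],
    fun x σ => by simp only [Pi.smul_apply, ha.2 x σ]; rw [smul_comm]⟩

/-- The `k`-module of augmented simplicial cochains of `K` in dimension `n - 1`. -/
def Cochains (K : AbstractSimplicialComplex V) (n : ℕ) : Type (max u v) :=
  K.cochainSubmodule k n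

instance (K : AbstractSimplicialComplex V) (n : ℕ) : AddCommGroup (K.Cochains k n) :=
  inferInstanceAs (AddCommGroup (K.cochainSubmodule k n))

instance (K : AbstractSimplicialComplex V) (n : ℕ) : Module k (K.Cochains k n) :=
  inferInstanceAs (Module k (K.cochainSubmodule k n))

theorem isOrderedSimplex_comp_perm (K : AbstractSimplicialComplex V) {n : ℕ} (x : Fin n → V)
    (σ : Equiv.Perm (Fin n)) : K.IsOrderedSimplex (x ∘ σ) ↔ K.IsOrderedSimplex x := by
  unfold IsOrderedSimplex
  rw [σ.surjective.range_comp, σ.injective_comp]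

/-- Deleting an entry of a permuted list is a permutation of deleting an entry of the list. -/
theorem exists_perm_succAbove {n : ℕ} (σ : Equiv.Perm (Fin (n + 1))) (i : Fin (n + 1)) :
    ∃ τ : Equiv.Perm (Fin n), (∀ j, σ (i.succAbove j) = (σ i).succAbove (τ j)) ∧
      (-1 : ℤ) ^ (i : ℕ) * ((Equiv.Perm.sign τ : ℤˣ) : ℤ) =
        ((Equiv.Perm.sign σ : ℤˣ) : ℤ) * (-1 : ℤ) ^ ((σ i : Fin (n + 1)) : ℕ) := by
  let ρ : Equiv.Perm (Fin (n + 1)) := (σ i).cycleRange * σ * i.cycleRange⁻¹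
  obtain ⟨⟨p, τ⟩, hρ⟩ := Equiv.Perm.decomposeFin.symm.surjective ρ
  have hp : p = 0 := by
    have h0 := Equiv.Perm.decomposeFin_symm_apply_zero p τ
    rw [hρ] at h0
    rw [← h0]
    simp [ρ, Equiv.Perm.inv_def]
  subst hp
  refine ⟨τ, fun j => ?_, ?_⟩
  · have h1 := Equiv.Perm.decomposeFin_symm_apply_succ τ 0 j
    rw [hρ] at h1
    apply (σ i).cycleRange.injective
    simpa [ρ, Equiv.Perm.inv_def] using h1
  · have h2 := Equiv.Perm.decomposeFin.symm_sign 0 τ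
    rw [hρ] at h2
    have h3 : Equiv.Perm.sign τ = (-1) ^ ((σ i : Fin (n + 1)) : ℕ) * Equiv.Perm.sign σ *
        (-1) ^ (i : ℕ) := by
      simpa [ρ, Fin.sign_cycleRange] using h2.symm
    have h4 : (-1 : ℤ) ^ (i : ℕ) * (-1) ^ (i : ℕ) = 1 := by
      rw [← mul_pow]; simp
    rw [h3]
    push_cast
    linear_combination ((-1 : ℤ) ^ ((σ i : Fin (n + 1)) : ℕ) * (Equiv.Perm.sign σ : ℤ)) * h4

open Classical in
/-- The simplicial coboundary operator
`(dc)(x₀, …, xₙ) = ∑ᵢ (-1)ⁱ c(x₀, …, x̂ᵢ, …, xₙ)`. -/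
noncomputable def coboundary (K : AbstractSimplicialComplex V) (n : ℕ) :
    K.Cochains k n →ₗ[k] K.Cochains k (n + 1) where
  toFun c := ⟨fun x => if K.IsOrderedSimplex x then
      ∑ i : Fin (n + 1), (-1 : ℤ) ^ (i : ℕ) • c.1 (x ∘ i.succAbove) else 0,
    fun x hx => if_neg hx, fun x σ => by
      simp only [isOrderedSimplex_comp_perm]
      split_ifs
      · rw [Finset.smul_sum, ← Equiv.sum_comp σ fun i =>
          ((Equiv.Perm.sign σ : ℤˣ) : ℤ) • (-1 : ℤ) ^ (i : ℕ) • c.1 (x ∘ i.succAbove)]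
        refine Finset.sum_congr rfl fun i _ => ?_
        obtain ⟨τ, hτ, hs⟩ := exists_perm_succAbove σ i
        have : (x ∘ σ) ∘ i.succAbove = (x ∘ (σ i).succAbove) ∘ τ := by
          funext j; simp [hτ]
        rw [this, c.2.2, smul_smul, smul_smul, hs]
      · simp⟩
  map_add' a b := by
    refine Subtype.ext (funext fun x => ?_)
    change (if K.IsOrderedSimplex x then
        ∑ i : Fin (n + 1), (-1 : ℤ) ^ (i : ℕ) • (a.1 (x ∘ i.succAbove) + b.1 (x ∘ i.succAbove))
        else 0) = (if _ then _ else _) + (if _ then _ else _)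
    by_cases hx : K.IsOrderedSimplex x <;> simp only [hx, if_true, if_false, smul_add,
      Finset.sum_add_distrib, add_zero]
  map_smul' r a := by
    refine Subtype.ext (funext fun x => ?_)
    change (if K.IsOrderedSimplex x then
        ∑ i : Fin (n + 1), (-1 : ℤ) ^ (i : ℕ) • (r • a.1 (x ∘ i.succAbove))
        else 0) = r • (if _ then _ else _)
    by_cases hx : K.IsOrderedSimplex x
    · simp only [hx, if_true, Finset.smul_sum]
      exact Finset.sum_congr rfl fun i _ => smul_comm _ _ _
    · simp only [hx, if_false, smul_zero]

/-- The coboundaries in dimension `n - 1`. -/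
noncomputable def coboundaries (K : AbstractSimplicialComplex V) :
    (n : ℕ) → Submodule k (K.Cochains k n)
  | 0 => ⊥
  | n + 1 => LinearMap.range (K.coboundary k n)

/-- The reduced simplicial cohomology `H̃ⁿ⁻¹(K; k)`: note the shift of the degree. -/
abbrev ReducedCohomologySubOne (K : AbstractSimplicialComplex V) (n : ℕ) : Type (max u v) :=
  (LinearMap.ker (K.coboundary k n)) ⧸
    (K.coboundaries k n).comap (LinearMap.ker (K.coboundary k n)).subtype

/-- The `k`-Leray number of `K`: the least `d : ℕ` such that `H̃ⁱ(K[W]; k) = 0` for all `i ≥ d` and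
all sets `W` of vertices (`⊤` if there is no such `d`, which does not happen for finite `K`). -/
noncomputable def lerayNumber (K : AbstractSimplicialComplex V) : ℕ∞ :=
  sInf {d : ℕ∞ | ∃ m : ℕ, d = m ∧ ∀ i : ℕ, m ≤ i → ∀ W : Set V,
    Subsingleton ((K.induced W).ReducedCohomologySubOne k (i + 1))}

end AbstractSimplicialComplex

/-! ### Cohomology of monoids -/

/-- The augmentation `ℤM → ℤ`. -/
noncomputable def augmentationHom (M : Type v) [Monoid M] : ℤ[M] →+* ℤ :=
  (MonoidAlgebra.lift ℤ ℤ M (1 : M →* ℤ)).toRingHom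

/-- The trivial left `ℤM`-module `ℤ`. -/
noncomputable def trivialZModule (M : Type v) [Monoid M] : ModuleCat.{w} ℤ[M] :=
  (ModuleCat.restrictScalars (augmentationHom M)).obj (ModuleCat.of ℤ (ULift.{w} ℤ))

/-- The cohomology `Hⁿ(M, V) = Extⁿ_{ℤM}(ℤ, V)` of a monoid `M` with coefficients in a left
`ℤM`-module `V`. -/
abbrev MonoidCohomology (M : Type v) [Monoid M] (V : ModuleCat.{max w v} ℤ[M]) (n : ℕ) :
    Type (max w v) :=
  Ext.{max w v} (trivialZModule.{v, max w v} M) V n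

/-- The ring homomorphism `ℤM → kM`. -/
noncomputable def intToMonoidAlgebra (k : Type u) [CommRing k] (M : Type v) [Monoid M] :
    ℤ[M] →+* k[M] :=
  MonoidAlgebra.mapRingHom M (Int.castRingHom k)

/-- The `k`-cohomological dimension
`cd_k M = sup {n ∣ Hⁿ(M, V) ≠ 0 for some kM-module V}`, an element of `ℕ ∪ {∞}`. -/
noncomputable def cohomologicalDimension (k : Type u) [CommRing k] (M : Type v) [Monoid M] : ℕ∞ :=
  sSup {d : ℕ∞ | ∃ n : ℕ, d = n ∧ ∃ V : ModuleCat.{max u v} k[M],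
    Nontrivial (MonoidCohomology.{v, u} M
      ((ModuleCat.restrictScalars (intToMonoidAlgebra k M)).obj V) n)}

/-! ### Free partially commutative left regular bands -/

/-- The relations presenting `B(Γ)` as a monoid: the left regular band identities for all words, and
`xy = yx` for adjacent vertices `x`, `y`. -/
inductive FreePCRel {V : Type v} (Γ : SimpleGraph V) : FreeMonoid V → FreeMonoid V → Prop
  | mul_self (a : FreeMonoid V) : FreePCRel Γ (a * a) a
  | mul_mul_self (a b : FreeMonoid V) : FreePCRel Γ (a * b * a) (a * b)
  | comm (x y : V) (h : Γ.Adj x y) :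
      FreePCRel Γ (FreeMonoid.of x * FreeMonoid.of y) (FreeMonoid.of y * FreeMonoid.of x)

/-- The free partially commutative left regular band `B(Γ)`. -/
abbrev FreePCLeftRegularBand {V : Type v} (Γ : SimpleGraph V) : Type v :=
  PresentedMonoid (FreePCRel Γ)

instance {V : Type v} (Γ : SimpleGraph V) : IsLeftRegularBand (FreePCLeftRegularBand Γ) where
  mul_self x := by
    obtain ⟨a, rfl⟩ := PresentedMonoid.surjective_mk x
    rw [← map_mul]
    exact PresentedMonoid.mk_eq_mk_of_rel (.mul_self a)
  mul_mul_self x y := by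
    obtain ⟨a, rfl⟩ := PresentedMonoid.surjective_mk x
    obtain ⟨b, rfl⟩ := PresentedMonoid.surjective_mk y
    rw [← map_mul, ← map_mul]
    exact PresentedMonoid.mk_eq_mk_of_rel (.mul_mul_self a b)

/-- A graph is chordal if it has no induced cycle on four or more vertices. -/
def IsChordalGraph {V : Type v} (Γ : SimpleGraph V) : Prop :=
  ∀ n : ℕ, 4 ≤ n → IsEmpty (SimpleGraph.cycleGraph n ↪g Γ)

/-! ### Alternating cochains with coefficients in an abelian group -/

/-! Part (1) computes cohomology with coefficients in simple-minded modules from a cover by right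
ideals. Call a module concentrated at `e` if `b` acts as the identity when `e b = e` and as zero
otherwise. Every `kB`-module has a finite filtration with concentrated subquotients
(`subsingleton_of_forall_isConcentratedAt`), so only these coefficients matter.

For such a `V`, cover the set of elements of `eB` other than `e` by right ideals whose intersections
along the simplices `s` of a complex `F` are principal, equal to `z s B`. The alternating cochains
that assign to `s` a function `z s B → V` form a coresolution of `V`. It is exact because evaluation
at a point `y ≠ e` of `eB` sees only the simplices whose ideals contain `y`, and these form a cone,
while at `y = e` only the empty simplex survives and contributes `V`. Functions on a principal right
ideal are coinduced from `ℤ`, so the terms are acyclic for `Ext(ℤ, -)`. An invariant function on `B`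
is constant, so Hom from `ℤ` into the coresolution is the augmented cochain complex of `F`. Hence
`Hⁿ(B, V)` vanishes exactly when `H̃ⁿ⁻¹(F; V)` does (`monoidCohomology_subsingleton_iff`). Vanishing
above `N` passes from `k` to all concentrated coefficients by free covers over `k` and descending
induction on the degree.

Two covers are used. All elements of `∂eB` give the order complex, hence (1). In `B(Γ)` the supports
correspond to sets `W` of vertices; with `e` the product of the vertices outside `W`, the ideals `e
v B` for `v ∈ W` have the clique complex of `Γ[W]` as nerve, hence the Leray number. An induced
cycle of length at least 4 carries a class in degree 1. Conversely, for chordal `Γ` the vertices are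
removed one at a time by a Mayer–Vietoris argument; chordality enters in degree 1 only, where
neighbours of `v` joined by a path avoiding `v` must be joined by a path of neighbours of `v`.

For (3), the clique complex of the cocktail party graph is the boundary of a cross-polytope, so
every `m` is some `cd B(Γ)`. In `L × Rᵐᵒᵖ`, a left zero of one factor makes that factor
cohomologically invisible from the corresponding side: inflation along the projection has an exact
right adjoint (`AbsorbingRetraction.cohomologicalDimension_eq`). So `cd` of the product is `cd L`,
and `cd` of its opposite is `cd R`. -/

section Cochains

variable {S : Type*} {A : Type*} [AddCommGroup A]

/-- The alternating sum `∑ᵢ (-1)ⁱ c(x₀, …, x̂ᵢ, …, xₙ)`. -/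
def alternatingFaceSum {n : ℕ} (c : (Fin n → S) → A) (x : Fin (n + 1) → S) : A :=
  ∑ i : Fin (n + 1), (-1 : ℤ) ^ (i : ℕ) • c (x ∘ i.succAbove)

theorem alternatingFaceSum_add {n : ℕ} (c c' : (Fin n → S) → A) (x : Fin (n + 1) → S) :
    alternatingFaceSum (c + c') x = alternatingFaceSum c x + alternatingFaceSum c' x := by
  simp [alternatingFaceSum, Finset.sum_add_distrib]

theorem alternatingFaceSum_sub {n : ℕ} (c c' : (Fin n → S) → A) (x : Fin (n + 1) → S) :
    alternatingFaceSum (c - c') x = alternatingFaceSum c x - alternatingFaceSum c' x := by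
  simp [alternatingFaceSum, Finset.sum_sub_distrib, smul_sub]

/-- Splitting off the face that omits `a` gives the recursion behind every cone homotopy below:
prepending `a` is a contraction up to the coboundary. -/
theorem alternatingFaceSum_cons {n : ℕ} (c : (Fin (n + 1) → S) → A) (a : S)
    (x : Fin (n + 1) → S) :
    alternatingFaceSum c (Fin.cons a x) =
      c x - alternatingFaceSum (fun y => c (Fin.cons a y)) x := by
  unfold alternatingFaceSum
  rw [Fin.sum_univ_succ, sub_eq_add_neg, ← Finset.sum_neg_distrib]
  congr 1
  · simp only [Fin.val_zero, pow_zero, one_smul, Fin.succAbove_zero]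
    congr 1
  · refine Finset.sum_congr rfl fun i _ => ?_
    rw [Fin.val_succ, pow_succ, mul_neg_one, neg_smul]
    congr 3
    funext j
    refine Fin.cases ?_ (fun j => ?_) j <;> simp

/-- By `alternatingFaceSum_cons`, applying the operator twice on a list headed by `a` leaves the
same expression for `c(a, -)` on a shorter list. Alternation of `c` plays no role. -/
theorem alternatingFaceSum_alternatingFaceSum {n : ℕ} (c : (Fin n → S) → A)
    (x : Fin (n + 2) → S) : alternatingFaceSum (alternatingFaceSum c) x = 0 := by
  induction n with
  | zero =>
    have h : ∀ y z : Fin 0 → S, c y = c z := fun y z => congrArg c (Subsingleton.elim _ _)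
    simp [alternatingFaceSum, Fin.sum_univ_two, h _ default]
  | succ n ih =>
    obtain ⟨a, y, rfl⟩ : ∃ a y, x = Fin.cons a y := ⟨x 0, Fin.tail x, (Fin.cons_self_tail x).symm⟩
    rw [alternatingFaceSum_cons]
    have : (fun z => alternatingFaceSum c (Fin.cons a z)) =
        c - alternatingFaceSum fun z => c (Fin.cons a z) := by
      funext z
      exact alternatingFaceSum_cons c a z
    rw [this, alternatingFaceSum_sub, ih]
    simp

theorem alternatingFaceSum_comp_perm {n : ℕ} {c : (Fin n → S) → A} (x : Fin (n + 1) → S)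
    (hc : ∀ (i : Fin (n + 1)) (τ : Equiv.Perm (Fin n)),
      c ((x ∘ i.succAbove) ∘ τ) = ((Equiv.Perm.sign τ : ℤˣ) : ℤ) • c (x ∘ i.succAbove))
    (σ : Equiv.Perm (Fin (n + 1))) :
    alternatingFaceSum c (x ∘ σ) = ((Equiv.Perm.sign σ : ℤˣ) : ℤ) • alternatingFaceSum c x := by
  unfold alternatingFaceSum
  rw [Finset.smul_sum, ← Equiv.sum_comp σ fun i =>
    ((Equiv.Perm.sign σ : ℤˣ) : ℤ) • (-1 : ℤ) ^ (i : ℕ) • c (x ∘ i.succAbove)]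
  refine Finset.sum_congr rfl fun i _ => ?_
  obtain ⟨τ, hτ, hs⟩ := AbstractSimplicialComplex.exists_perm_succAbove σ i
  have : (x ∘ σ) ∘ i.succAbove = (x ∘ (σ i).succAbove) ∘ τ := by
    funext j; simp [hτ]
  rw [this, hc, smul_smul, smul_smul, hs]

/-- `x` lists without repetition the elements of a set in the family `F`. -/
def IsSimplexOf (F : Set S → Prop) {n : ℕ} (x : Fin n → S) : Prop :=
  Function.Injective x ∧ F (Set.range x)

theorem isSimplexOf_comp_perm {F : Set S → Prop} {n : ℕ} {x : Fin n → S}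
    (σ : Equiv.Perm (Fin n)) : IsSimplexOf F (x ∘ σ) ↔ IsSimplexOf F x := by
  unfold IsSimplexOf
  rw [σ.surjective.range_comp, σ.injective_comp]

theorem IsSimplexOf.succAbove {F : Set S → Prop} (hF : ∀ s t, F s → t ⊆ s → F t) {n : ℕ}
    {x : Fin (n + 1) → S} (hx : IsSimplexOf F x) (i : Fin (n + 1)) :
    IsSimplexOf F (x ∘ i.succAbove) :=
  ⟨hx.1.comp Fin.succAbove_right_injective, hF _ _ hx.2 (Set.range_comp_subset_range _ _)⟩

/-- Alternating functions on the simplices of `F`, extended by zero. -/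
def IsCochain (F : Set S → Prop) {n : ℕ} (c : (Fin n → S) → A) : Prop :=
  (∀ x, ¬ IsSimplexOf F x → c x = 0) ∧
    ∀ (x : Fin n → S) (σ : Equiv.Perm (Fin n)),
      c (x ∘ σ) = ((Equiv.Perm.sign σ : ℤˣ) : ℤ) • c x

theorem IsCochain.sub {F : Set S → Prop} {n : ℕ} {c c' : (Fin n → S) → A} (h : IsCochain F c)
    (h' : IsCochain F c') : IsCochain F (c - c') :=
  ⟨fun x hx => by simp [h.1 x hx, h'.1 x hx], fun x σ => by simp [h.2 x σ, h'.2 x σ, smul_sub]⟩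

theorem IsCochain.add {F : Set S → Prop} {n : ℕ} {c c' : (Fin n → S) → A} (h : IsCochain F c)
    (h' : IsCochain F c') : IsCochain F (c + c') :=
  ⟨fun x hx => by simp [h.1 x hx, h'.1 x hx], fun x σ => by simp [h.2 x σ, h'.2 x σ, smul_add]⟩

/-- The coboundary of an alternating cochain. -/
theorem IsCochain.coboundary {F : Set S → Prop} {n : ℕ} {c : (Fin n → S) → A}
    (h : IsCochain F c) [DecidablePred fun x : Fin (n + 1) → S => IsSimplexOf F x] :
    IsCochain F fun x => if IsSimplexOf F x then alternatingFaceSum c x else 0 := by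
  refine ⟨fun x hx => if_neg hx, fun x σ => ?_⟩
  simp only [isSimplexOf_comp_perm]
  split_ifs
  · exact alternatingFaceSum_comp_perm x (fun i τ => h.2 _ τ) σ
  · simp

/-- The augmented complex of alternating `A`-valued cochains on the simplices of `F` is exact at
the cochains on `n`-tuples, i.e. the reduced cohomology of `F` vanishes in degree `n - 1`. -/
def IsAcyclicAt (F : Set S → Prop) (A : Type*) [AddCommGroup A] : ℕ → Prop
  | 0 => ∀ c : (Fin 0 → S) → A, IsCochain F c →
      (∀ x, IsSimplexOf F x → alternatingFaceSum c x = 0) → c = 0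
  | n + 1 => ∀ c : (Fin (n + 1) → S) → A, IsCochain F c →
      (∀ x, IsSimplexOf F x → alternatingFaceSum c x = 0) →
      ∃ g : (Fin n → S) → A, IsCochain F g ∧ ∀ x, IsSimplexOf F x → c x = alternatingFaceSum g x

theorem isAcyclicAt_of_isEmpty {F : Set S → Prop} {n : ℕ}
    (h : ∀ x : Fin (n + 1) → S, ¬ IsSimplexOf F x) : IsAcyclicAt F A (n + 1) :=
  fun _ _ _ => ⟨0, ⟨fun _ _ => rfl, fun _ _ => by simp⟩, fun x hx => (h x hx).elim⟩

theorem isAcyclicAt_of_card_lt [Finite S] {F : Set S → Prop} {n : ℕ} (h : Nat.card S < n) :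
    IsAcyclicAt F A n := by
  obtain ⟨m, rfl⟩ : ∃ m, n = m + 1 := ⟨n - 1, by lia⟩
  refine isAcyclicAt_of_isEmpty fun x hx => ?_
  have := Nat.card_le_card_of_injective x hx.1
  simp at this
  lia

theorem alternatingFaceSum_map {A' : Type*} [AddCommGroup A'] (φ : A →+ A') {n : ℕ}
    (c : (Fin n → S) → A) (x : Fin (n + 1) → S) :
    alternatingFaceSum (φ ∘ c) x = φ (alternatingFaceSum c x) := by
  simp [alternatingFaceSum]

theorem IsCochain.map {F : Set S → Prop} {A' : Type*} [AddCommGroup A'] (φ : A →+ A') {n : ℕ}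
    {c : (Fin n → S) → A} (hc : IsCochain F c) : IsCochain F (φ ∘ c) :=
  ⟨fun x hx => by simp [hc.1 x hx], fun x σ => by simp [hc.2 x σ]⟩

theorem IsAcyclicAt.congr_equiv {F : Set S → Prop} {A' : Type*} [AddCommGroup A'] (φ : A ≃+ A')
    {n : ℕ} (h : IsAcyclicAt F A n) : IsAcyclicAt F A' n := by
  cases n with
  | zero =>
    intro c hc hd
    have := h (φ.symm ∘ c) (hc.map φ.symm.toAddMonoidHom) fun x hx => by
      have := alternatingFaceSum_map φ.symm.toAddMonoidHom c x
      rw [hd x hx, map_zero] at this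
      exact this
    funext x
    simpa using congrFun this x
  | succ n =>
    intro c hc hd
    obtain ⟨g, hg, hgc⟩ := h (φ.symm ∘ c) (hc.map φ.symm.toAddMonoidHom) fun x hx => by
      have := alternatingFaceSum_map φ.symm.toAddMonoidHom c x
      rw [hd x hx, map_zero] at this
      exact this
    refine ⟨φ ∘ g, hg.map φ.toAddMonoidHom, fun x hx => ?_⟩
    have := alternatingFaceSum_map φ.toAddMonoidHom g x
    refine Eq.trans ?_ this.symm
    rw [← hgc x hx]
    simp

/-- Finitely supported families of cochains have a finite number of nonzero components. -/
theorem IsAcyclicAt.finsupp [Finite S] {F : Set S → Prop} {n : ℕ} (I : Type*)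
    (h : IsAcyclicAt F A n) : IsAcyclicAt F (I →₀ A) n := by
  have key : ∀ {m : ℕ} (c : (Fin m → S) → I →₀ A) i x,
      alternatingFaceSum (fun y => c y i) x = alternatingFaceSum c x i := by
    intro m c i x
    simp [alternatingFaceSum]
  have key2 : ∀ {m : ℕ} {c : (Fin m → S) → I →₀ A}, IsCochain F c → ∀ i,
      IsCochain F fun y => c y i := fun hc i =>
    ⟨fun x hx => by simp [hc.1 x hx], fun x σ => by simp [hc.2 x σ]⟩
  cases n with
  | zero =>
    intro c hc hd
    funext x
    ext i
    exact congrFun (h _ (key2 hc i) fun x hx => by rw [key, hd x hx]; rfl) x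
  | succ n =>
    intro c hc hd
    have := fun i => h _ (key2 hc i) fun x hx => by rw [key, hd x hx]; rfl
    choose g hg hgc using this
    classical
    have hfin : {i | ∃ x, c x i ≠ 0}.Finite := by
      have : {i | ∃ x, c x i ≠ 0} = ⋃ x, ((c x).support : Set I) := by
        ext i; simp
      rw [this]
      exact Set.finite_iUnion fun x => Finset.finite_toSet _
    -- The chosen primitives `g i` may be nonzero for infinitely many `i`; they are replaced by zero
    -- wherever the component of `c` vanishes.
    let G : (Fin n → S) → I →₀ A := fun y =>
      Finsupp.onFinset hfin.toFinset (fun i => if ∃ x, c x i ≠ 0 then g i y else 0) (by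
        intro i hi
        by_contra h1
        exact hi (if_neg (by simpa using h1)))
    refine ⟨G, ⟨fun x hx => ?_, fun x σ => ?_⟩, fun x hx => ?_⟩
    · ext i
      simp [G, (hg i).1 x hx]
    · ext i
      simp only [G, Finsupp.onFinset_apply, (hg i).2 x σ, Finsupp.smul_apply]
      split_ifs <;> simp
    · ext i
      rw [← key]
      simp only [G, Finsupp.onFinset_apply]
      by_cases h1 : ∃ x, c x i ≠ 0
      · simp only [if_pos h1]
        exact hgc i x hx
      · simp only [if_neg h1]
        rw [not_exists] at h1
        simpa [alternatingFaceSum] using h1 x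

/-- Alternating cochains may be transported along an injective map of vertices. -/
theorem isAcyclicAt_comap_iff {S' : Type*} {F : Set S → Prop} {F' : Set S' → Prop} {j : S' → S}
    (hj : Function.Injective j) (hF : ∀ s, F s → s ⊆ Set.range j) (hF' : ∀ s, F' s ↔ F (j '' s))
    (n : ℕ) : IsAcyclicAt F' A n ↔ IsAcyclicAt F A n := by
  classical
  have hs : ∀ {m : ℕ} (x : Fin m → S'), IsSimplexOf F (j ∘ x) ↔ IsSimplexOf F' x := by
    intro m x
    rw [IsSimplexOf, IsSimplexOf, hj.of_comp_iff, hF', Set.range_comp]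
  have hlift : ∀ {m : ℕ} (x : Fin m → S), IsSimplexOf F x → ∃ y, x = j ∘ y := by
    intro m x hx
    have : ∀ i, ∃ b, j b = x i := fun i => hF _ hx.2 ⟨i, rfl⟩
    choose y hy using this
    exact ⟨y, funext fun i => (hy i).symm⟩
  have hdown : ∀ {m : ℕ} {c : (Fin m → S) → A}, IsCochain F c → IsCochain F' fun y => c (j ∘ y) :=
    fun hc => ⟨fun x hx => hc.1 _ (by rwa [hs]), fun x σ => hc.2 (j ∘ x) σ⟩
  have hsum : ∀ {m : ℕ} (c : (Fin m → S) → A) (x : Fin (m + 1) → S'),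
      alternatingFaceSum c (j ∘ x) = alternatingFaceSum (fun y => c (j ∘ y)) x := fun c x => rfl
  have hup : ∀ {m : ℕ} {c : (Fin m → S') → A}, IsCochain F' c →
      ∃ c' : (Fin m → S) → A, IsCochain F c' ∧ ∀ y, c' (j ∘ y) = c y := by
    intro m c hc
    have hinj : Function.Injective fun y : Fin m → S' => j ∘ y := hj.comp_left
    -- Extension by zero: a simplex of `F` has exactly one preimage list, as `j` is injective and
    -- its range contains all simplices.
    refine ⟨fun x => if h : IsSimplexOf F x then c (hlift x h).choose else 0,
      ⟨fun x hx => dif_neg hx, fun x σ => ?_⟩, fun y => ?_⟩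
    · by_cases h : IsSimplexOf F x
      · have h' : IsSimplexOf F (x ∘ σ) := (isSimplexOf_comp_perm σ).mpr h
        simp only [dif_pos h, dif_pos h']
        rw [← hc.2]
        congr 1
        apply hinj
        change j ∘ _ = j ∘ _ ∘ σ
        rw [← (hlift _ h').choose_spec, ← Function.comp_assoc, ← (hlift _ h).choose_spec]
      · beta_reduce
        rw [dif_neg h, dif_neg (by rwa [isSimplexOf_comp_perm]), smul_zero]
    · by_cases h : IsSimplexOf F (j ∘ y)
      · simp only [dif_pos h]
        congr 1
        exact hinj (hlift _ h).choose_spec.symm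
      · beta_reduce
        rw [dif_neg h, hc.1]
        rwa [← hs]
  cases n with
  | zero =>
    constructor
    · intro h c hc hd
      have := h _ (hdown hc) fun x hx => by rw [← hsum]; exact hd _ ((hs x).2 hx)
      funext x
      have h1 := congrFun this default
      rwa [show j ∘ default = x from Subsingleton.elim _ _] at h1
    · intro h c hc hd
      obtain ⟨c', hc', hcc⟩ := hup hc
      have := h c' hc' fun x hx => by
        obtain ⟨y, rfl⟩ := hlift x hx
        rw [hsum]
        simp only [hcc]
        exact hd y ((hs y).1 hx)
      funext y
      rw [← hcc, this]
      rfl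
  | succ n =>
    constructor
    · intro h c hc hd
      obtain ⟨g, hg, hgc⟩ := h _ (hdown hc) fun x hx => by rw [← hsum]; exact hd _ ((hs x).2 hx)
      obtain ⟨g', hg', hgg⟩ := hup hg
      refine ⟨g', hg', fun x hx => ?_⟩
      obtain ⟨y, rfl⟩ := hlift x hx
      rw [hsum]
      simp only [hgg]
      exact hgc y ((hs y).1 hx)
    · intro h c hc hd
      obtain ⟨c', hc', hcc⟩ := hup hc
      obtain ⟨g, hg, hgc⟩ := h c' hc' fun x hx => by
        obtain ⟨y, rfl⟩ := hlift x hx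
        rw [hsum]
        simp only [hcc]
        exact hd y ((hs y).1 hx)
      refine ⟨_, hdown hg, fun x hx => ?_⟩
      rw [← hsum, ← hcc, hgc _ ((hs x).2 hx)]

/-- A nonempty family of simplices has no cohomology in degree `-1`; the empty one does. -/
theorem not_isAcyclicAt_zero [Nontrivial A] {F : Set S → Prop} (h0 : F ∅)
    (h : ∀ x : Fin 1 → S, ¬ IsSimplexOf F x) : ¬ IsAcyclicAt F A 0 := by
  intro hF
  obtain ⟨a, ha⟩ := exists_ne (0 : A)
  refine ha (congrFun (hF (fun _ => a) ⟨fun x hx => (hx ⟨?_, ?_⟩).elim, fun x σ => ?_⟩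
    fun x hx => (h x hx).elim) default)
  · exact Function.injective_of_subsingleton x
  · rwa [Set.range_eq_empty]
  · rw [Subsingleton.elim σ 1]; simp

end Cochains

/-! ### Reduced simplicial cohomology in terms of acyclicity. -/

namespace AbstractSimplicialComplex

variable {V : Type v} (k : Type u) [CommRing k]

/-- The faces of a complex, together with the empty set, as a family of sets. -/
def IsFaceOrEmpty (K : AbstractSimplicialComplex V) (s : Set V) : Prop :=
  s = ∅ ∨ ∃ t ∈ K.faces, (t : Set V) = s

theorem isOrderedSimplex_iff (K : AbstractSimplicialComplex V) {n : ℕ} (x : Fin n → V) :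
    K.IsOrderedSimplex x ↔ IsSimplexOf K.IsFaceOrEmpty x := by
  unfold IsOrderedSimplex IsSimplexOf IsFaceOrEmpty
  rw [Set.range_eq_empty_iff]
  refine and_congr_right fun _ => or_congr ?_ Iff.rfl
  cases n with
  | zero => simp [Fin.isEmpty]
  | succ n => simp

theorem mem_cochainSubmodule_iff (K : AbstractSimplicialComplex V) {n : ℕ}
    (c : (Fin n → V) → k) : c ∈ K.cochainSubmodule k n ↔ IsCochain K.IsFaceOrEmpty c := by
  unfold IsCochain
  simp only [← isOrderedSimplex_iff]
  rfl

theorem coboundary_eq_iff (K : AbstractSimplicialComplex V) {n : ℕ} (c : K.Cochains k n)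
    (d : K.Cochains k (n + 1)) : K.coboundary k n c = d ↔
      ∀ x, IsSimplexOf K.IsFaceOrEmpty x → alternatingFaceSum c.1 x = d.1 x := by
  constructor
  · rintro rfl x hx
    exact (if_pos ((K.isOrderedSimplex_iff x).2 hx)).symm
  · intro h
    refine Subtype.ext (funext fun x => ?_)
    by_cases hx : K.IsOrderedSimplex x
    · exact (if_pos hx).trans (h x ((K.isOrderedSimplex_iff x).1 hx))
    · exact (if_neg hx).trans (d.2.1 x hx).symm

/-- This elementwise form makes sense for coefficients in any abelian group and for any family of
vertex sets, which is how the monoid cohomology will appear. -/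
theorem subsingleton_reducedCohomologySubOne_iff (K : AbstractSimplicialComplex V) (n : ℕ) :
    Subsingleton (K.ReducedCohomologySubOne k n) ↔ IsAcyclicAt K.IsFaceOrEmpty k n := by
  have h0 : Subsingleton (K.ReducedCohomologySubOne k n) ↔
      ∀ c : K.Cochains k n, K.coboundary k n c = 0 → c ∈ K.coboundaries k n := by
    rw [Submodule.Quotient.subsingleton_iff, Submodule.comap_subtype_eq_top]
    exact Iff.rfl
  rw [h0]
  cases n with
  | zero =>
    constructor
    · intro h c hc hd
      let c' : K.Cochains k 0 := ⟨c, (K.mem_cochainSubmodule_iff k c).2 hc⟩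
      have h1 : c' = 0 := h c' ((K.coboundary_eq_iff k c' 0).2 fun x hx => hd x hx)
      exact congrArg Subtype.val h1
    · intro h c hd
      change c = 0
      exact Subtype.ext (h c.1 ((K.mem_cochainSubmodule_iff k _).1 c.2)
        fun x hx => (K.coboundary_eq_iff k _ _).1 hd x hx)
  | succ n =>
    constructor
    · intro h c hc hd
      obtain ⟨g, hg⟩ := h ⟨c, (K.mem_cochainSubmodule_iff k c).2 hc⟩
        ((K.coboundary_eq_iff k _ _).2 fun x hx => hd x hx)
      exact ⟨g.1, (K.mem_cochainSubmodule_iff k _).1 g.2,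
        fun x hx => ((K.coboundary_eq_iff k _ _).1 hg x hx).symm⟩
    · intro h c hd
      obtain ⟨g, hg, hgc⟩ := h c.1 ((K.mem_cochainSubmodule_iff k _).1 c.2)
        fun x hx => (K.coboundary_eq_iff k _ _).1 hd x hx
      exact ⟨⟨g, (K.mem_cochainSubmodule_iff k _).2 hg⟩,
        (K.coboundary_eq_iff k _ _).2 fun x hx => (hgc x hx).symm⟩

end AbstractSimplicialComplex

/-! ### Dimension shifting -/

section DimensionShifting

universe u₁ v₁ w₁

variable {C : Type u₁} [Category.{v₁} C] [Abelian C]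

/-- The first step of a coresolution cut off as a short exact sequence, with the kernel of `d₁` as
cosyzygy. Exactness in the middle is inherited since the kernel embeds in `K₁`. -/
theorem shortExact_kernelLift {V K₀ K₁ K₂ : C} {ι : V ⟶ K₀} {d₀ : K₀ ⟶ K₁} {d₁ : K₁ ⟶ K₂} [Mono ι]
    {w₀ : ι ≫ d₀ = 0} (e₀ : (ShortComplex.mk _ _ w₀).Exact) {w : d₀ ≫ d₁ = 0}
    (e : (ShortComplex.mk _ _ w).Exact) :
    (ShortComplex.mk ι (Limits.kernel.lift d₁ d₀ w) (by
      rw [← cancel_mono (Limits.kernel.ι d₁)]; simpa using w₀)).ShortExact := by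
  have := e.epi_kernelLift
  refine { exact := ?_, mono_f := ‹_›, epi_g := this }
  let φ : ShortComplex.mk ι (Limits.kernel.lift d₁ d₀ w) (by
      rw [← cancel_mono (Limits.kernel.ι d₁)]; simpa using w₀) ⟶ ShortComplex.mk _ _ w₀ :=
    { τ₁ := 𝟙 V, τ₂ := 𝟙 K₀, τ₃ := Limits.kernel.ι d₁ }
  have h₁ : Epi φ.τ₁ := by dsimp [φ]; infer_instance
  have h₂ : IsIso φ.τ₂ := by dsimp [φ]; infer_instance
  have h₃ : Mono φ.τ₃ := by dsimp [φ]; infer_instance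
  exact (ShortComplex.exact_iff_of_epi_of_isIso_of_mono φ).2 e₀

variable [HasExt.{w₁} C]

theorem ext_zero_subsingleton_iff (X Y : C) :
    Subsingleton (Ext.{w₁} X Y 0) ↔ ∀ φ : X ⟶ Y, φ = 0 := by
  rw [Ext.homEquiv₀.subsingleton_congr]
  exact ⟨fun h φ => Subsingleton.elim _ _, fun h => ⟨fun a b => by rw [h a, h b]⟩⟩

theorem ext_subsingleton_congr_of_iso {X X' Y Y' : C} (e : X ≅ X') (f : Y ≅ Y') (n : ℕ) :
    Subsingleton (Ext.{w₁} X Y n) ↔ Subsingleton (Ext.{w₁} X' Y' n) := by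
  have key : ∀ {X X' Y Y' : C} (_ : X ≅ X') (_ : Y ≅ Y'), Subsingleton (Ext.{w₁} X Y n) →
      Subsingleton (Ext.{w₁} X' Y' n) := by
    intro X X' Y Y' e f h
    refine ⟨fun a b => ?_⟩
    have h1 : ∀ x : Ext.{w₁} X' Y' n, x = (Ext.mk₀ e.inv).comp
        (((Ext.mk₀ e.hom).comp (x.comp (Ext.mk₀ f.inv) (add_zero n)) (zero_add n)).comp
          (Ext.mk₀ f.hom) (add_zero n)) (zero_add n) := by
      intro x
      simp
    rw [h1 a, h1 b]
    congr 2
    exact Subsingleton.elim _ _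
  exact ⟨key e f, key e.symm f.symm⟩

variable {E : ShortComplex C} (hE : E.ShortExact)
include hE

theorem ShortExact.ext_subsingleton_middle (T : C) {n : ℕ} (h₁ : Subsingleton (Ext.{w₁} T E.X₁ n))
    (h₃ : Subsingleton (Ext.{w₁} T E.X₃ n)) : Subsingleton (Ext.{w₁} T E.X₂ n) := by
  refine subsingleton_of_forall_eq 0 fun x => ?_
  obtain ⟨y, rfl⟩ := Ext.covariant_sequence_exact₂ T hE x (Subsingleton.elim _ _)
  rw [Subsingleton.elim y 0, Ext.zero_comp]

theorem ShortExact.ext_subsingleton_right (T : C) {n : ℕ} (h₂ : Subsingleton (Ext.{w₁} T E.X₂ n))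
    (h₁ : Subsingleton (Ext.{w₁} T E.X₁ (n + 1))) : Subsingleton (Ext.{w₁} T E.X₃ n) := by
  refine subsingleton_of_forall_eq 0 fun x => ?_
  obtain ⟨y, rfl⟩ := Ext.covariant_sequence_exact₃ T hE x rfl (Subsingleton.elim _ _)
  rw [Subsingleton.elim y 0, Ext.zero_comp]

theorem ShortExact.ext_subsingleton_shift_iff (T : C)
    (h : ∀ q, Subsingleton (Ext.{w₁} T E.X₂ (q + 1))) (n : ℕ) :
    Subsingleton (Ext.{w₁} T E.X₁ (n + 2)) ↔ Subsingleton (Ext.{w₁} T E.X₃ (n + 1)) := by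
  constructor
  · intro h₁
    exact ShortExact.ext_subsingleton_right hE T (h n) h₁
  · intro h₃
    refine subsingleton_of_forall_eq 0 fun x => ?_
    have := h (n + 1)
    obtain ⟨y, rfl⟩ := Ext.covariant_sequence_exact₁ T hE x (Subsingleton.elim _ _)
      (show n + 1 + 1 = n + 2 from rfl)
    rw [Subsingleton.elim y 0, Ext.zero_comp]

/-- Degree one is separate from the shift: `Hom(T, X₂)` need not vanish, so `Ext¹(T, X₁)` is the
cokernel of `Hom(T, X₂) → Hom(T, X₃)`. -/
theorem ShortExact.ext_one_subsingleton_iff (T : C)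
    (h : Subsingleton (Ext.{w₁} T E.X₂ 1)) :
    Subsingleton (Ext.{w₁} T E.X₁ 1) ↔ ∀ φ : T ⟶ E.X₃, ∃ ψ : T ⟶ E.X₂, ψ ≫ E.g = φ := by
  constructor
  · intro h₁ φ
    obtain ⟨y, hy⟩ := Ext.covariant_sequence_exact₃ T hE (Ext.mk₀ φ) rfl (Subsingleton.elim _ _)
    obtain ⟨ψ, rfl⟩ := Ext.homEquiv₀.symm.surjective y
    refine ⟨ψ, ?_⟩
    apply Ext.homEquiv₀.symm.injective
    simpa using hy
  · intro h₃
    refine subsingleton_of_forall_eq 0 fun x => ?_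
    obtain ⟨y, rfl⟩ := Ext.covariant_sequence_exact₁ T hE x (Subsingleton.elim _ _) (zero_add 1)
    obtain ⟨φ, rfl⟩ := Ext.homEquiv₀.symm.surjective y
    obtain ⟨ψ, rfl⟩ := h₃ φ
    have : Ext.homEquiv₀.symm (ψ ≫ E.g) =
        (Ext.mk₀ ψ).comp (Ext.mk₀ E.g) (add_zero 0) := by simp
    rw [this, Ext.comp_assoc_of_second_deg_zero, hE.comp_extClass, Ext.comp_zero]

theorem ShortExact.ext_subsingleton_contra_shift_iff (Y : C)
    (h : ∀ q, Subsingleton (Ext.{w₁} E.X₂ Y (q + 1))) (n : ℕ) :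
    Subsingleton (Ext.{w₁} E.X₃ Y (n + 2)) ↔ Subsingleton (Ext.{w₁} E.X₁ Y (n + 1)) := by
  constructor
  · intro h₁
    refine subsingleton_of_forall_eq 0 fun x => ?_
    have := h n
    obtain ⟨y, rfl⟩ := Ext.contravariant_sequence_exact₁ hE Y x
      (show 1 + (n + 1) = n + 2 by lia) (Subsingleton.elim _ _)
    rw [Subsingleton.elim y 0, Ext.comp_zero]
  · intro h₃
    refine subsingleton_of_forall_eq 0 fun x => ?_
    have := h (n + 1)
    obtain ⟨y, rfl⟩ := Ext.contravariant_sequence_exact₃ hE Y x (Subsingleton.elim _ _)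
      (show 1 + (n + 1) = n + 2 by lia)
    rw [Subsingleton.elim y 0, Ext.comp_zero]

theorem ShortExact.ext_one_subsingleton_contra_iff (Y : C)
    (h : Subsingleton (Ext.{w₁} E.X₂ Y 1)) :
    Subsingleton (Ext.{w₁} E.X₃ Y 1) ↔ ∀ φ : E.X₁ ⟶ Y, ∃ ψ : E.X₂ ⟶ Y, E.f ≫ ψ = φ := by
  constructor
  · intro h₁ φ
    obtain ⟨y, hy⟩ := Ext.contravariant_sequence_exact₁ hE Y (Ext.mk₀ φ)
      (show 1 + 0 = 1 from rfl) (Subsingleton.elim _ _)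
    obtain ⟨ψ, rfl⟩ := Ext.homEquiv₀.symm.surjective y
    refine ⟨ψ, ?_⟩
    apply Ext.homEquiv₀.symm.injective
    simpa using hy
  · intro h₃
    refine subsingleton_of_forall_eq 0 fun x => ?_
    obtain ⟨y, rfl⟩ := Ext.contravariant_sequence_exact₃ hE Y x (Subsingleton.elim _ _)
      (show 1 + 0 = 1 from rfl)
    obtain ⟨φ, rfl⟩ := Ext.homEquiv₀.symm.surjective y
    obtain ⟨ψ, rfl⟩ := h₃ φ
    have : Ext.homEquiv₀.symm (E.f ≫ ψ) =
        (Ext.mk₀ E.f).comp (Ext.mk₀ ψ) (zero_add 0) := by simp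
    rw [this]
    exact hE.extClass_comp_assoc _

omit hE

/-- The groups `Ext` can be computed from an acyclic coresolution. -/
theorem ext_subsingleton_iff_of_coresolution (T : C) (n : ℕ) :
    ∀ {V : C} {K : ℕ → C} {d : ∀ n, K n ⟶ K (n + 1)} {ι : V ⟶ K 0} [Mono ι] (w₀ : ι ≫ d 0 = 0)
      (_ : (ShortComplex.mk _ _ w₀).Exact) (w : ∀ n, d n ≫ d (n + 1) = 0)
      (_ : ∀ n, (ShortComplex.mk _ _ (w n)).Exact)
      (_ : ∀ n q, Subsingleton (Ext.{w₁} T (K n) (q + 1))),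
      Subsingleton (Ext.{w₁} T V (n + 1)) ↔
        ∀ φ : T ⟶ K (n + 1), φ ≫ d (n + 1) = 0 → ∃ ψ : T ⟶ K n, ψ ≫ d n = φ := by
  induction n with
  | zero =>
    intro V K d ι _ w₀ e₀ w e h
    have hS := shortExact_kernelLift e₀ (e 0)
    rw [ShortExact.ext_one_subsingleton_iff hS T (h 0 0)]
    constructor
    · intro h1 φ hφ
      obtain ⟨ψ, hψ⟩ := h1 (Limits.kernel.lift _ φ hφ)
      refine ⟨ψ, ?_⟩
      simpa using congrArg (· ≫ Limits.kernel.ι (d 1)) hψ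
    · intro h1 φ
      obtain ⟨ψ, hψ⟩ := h1 (φ ≫ Limits.kernel.ι (d 1)) (by simp)
      refine ⟨ψ, ?_⟩
      rw [← cancel_mono (Limits.kernel.ι (d 1)), ← hψ, Category.assoc]
      exact congrArg _ (Limits.kernel.lift_ι _ _ _)
  | succ n ih =>
    intro V K d ι _ w₀ e₀ w e h
    rw [ShortExact.ext_subsingleton_shift_iff (shortExact_kernelLift e₀ (e 0)) T (h 0)]
    -- The shifted complex coresolves the kernel of `d 1`, which takes the place of `V`.
    exact ih (K := fun n => K (n + 1)) (d := fun n => d (n + 1)) (Limits.kernel.condition (d 1))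
      (ShortComplex.exact_of_f_is_kernel _ (Limits.kernelIsKernel (d 1)))
      (fun n => w (n + 1)) (fun n => e (n + 1)) fun n => h (n + 1)

end DimensionShifting

/-! ### Modules over monoid rings -/

section MonoidModules

variable {B : Type v} [Monoid B]

/-- An additive map that commutes with the monoid is linear over the monoid ring. -/
def linearMapOfComm {k : Type u} [CommRing k] {X Y : Type*} [AddCommGroup X] [AddCommGroup Y]
    [Module k[B] X] [Module k[B] Y] (f : X →+ Y)
    (h : ∀ (b : B) (r : k) x, f (MonoidAlgebra.single b r • x) = MonoidAlgebra.single b r • f x) :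
    X →ₗ[k[B]] Y where
  toFun := f
  map_add' := map_add f
  map_smul' a x := by
    induction a using MonoidAlgebra.induction_linear with
    | zero => simp
    | add a b ha hb => simp_all [add_smul]
    | single b r => exact h b r x

theorem single_int_smul {X : Type*} [AddCommGroup X] [Module ℤ[B] X] (b : B) (r : ℤ) (x : X) :
    (MonoidAlgebra.single b r : ℤ[B]) • x = r • ((MonoidAlgebra.single b 1 : ℤ[B]) • x) := by
  rw [← smul_assoc]
  simp

/-- An additive map that commutes with the monoid is linear over the integral monoid ring. -/
def intLinearMapOfComm {X Y : Type*} [AddCommGroup X] [AddCommGroup Y]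
    [Module ℤ[B] X] [Module ℤ[B] Y] (f : X →+ Y)
    (h : ∀ (b : B) x, f ((MonoidAlgebra.single b 1 : ℤ[B]) • x) =
      (MonoidAlgebra.single b 1 : ℤ[B]) • f x) : X →ₗ[ℤ[B]] Y :=
  linearMapOfComm f fun b r x => by
    rw [single_int_smul, map_zsmul, h, ← single_int_smul]

/-- The kernel of a surjective homomorphism onto a `ℤ`-projective module is a direct summand. -/
theorem projective_int_of_exact {K X Y : Type*} [AddCommGroup K] [AddCommGroup X] [AddCommGroup Y]
    [Module.Projective ℤ X] [Module.Projective ℤ Y] (i : K →+ X) (f : X →+ Y)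
    (hi : Function.Injective i) (hf : Function.Surjective f) (h : ∀ x, f x = 0 ↔ ∃ y, i y = x) :
    Module.Projective ℤ K ∧ ∃ r : X →+ K, ∀ y, r (i y) = y := by
  obtain ⟨s, hs⟩ := Module.projective_lifting_property f.toIntLinearMap LinearMap.id hf
  have hs' : ∀ y, f (s y) = y := fun y => LinearMap.congr_fun hs y
  have hx : ∀ x, ∃ y, i y = x - s (f x) := fun x => (h _).1 (by simp [hs'])
  choose r hr using hx
  let r' : X →+ K := AddMonoidHom.mk' r fun a b => hi (by simp [hr]; abel)
  have hr' : ∀ y, r' (i y) = y := fun y => hi (by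
    change i (r (i y)) = _
    rw [hr, (h (i y)).2 ⟨y, rfl⟩, map_zero, sub_zero])
  exact ⟨Module.Projective.of_split i.toIntLinearMap r'.toIntLinearMap (LinearMap.ext hr'), r', hr'⟩

/-- A module into which homomorphisms extend along `ℤ`-split inclusions is acyclic for
`Ext(T, -)` whenever `T` is projective over `ℤ`. -/
theorem ext_subsingleton_of_extension {C : ModuleCat.{max w v} ℤ[B]}
    (hC : ∀ (X : ModuleCat.{max w v} ℤ[B]) (K : Submodule ℤ[B] X) (r : X →+ K) (_ : ∀ x : K, r x = x)
      (φ : K →ₗ[ℤ[B]] C), ∃ ψ : X →ₗ[ℤ[B]] C, ∀ x : K, ψ x = φ x) (q : ℕ) :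
    ∀ (T : ModuleCat.{max w v} ℤ[B]) [Module.Projective ℤ T],
      Subsingleton (Ext.{max w v} T C (q + 1)) := by
  -- A free cover of `T` splits over `ℤ`, so its kernel is again `ℤ`-projective. This keeps the
  -- induction running and makes the extension hypothesis applicable.
  have key : ∀ (T : ModuleCat.{max w v} ℤ[B]) [Module.Projective ℤ T],
      ∃ (E : ShortComplex (ModuleCat.{max w v} ℤ[B])) (_ : E.ShortExact), E.X₃ = T ∧
        Projective E.X₂ ∧ Module.Projective ℤ E.X₁ ∧
        ∀ φ : E.X₁ ⟶ C, ∃ ψ : E.X₂ ⟶ C, E.f ≫ ψ = φ := by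
    intro T _
    let π : (T →₀ ℤ[B]) →ₗ[ℤ[B]] T := Finsupp.linearCombination _ id
    have hπ : Function.Surjective π := Finsupp.linearCombination_id_surjective _ _
    let X := ModuleCat.of ℤ[B] (T →₀ ℤ[B])
    obtain ⟨h1, r, hr⟩ := projective_int_of_exact (K := LinearMap.ker π)
      (LinearMap.ker π).subtype.toAddMonoidHom π.toAddMonoidHom Subtype.val_injective hπ
      fun x => ⟨fun h => ⟨⟨x, h⟩, rfl⟩, fun ⟨y, hy⟩ => hy ▸ y.2⟩
    refine ⟨π.shortComplexKer, LinearMap.shortExact_shortComplexKer hπ, rfl, ?_, h1, ?_⟩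
    · exact ModuleCat.projective_of_free (Finsupp.basisSingleOne (R := ℤ[B]) (ι := T))
    · intro φ
      obtain ⟨ψ, hψ⟩ := hC X (LinearMap.ker π) r hr φ.hom
      exact ⟨ModuleCat.ofHom ψ, ModuleCat.hom_ext (LinearMap.ext hψ)⟩
  induction q with
  | zero =>
    intro T _
    obtain ⟨E, hE, rfl, hP, h1, h2⟩ := key T
    exact (ShortExact.ext_one_subsingleton_contra_iff hE C (Ext.subsingleton_of_projective _ _ _)).2 h2
  | succ q ih =>
    intro T _
    obtain ⟨E, hE, rfl, hP, h1, h2⟩ := key T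
    exact (ShortExact.ext_subsingleton_contra_shift_iff hE C
      (fun q => Ext.subsingleton_of_projective _ _ _) q).2 (ih E.X₁)

end MonoidModules

/-! ### The cone homotopy for alternating cochains -/

section Cone

variable {S : Type*} {A : Type*} [AddCommGroup A]

/-- A permutation of the tail, extended to fix the first position, keeps its sign. -/
theorem alternating_cons {n : ℕ} {c : (Fin (n + 1) → S) → A}
    (hc : ∀ (x : Fin (n + 1) → S) (σ : Equiv.Perm (Fin (n + 1))),
      c (x ∘ σ) = ((Equiv.Perm.sign σ : ℤˣ) : ℤ) • c x) (a : S) (x : Fin n → S)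
    (σ : Equiv.Perm (Fin n)) :
    c (Fin.cons a (x ∘ σ)) = ((Equiv.Perm.sign σ : ℤˣ) : ℤ) • c (Fin.cons a x) := by
  let τ := Equiv.Perm.decomposeFin.symm ((0 : Fin (n + 1)), σ)
  have h1 : (Fin.cons a (x ∘ σ) : Fin (n + 1) → S) = (Fin.cons a x : Fin (n + 1) → S) ∘ τ := by
    funext j
    refine Fin.cases ?_ (fun j => ?_) j <;> simp [τ]
  have h2 : Equiv.Perm.sign τ = Equiv.Perm.sign σ := by
    simp [τ, Equiv.Perm.decomposeFin.symm_sign]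
  rw [h1, hc, h2]

/-- The coboundary of an alternating cochain vanishes on lists with repetition. -/
theorem alternatingFaceSum_cons_of_mem {n : ℕ} {c : (Fin (n + 1) → S) → A}
    (hc : ∀ (x : Fin (n + 1) → S) (σ : Equiv.Perm (Fin (n + 1))),
      c (x ∘ σ) = ((Equiv.Perm.sign σ : ℤˣ) : ℤ) • c x)
    (hc0 : ∀ x, ¬ Function.Injective x → c x = 0) {a : S} {x : Fin (n + 1) → S}
    (ha : a ∈ Set.range x) : alternatingFaceSum (fun y => c (Fin.cons a y)) x = c x := by
  -- If `a` is the first entry, all faces but one contain `a` twice after prepending and contribute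
  -- zero. The general case follows by swapping `a` to the front, which multiplies both sides by the
  -- same sign.
  have key : ∀ x' : Fin n → S,
      alternatingFaceSum (fun y => c (Fin.cons a y)) (Fin.cons a x') = c (Fin.cons a x') := by
    intro x'
    cases n with
    | zero =>
      simp only [alternatingFaceSum, Fin.sum_univ_succ, Fin.sum_univ_zero]
      simp only [Fin.val_zero, pow_zero, one_smul, add_zero]
      congr 2
    | succ n =>
      rw [alternatingFaceSum_cons]
      have : ∀ y : Fin n → S, c (Fin.cons a (Fin.cons a y)) = 0 := fun y => hc0 _ fun h => by
        have := @h 0 (Fin.succ 0) (by rw [Fin.cons_zero, Fin.cons_succ, Fin.cons_zero])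
        simp at this
      simp [this, alternatingFaceSum]
  obtain ⟨j, rfl⟩ := ha
  have h1 := alternatingFaceSum_comp_perm (c := fun y => c (Fin.cons (x j) y)) x
    (fun i τ => alternating_cons hc _ _ τ) (Equiv.swap 0 j)
  have h2 : x ∘ Equiv.swap 0 j = Fin.cons (x j) (Fin.tail (x ∘ Equiv.swap 0 j)) := by
    conv_lhs => rw [← Fin.cons_self_tail (x ∘ Equiv.swap 0 j)]
    simp
  rw [h2, key, ← h2, hc] at h1
  have h3 := congrArg (fun t => ((Equiv.Perm.sign (Equiv.swap 0 j) : ℤˣ) : ℤ) • t) h1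
  simp only [smul_smul] at h3
  have h4 : ((Equiv.Perm.sign (Equiv.swap 0 j) : ℤˣ) : ℤ) *
      ((Equiv.Perm.sign (Equiv.swap 0 j) : ℤˣ) : ℤ) = 1 := by
    rw [← Units.val_mul, Int.units_mul_self, Units.val_one]
  rw [h4, one_smul, one_smul] at h3
  exact h3.symm

end Cone

/-! ### Coefficient systems on right ideals -/

section Coresolution

variable {B : Type v} [Monoid B]

/-- The action of a monoid on the functions on it, by translation of the argument. -/
def translationHom (B : Type v) [Monoid B] (X : Type*) [AddCommGroup X] :
    B →* AddMonoid.End (B → X) where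
  toFun b := { toFun := fun f y => f (y * b), map_zero' := rfl, map_add' := fun _ _ => rfl }
  map_one' := AddMonoidHom.ext fun f => funext fun y => congrArg f (mul_one y)
  map_mul' b b' := AddMonoidHom.ext fun f => funext fun y => congrArg f (mul_assoc y b b').symm

/-- The functions on a monoid, as a module over the monoid ring. -/
def MonoidFunctions (B : Type v) (X : Type*) : Type _ := B → X

instance (X : Type*) [AddCommGroup X] : AddCommGroup (MonoidFunctions B X) :=
  inferInstanceAs (AddCommGroup (B → X))

noncomputable instance (X : Type*) [AddCommGroup X] : Module (AddMonoid.End (B → X)) (MonoidFunctions B X) :=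
  inferInstanceAs (Module (AddMonoid.End (B → X)) (B → X))

noncomputable instance (X : Type*) [AddCommGroup X] : Module ℤ[B] (MonoidFunctions B X) :=
  Module.compHom _ (MonoidAlgebra.lift ℤ _ B (translationHom B X)).toRingHom

theorem MonoidFunctions.single_smul {X : Type*} [AddCommGroup X] (b : B) (f : MonoidFunctions B X)
    (y : B) : ((MonoidAlgebra.single b 1 : ℤ[B]) • f) y = f (y * b) := by
  change ((MonoidAlgebra.lift ℤ _ B (translationHom B X)) (MonoidAlgebra.single b 1) •
    (show B → X from f)) y = _
  rw [MonoidAlgebra.lift_single, one_smul]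
  rfl

/-- A subgroup that is stable under the monoid, as a submodule over the integral monoid ring. -/
def submoduleOfStable {X : Type*} [AddCommGroup X] [Module ℤ[B] X] (H : AddSubgroup X)
    (h : ∀ (b : B), ∀ x ∈ H, (MonoidAlgebra.single b 1 : ℤ[B]) • x ∈ H) : Submodule ℤ[B] X where
  carrier := H
  add_mem' := H.add_mem
  zero_mem' := H.zero_mem
  smul_mem' a x hx := by
    induction a using MonoidAlgebra.induction_linear with
    | zero => simp
    | add a b ha hb => rw [add_smul]; exact H.add_mem ha hb
    | single b r => rw [single_int_smul]; exact H.zsmul_mem (h b x hx) r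

/-- A family `F` of finite sets of vertices `v`, labelled by elements `ψ v` of a monoid, such that
the right ideals `ψ v B` cover the elements strictly below `e`, the intersection of those that
belong to a simplex is principal, and those that contain a given element `y < e` form a cone. -/
structure RightIdealCover {B : Type v} [Monoid B] (e : B) (S : Type*) where
  F : Set S → Prop
  ψ : S → B
  z : Set S → B
  lower : ∀ s t, F s → t ⊆ s → F t
  empty : F ∅
  z_mul : ∀ s, F s → ∀ y, z s * y = y ↔ e * y = y ∧ ∀ v ∈ s, ψ v * y = y
  mul_ne : ∀ s, F s → ∀ v ∈ s, ψ v * e ≠ e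
  apex : ∀ y, e * y = y → y ≠ e →
    ∃ a, ψ a * y = y ∧ ∀ s, F s → (∀ v ∈ s, ψ v * y = y) → F (insert a s)

variable {e : B} {S : Type v} (𝒰 : RightIdealCover e S)

namespace RightIdealCover

variable (A : Type w) [AddCommGroup A]

/-- The alternating cochains on the simplices, with values in the functions on the right ideals
attached to the simplices; a function on the principal right ideal `zB` is given as a function `f`
on `B` with `f (z y) = f y`. -/
noncomputable def cochainModule (n : ℕ) : Submodule ℤ[B] (MonoidFunctions B ((Fin n → S) → A)) :=
  submoduleOfStable
    { carrier := {f | (∀ y, IsCochain 𝒰.F (f y)) ∧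
        ∀ y x, IsSimplexOf 𝒰.F x → f (𝒰.z (Set.range x) * y) x = f y x}
      add_mem' := fun {f g} hf hg => ⟨fun y => (hf.1 y).add (hg.1 y), fun y x hx =>
        congrArg₂ (· + ·) (hf.2 y x hx) (hg.2 y x hx)⟩
      zero_mem' := ⟨fun y => ⟨fun _ _ => rfl, fun _ _ => (smul_zero _).symm⟩, fun _ _ _ => rfl⟩
      neg_mem' := fun {f} hf => ⟨fun y => by
        have := (hf.1 y).map (negAddMonoidHom : A →+ A)
        exact this, fun y x hx => congrArg Neg.neg (hf.2 y x hx)⟩ }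
    (fun b f hf => by
      refine ⟨fun y => ?_, fun y x hx => ?_⟩
      · rw [MonoidFunctions.single_smul]
        exact hf.1 _
      · rw [MonoidFunctions.single_smul, MonoidFunctions.single_smul, mul_assoc]
        exact hf.2 _ x hx)

variable {A}

theorem cochainModule_ext {n : ℕ} {f g : 𝒰.cochainModule A n}
    (h : ∀ y x, IsSimplexOf 𝒰.F x → f.1 y x = g.1 y x) : f = g := by
  refine Subtype.ext (funext fun y => funext fun x => ?_)
  by_cases hx : IsSimplexOf 𝒰.F x
  · exact h y x hx
  · rw [(f.2.1 y).1 x hx, (g.2.1 y).1 x hx]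

open Classical in
/-- The coboundary of an equivariant cochain. -/
noncomputable def coboundaryFun {n : ℕ} (f : B → (Fin n → S) → A) (y : B) (x : Fin (n + 1) → S) : A :=
  -- Faces of `x` carry functions on larger right ideals; evaluation at `z y` restricts them to the
  -- ideal of `x`.
  if IsSimplexOf 𝒰.F x then alternatingFaceSum (f (𝒰.z (Set.range x) * y)) x else 0

variable [IsLeftRegularBand B]

theorem z_mul_z_of_subset {s t : Set S} (hs : 𝒰.F s) (hts : t ⊆ s) :
    𝒰.z t * 𝒰.z s = 𝒰.z s := by
  have h := (𝒰.z_mul s hs (𝒰.z s)).1 (IsLeftRegularBand.mul_self _)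
  exact (𝒰.z_mul t (𝒰.lower s t hs hts) _).2 ⟨h.1, fun v hv => h.2 v (hts hv)⟩

/-- Both elements generate the same right ideal, and in a left regular band a principal right ideal
has only one generator. -/
theorem z_empty : 𝒰.z ∅ = e := by
  have h1 := ((𝒰.z_mul ∅ 𝒰.empty (𝒰.z ∅)).1 (IsLeftRegularBand.mul_self _)).1
  have h2 := (𝒰.z_mul ∅ 𝒰.empty e).2 ⟨IsLeftRegularBand.mul_self _, by simp⟩
  calc 𝒰.z ∅ = e * 𝒰.z ∅ := h1.symm
    _ = 𝒰.z ∅ * e * 𝒰.z ∅ := by rw [h2]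
    _ = e := by rw [IsLeftRegularBand.mul_mul_self, h2]

theorem coboundaryFun_mem {n : ℕ} {f : MonoidFunctions B ((Fin n → S) → A)}
    (hf : f ∈ 𝒰.cochainModule A n) :
    (show MonoidFunctions B ((Fin (n + 1) → S) → A) from 𝒰.coboundaryFun f) ∈
      𝒰.cochainModule A (n + 1) := by
  refine ⟨fun y => ⟨fun x hx => if_neg hx, fun x σ => ?_⟩, fun y x hx => ?_⟩
  · have hσ := isSimplexOf_comp_perm (F := 𝒰.F) (x := x) σ
    by_cases hx : IsSimplexOf 𝒰.F x
    · simp only [coboundaryFun, if_pos hx, if_pos (hσ.2 hx), σ.surjective.range_comp]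
      exact alternatingFaceSum_comp_perm x (fun i τ => (hf.1 _).2 _ τ) σ
    · simp only [coboundaryFun, if_neg hx, if_neg (mt hσ.1 hx), smul_zero]
  · simp only [coboundaryFun]
    rw [← mul_assoc, IsLeftRegularBand.mul_self]

variable (A) in
/-- The coboundary, as a map of modules. -/
noncomputable def coboundary (n : ℕ) : 𝒰.cochainModule A n →ₗ[ℤ[B]] 𝒰.cochainModule A (n + 1) :=
  intLinearMapOfComm
    (AddMonoidHom.mk' (G := 𝒰.cochainModule A (n + 1))
      (fun f : 𝒰.cochainModule A n => ⟨𝒰.coboundaryFun f.1, 𝒰.coboundaryFun_mem f.2⟩)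
      fun f g => by
      refine Subtype.ext (funext fun y => funext fun x => ?_)
      change 𝒰.coboundaryFun (f.1 + g.1) y x =
        𝒰.coboundaryFun f.1 y x + 𝒰.coboundaryFun g.1 y x
      by_cases hx : IsSimplexOf 𝒰.F x
      · simp only [coboundaryFun, if_pos hx]
        exact alternatingFaceSum_add _ _ _
      · simp [coboundaryFun, if_neg hx])
    fun b f => by
      refine Subtype.ext (funext fun y => funext fun x => ?_)
      change 𝒰.coboundaryFun ((MonoidAlgebra.single b 1 : ℤ[B]) • f.1) y x =
        ((MonoidAlgebra.single b 1 : ℤ[B]) •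
          (show MonoidFunctions B ((Fin (n + 1) → S) → A) from 𝒰.coboundaryFun f.1)) y x
      rw [MonoidFunctions.single_smul]
      simp only [coboundaryFun]
      rw [MonoidFunctions.single_smul, mul_assoc]

theorem coboundary_apply {n : ℕ} (f : 𝒰.cochainModule A n) (y : B) {x : Fin (n + 1) → S}
    (hx : IsSimplexOf 𝒰.F x) :
    (𝒰.coboundary A n f).1 y x = alternatingFaceSum (f.1 (𝒰.z (Set.range x) * y)) x :=
  if_pos hx

/-- Restricting first to the ideal of a face and then to that of `x` is restriction to the ideal of
`x`, so at each point this is the identity for plain cochains. -/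
theorem coboundary_coboundary {n : ℕ} (f : 𝒰.cochainModule A n) :
    𝒰.coboundary A (n + 1) (𝒰.coboundary A n f) = 0 := by
  refine 𝒰.cochainModule_ext fun y x hx => ?_
  rw [coboundary_apply _ _ _ hx]
  change _ = (0 : A)
  rw [← alternatingFaceSum_alternatingFaceSum (f.1 (𝒰.z (Set.range x) * y)) x]
  refine Finset.sum_congr rfl fun i _ => ?_
  rw [coboundary_apply _ _ _ (hx.succAbove 𝒰.lower i), ← mul_assoc,
    𝒰.z_mul_z_of_subset hx.2 (Set.range_comp_subset_range _ _)]

/-- The coboundaries exhaust the cocycles: over every `y < e` the simplices form a cone. -/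
theorem exists_coboundary_eq {n : ℕ} (f : 𝒰.cochainModule A (n + 1))
    (hf : 𝒰.coboundary A (n + 1) f = 0) : ∃ g, 𝒰.coboundary A n g = f := by
  classical
  let a : ∀ y, e * y = y ∧ y ≠ e → S := fun y h => (𝒰.apex y h.1 h.2).choose
  have ha : ∀ y h, 𝒰.ψ (a y h) * y = y ∧
      ∀ s, 𝒰.F s → (∀ v ∈ s, 𝒰.ψ v * y = y) → 𝒰.F (insert (a y h) s) := fun y h =>
    (𝒰.apex y h.1 h.2).choose_spec
  -- The cone contraction over `y`: prepend the apex of `y`. At `y = e` there is no apex; the value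
  -- `0` there is never needed, because the lists on which the identity is checked are nonempty and
  -- force `y ≠ e`.
  let H : B → (Fin n → S) → A := fun y x =>
    if h : e * y = y ∧ y ≠ e then f.1 y (Fin.cons (a y h) x) else 0
  -- The points `y` and `z y` may have different apexes; evaluating at `z y` makes `g` a function on
  -- the right ideal of the simplex.
  let g : MonoidFunctions B ((Fin n → S) → A) := fun y x =>
    if IsSimplexOf 𝒰.F x then H (𝒰.z (Set.range x) * y) x else 0
  have hg : g ∈ 𝒰.cochainModule A n := by
    refine ⟨fun y => ⟨fun x hx => if_neg hx, fun x σ => ?_⟩, fun y x hx => ?_⟩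
    · simp only [g, isSimplexOf_comp_perm, σ.surjective.range_comp]
      split_ifs
      · simp only [H]
        split_ifs
        · exact alternating_cons (f.2.1 _).2 _ _ _
        · simp
      · simp
    · simp only [g]
      rw [← mul_assoc, IsLeftRegularBand.mul_self]
  refine ⟨⟨g, hg⟩, 𝒰.cochainModule_ext fun y x hx => ?_⟩
  rw [coboundary_apply _ _ _ hx, ← f.2.2 y x hx]
  set y' := 𝒰.z (Set.range x) * y with hy'
  have hzy : 𝒰.z (Set.range x) * y' = y' := by
    rw [hy', ← mul_assoc, IsLeftRegularBand.mul_self]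
  have hle := (𝒰.z_mul _ hx.2 y').1 hzy
  have hne : e * y' = y' ∧ y' ≠ e := by
    refine ⟨hle.1, fun h => 𝒰.mul_ne _ hx.2 (x 0) ⟨0, rfl⟩ ?_⟩
    have := hle.2 _ ⟨0, rfl⟩
    rwa [h] at this
  have h1 : ∀ i : Fin (n + 1), g y' (x ∘ i.succAbove) =
      f.1 y' (Fin.cons (a y' hne) (x ∘ i.succAbove)) := by
    intro i
    have h2 : 𝒰.z (Set.range (x ∘ i.succAbove)) * y' = y' := by
      rw [← hzy, ← mul_assoc, 𝒰.z_mul_z_of_subset hx.2 (Set.range_comp_subset_range _ _)]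
    simp only [g, if_pos (hx.succAbove 𝒰.lower i), h2, H, dif_pos hne]
  have h2 : alternatingFaceSum (g y') x =
      alternatingFaceSum (fun t => f.1 y' (Fin.cons (a y' hne) t)) x :=
    Finset.sum_congr rfl fun i _ => by rw [h1]
  refine h2.trans ?_
  -- If the apex already occurs in `x`, the homotopy formula holds by alternation. Otherwise
  -- prepending it gives a simplex whose ideal contains `y'`, and the cocycle condition on that
  -- simplex is the formula.
  by_cases hax : a y' hne ∈ Set.range x
  · exact alternatingFaceSum_cons_of_mem (f.2.1 y').2
      (fun t ht => (f.2.1 y').1 t fun h => ht h.1) hax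
  · have hs : IsSimplexOf 𝒰.F (Fin.cons (a y' hne) x : Fin (n + 2) → S) := by
      refine ⟨Fin.cons_injective_iff.2 ⟨hax, hx.1⟩, ?_⟩
      rw [Fin.range_cons]
      exact (ha y' hne).2 _ hx.2 hle.2
    have h3 := coboundary_apply 𝒰 f y' hs
    have h4 : 𝒰.z (Set.range (Fin.cons (a y' hne) x : Fin (n + 2) → S)) * y' = y' := by
      refine (𝒰.z_mul _ hs.2 y').2 ⟨hle.1, ?_⟩
      rw [Fin.range_cons]
      rintro v (rfl | hv)
      · exact (ha y' hne).1
      · exact hle.2 v hv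
    rw [h4, alternatingFaceSum_cons, hf] at h3
    exact (sub_eq_zero.1 h3.symm).symm

/-- Homomorphisms into the cochain modules extend along `ℤ`-split inclusions. -/
theorem exists_extension {n : ℕ} {X : Type*} [AddCommGroup X] [Module ℤ[B] X] (K : Submodule ℤ[B] X)
    (r : X →+ K) (hr : ∀ x : K, r x = x) (φ : K →ₗ[ℤ[B]] 𝒰.cochainModule A n) :
    ∃ ψ : X →ₗ[ℤ[B]] 𝒰.cochainModule A n, ∀ x : K, ψ x = φ x := by
  -- For `t` in `K`, linearity gives `φ(t)(y) = φ((z y) t)(z)`. The right-hand side makes sense on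
  -- all of `X` once `r` is applied to `(z y) t`, and it is linear over the monoid ring although `r`
  -- is only additive.
  let ψ : X → MonoidFunctions B ((Fin n → S) → A) := fun t y x =>
    (φ (r ((MonoidAlgebra.single (𝒰.z (Set.range x) * y) 1 : ℤ[B]) • t))).1 (𝒰.z (Set.range x)) x
  have hψ : ∀ t, ψ t ∈ 𝒰.cochainModule A n := by
    refine fun t => ⟨fun y => ⟨fun x hx => ?_, fun x σ => ?_⟩, fun y x hx => ?_⟩
    · exact ((φ _).2.1 _).1 x hx
    · simp only [ψ, σ.surjective.range_comp]
      exact ((φ _).2.1 _).2 x σ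
    · simp only [ψ]
      rw [← mul_assoc, IsLeftRegularBand.mul_self]
  refine ⟨intLinearMapOfComm (AddMonoidHom.mk' (fun t => ⟨ψ t, hψ t⟩) fun t t' => ?_)
    fun b t => ?_, fun t => ?_⟩
  · refine Subtype.ext (funext fun y => funext fun x => ?_)
    change ψ (t + t') y x = ψ t y x + ψ t' y x
    simp only [ψ, smul_add, map_add]
    rfl
  · refine Subtype.ext (funext fun y => funext fun x => ?_)
    change ψ _ y x = ((MonoidAlgebra.single b 1 : ℤ[B]) • ψ t) y x
    rw [MonoidFunctions.single_smul]
    simp only [ψ]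
    rw [← mul_smul, MonoidAlgebra.single_mul_single, mul_one, mul_assoc]
  · refine 𝒰.cochainModule_ext fun y x hx => ?_
    change (φ (r ((MonoidAlgebra.single (𝒰.z (Set.range x) * y) 1 : ℤ[B]) • (t : X)))).1
      (𝒰.z (Set.range x)) x = _
    have h1 : r ((MonoidAlgebra.single (𝒰.z (Set.range x) * y) 1 : ℤ[B]) • (t : X)) =
        (MonoidAlgebra.single (𝒰.z (Set.range x) * y) 1 : ℤ[B]) • t :=
      hr ((MonoidAlgebra.single (𝒰.z (Set.range x) * y) 1 : ℤ[B]) • t)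
    rw [h1, map_smul]
    change ((MonoidAlgebra.single (𝒰.z (Set.range x) * y) 1 : ℤ[B]) • (φ t).1) _ x = _
    rw [MonoidFunctions.single_smul, ← mul_assoc, IsLeftRegularBand.mul_self]
    exact (φ t).2.2 y x hx

end RightIdealCover

end Coresolution

/-! ### Homomorphisms from the trivial module -/

section TrivialModule

variable {B : Type v} [Monoid B]

/-- The generator of the trivial module. -/
def trivialGenerator (B : Type v) [Monoid B] : trivialZModule.{v, w} B :=
  (ULift.up 1 : ULift.{w} ℤ)

theorem trivialZModule_smul (b : B) (t : trivialZModule.{v, w} B) :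
    (MonoidAlgebra.single b 1 : ℤ[B]) • t = t := by
  have h : augmentationHom B (MonoidAlgebra.single b 1) = 1 := by
    change (MonoidAlgebra.lift ℤ ℤ B (1 : B →* ℤ)) (MonoidAlgebra.single b 1) = 1
    simp
  change augmentationHom B (MonoidAlgebra.single b 1) • (show ULift.{w} ℤ from t) = t
  rw [h, one_smul]

theorem trivialZModule_eq_zsmul (t : trivialZModule.{v, w} B) :
    ∃ r : ℤ, t = r • trivialGenerator.{v, w} B := by
  have key : ∀ t : ULift.{w} ℤ, t = t.down • ULift.up 1 := fun t => ULift.ext _ _ (by simp)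
  exact ⟨_, key t⟩

theorem trivialZModule_hom_ext {E : ModuleCat.{w} ℤ[B]} {φ ψ : trivialZModule.{v, w} B ⟶ E}
    (h : φ.hom (trivialGenerator B) = ψ.hom (trivialGenerator B)) : φ = ψ := by
  ext t
  obtain ⟨r, rfl⟩ := trivialZModule_eq_zsmul t
  rw [map_zsmul, map_zsmul, h]

theorem single_smul_hom_trivialGenerator {E : ModuleCat.{w} ℤ[B]}
    (φ : trivialZModule.{v, w} B ⟶ E) (b : B) :
    (MonoidAlgebra.single b 1 : ℤ[B]) • φ.hom (trivialGenerator B) =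
      φ.hom (trivialGenerator B) := by
  rw [← map_smul, trivialZModule_smul]

/-- Together with `trivialZModule_hom_ext` and `single_smul_hom_trivialGenerator`, this identifies
homomorphisms from the trivial module with invariant elements. -/
theorem exists_trivialZModule_hom {E : ModuleCat.{w} ℤ[B]} (f : E)
    (h : ∀ b : B, (MonoidAlgebra.single b 1 : ℤ[B]) • f = f) :
    ∃ φ : trivialZModule.{v, w} B ⟶ E, φ.hom (trivialGenerator B) = f := by
  let g : trivialZModule.{v, w} B →+ E :=
    { toFun := fun t => (show ULift.{w} ℤ from t).down • f
      map_zero' := zero_zsmul f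
      map_add' := fun s t =>
        add_zsmul f (show ULift.{w} ℤ from s).down (show ULift.{w} ℤ from t).down }
  have hg : g (trivialGenerator B) = f := one_zsmul f
  have hcomm : ∀ (b : B) (t : trivialZModule.{v, w} B),
      g ((MonoidAlgebra.single b 1 : ℤ[B]) • t) = (MonoidAlgebra.single b 1 : ℤ[B]) • g t := by
    intro b t
    rw [trivialZModule_smul]
    obtain ⟨r, rfl⟩ := trivialZModule_eq_zsmul t
    rw [map_zsmul, hg, smul_comm, h]
  let φ : trivialZModule.{v, w} B →ₗ[ℤ[B]] E := intLinearMapOfComm g hcomm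
  let φ' := ModuleCat.ofHom φ
  exact ⟨φ', hg⟩

instance : Module.Projective ℤ (trivialZModule.{v, w} B) := by
  have : Module.Projective ℤ (ULift.{w} ℤ) :=
    Module.Projective.of_equiv (ULift.moduleEquiv : ULift.{w} ℤ ≃ₗ[ℤ] ℤ).symm
  exact Module.Projective.of_equiv
    (AddEquiv.refl (ULift.{w} ℤ) : ULift.{w} ℤ ≃+ trivialZModule.{v, w} B).toIntLinearEquiv

end TrivialModule

/-! ### Coresolutions and cohomology of concentrated modules. -/

section Concentrated

variable {B : Type v} [Monoid B] [IsLeftRegularBand B] {e : B}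

/-- A module on which an element `b` acts as the identity if `e b = e`, and as zero otherwise. -/
def IsConcentratedAt (e : B) (V : Type*) [AddCommGroup V] [Module ℤ[B] V] : Prop :=
  ∀ (b : B) (v : V), (e * b = e → (MonoidAlgebra.single b 1 : ℤ[B]) • v = v) ∧
    (e * b ≠ e → (MonoidAlgebra.single b 1 : ℤ[B]) • v = 0)

namespace RightIdealCover

variable {S : Type v} (𝒰 : RightIdealCover e S)

/-- A module concentrated at `e` embeds into the functions on the right ideal `eB`. -/
noncomputable def augmentation (V : Type w) [AddCommGroup V] [Module ℤ[B] V] :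
    V →ₗ[ℤ[B]] 𝒰.cochainModule V 0 :=
  intLinearMapOfComm
    (AddMonoidHom.mk' (G := 𝒰.cochainModule V 0)
      (fun t => ⟨fun y _ => (MonoidAlgebra.single (e * y) 1 : ℤ[B]) • t,
        fun y => ⟨fun x hx => (hx ⟨Function.injective_of_subsingleton x, by
          rw [Set.range_eq_empty]; exact 𝒰.empty⟩).elim, fun x σ => by
          rw [Subsingleton.elim σ 1]; simp⟩,
        fun y x _ => by
          beta_reduce
          rw [Set.range_eq_empty, 𝒰.z_empty, ← mul_assoc, IsLeftRegularBand.mul_self]⟩)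
      fun t t' => by
      refine Subtype.ext (funext fun y => funext fun x => ?_)
      exact smul_add _ _ _)
    fun b t => by
      refine Subtype.ext (funext fun y => funext fun x => ?_)
      refine Eq.trans ?_ (congrFun (MonoidFunctions.single_smul (X := (Fin 0 → S) → V) b
        (fun y _ => (MonoidAlgebra.single (e * y) 1 : ℤ[B]) • t) y) x).symm
      change (MonoidAlgebra.single (e * y) 1 : ℤ[B]) • (MonoidAlgebra.single b 1 : ℤ[B]) • t =
        (MonoidAlgebra.single (e * (y * b)) 1 : ℤ[B]) • t
      rw [← mul_smul, MonoidAlgebra.single_mul_single, mul_one, mul_assoc]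

theorem augmentation_apply {V : Type w} [AddCommGroup V] [Module ℤ[B] V] (t : V) (y : B)
    (x : Fin 0 → S) :
    (𝒰.augmentation V t).1 y x = (MonoidAlgebra.single (e * y) 1 : ℤ[B]) • t := rfl

theorem augmentation_injective {V : Type w} [AddCommGroup V] [Module ℤ[B] V]
    (hV : IsConcentratedAt e V) : Function.Injective (𝒰.augmentation V) := by
  intro t t' h
  have h1 : (𝒰.augmentation V t).1 1 default = (𝒰.augmentation V t').1 1 default := by rw [h]
  rw [augmentation_apply, augmentation_apply, mul_one, (hV e t).1 (IsLeftRegularBand.mul_self e),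
    (hV e t').1 (IsLeftRegularBand.mul_self e)] at h1
  exact h1

/-- A 0-cochain is a function on `eB`. Each `y ≠ e` in `eB` lies in the ideal of its apex, so a
cocycle vanishes there and is determined by its value at `e`; concentration says that the
augmentation produces exactly these functions. -/
theorem coboundary_zero_eq_zero_iff {V : Type w} [AddCommGroup V] [Module ℤ[B] V]
    (hV : IsConcentratedAt e V) (f : 𝒰.cochainModule V 0) :
    𝒰.coboundary V 0 f = 0 ↔ ∃ t, 𝒰.augmentation V t = f := by
  have hsum : ∀ (c : (Fin 0 → S) → V) x, alternatingFaceSum c x = c default := by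
    intro c x
    simp only [alternatingFaceSum, Fin.sum_univ_succ, Fin.sum_univ_zero]
    simp only [Fin.val_zero, pow_zero, one_smul, add_zero]
    congr 1
    exact Subsingleton.elim _ _
  have hf0 : ∀ y, f.1 (e * y) default = f.1 y default := fun y => by
    have := f.2.2 y default ⟨Function.injective_of_subsingleton _, by
      rw [Set.range_eq_empty]; exact 𝒰.empty⟩
    rwa [Set.range_eq_empty, 𝒰.z_empty] at this
  constructor
  · intro h
    have hlt : ∀ y, e * y = y → y ≠ e → f.1 y default = 0 := by
      intro y hy hne
      obtain ⟨a, ha, hF⟩ := 𝒰.apex y hy hne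
      have hx : IsSimplexOf 𝒰.F (fun _ : Fin 1 => a) := by
        refine ⟨Function.injective_of_subsingleton _, ?_⟩
        have := hF ∅ 𝒰.empty (by simp)
        rwa [Set.range_const, ← LawfulSingleton.insert_empty_eq]
      have h1 := 𝒰.coboundary_apply f y hx
      rw [h, hsum] at h1
      have h2 : 𝒰.z (Set.range fun _ : Fin 1 => a) * y = y := by
        refine (𝒰.z_mul _ hx.2 y).2 ⟨hy, ?_⟩
        rintro v ⟨-, rfl⟩
        exact ha
      rw [h2] at h1
      exact h1.symm
    refine ⟨f.1 e default, 𝒰.cochainModule_ext fun y x _ => ?_⟩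
    rw [augmentation_apply, Subsingleton.elim x default, ← hf0 y]
    by_cases hy : e * y = e
    · rw [hy, (hV e _).1 (IsLeftRegularBand.mul_self e)]
    · rw [(hV _ _).2, hlt _ _ hy]
      · rw [← mul_assoc, IsLeftRegularBand.mul_self]
      · rwa [← mul_assoc, IsLeftRegularBand.mul_self]
  · rintro ⟨t, rfl⟩
    refine 𝒰.cochainModule_ext fun y x hx => ?_
    rw [𝒰.coboundary_apply _ _ hx, hsum, augmentation_apply]
    refine (hV _ _).2 ?_
    have hz : e * 𝒰.z (Set.range x) = 𝒰.z (Set.range x) :=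
      ((𝒰.z_mul _ hx.2 _).1 (IsLeftRegularBand.mul_self _)).1
    have hψ := ((𝒰.z_mul _ hx.2 _).1 (IsLeftRegularBand.mul_self _)).2 (x 0) ⟨0, rfl⟩
    rw [← mul_assoc, ← mul_assoc, IsLeftRegularBand.mul_self, hz]
    -- If the product were `e`, then `ψ (x 0)`, which fixes `z`, would fix `e`, against `mul_ne`.
    intro h
    apply 𝒰.mul_ne _ hx.2 (x 0) ⟨0, rfl⟩
    have h' := congrArg (fun t => 𝒰.ψ (x 0) * t) h
    simp only [← mul_assoc, hψ] at h'
    rw [← h', h]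

/-- The cohomology with coefficients in a module concentrated at `e` is the reduced cohomology of
the nerve of a cover of `∂eB` by right ideals. -/
theorem monoidCohomology_subsingleton_iff (V : ModuleCat.{max w v} ℤ[B])
    (hV : IsConcentratedAt e V) (n : ℕ) :
    Subsingleton (MonoidCohomology.{v, w} B V n) ↔ IsAcyclicAt 𝒰.F V n := by
  let T := trivialZModule.{v, max w v} B
  let K : ℕ → ModuleCat.{max w v} ℤ[B] := fun n => ModuleCat.of ℤ[B] (𝒰.cochainModule V n)
  let d : ∀ n, K n ⟶ K (n + 1) := fun n => ModuleCat.ofHom (𝒰.coboundary V n)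
  let ι : V ⟶ K 0 := ModuleCat.ofHom (𝒰.augmentation V)
  have hι : Mono ι := (ModuleCat.mono_iff_injective _).2 (𝒰.augmentation_injective hV)
  -- invariants of the cochain modules
  have hto : ∀ {m : ℕ} (φ : T ⟶ K m), ∃ c : (Fin m → S) → V, IsCochain 𝒰.F c ∧
      ∀ y, (φ.hom (trivialGenerator B)).1 y = c := by
    intro m φ
    refine ⟨(φ.hom (trivialGenerator B)).1 1, (φ.hom (trivialGenerator B)).2.1 1, fun y => ?_⟩
    -- Invariance under `y`, evaluated at `1`, says that `f y = f 1`: invariant functions are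
    -- constant.
    have h := congrArg (fun f : 𝒰.cochainModule V m => f.1 1)
      (single_smul_hom_trivialGenerator φ y)
    refine Eq.trans ?_ h
    refine Eq.trans ?_ (MonoidFunctions.single_smul y _ 1).symm
    rw [one_mul]
  have hfrom : ∀ {m : ℕ} {c : (Fin m → S) → V}, IsCochain 𝒰.F c → ∃ φ : T ⟶ K m,
      ∀ y, (φ.hom (trivialGenerator B)).1 y = c := by
    intro m c hc
    let f : 𝒰.cochainModule V m := ⟨fun _ => c, fun _ => hc, fun _ _ _ => rfl⟩
    obtain ⟨φ, hφ⟩ := exists_trivialZModule_hom (E := K m) f fun b => Subtype.ext (funext fun y =>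
      MonoidFunctions.single_smul b _ y)
    exact ⟨φ, fun y => by rw [hφ]⟩
  have hd : ∀ {m : ℕ} (φ : T ⟶ K m) (ψ : T ⟶ K (m + 1)) (c c'),
      (∀ y, (φ.hom (trivialGenerator B)).1 y = c) → (∀ y, (ψ.hom (trivialGenerator B)).1 y = c') →
      (φ ≫ d m = ψ ↔ ∀ x, IsSimplexOf 𝒰.F x → c' x = alternatingFaceSum c x) := by
    intro m φ ψ c c' h h'
    constructor
    · rintro rfl x hx
      rw [← h' 1]
      refine (𝒰.coboundary_apply _ 1 hx).trans ?_
      exact congrArg (fun c => alternatingFaceSum c x) (h _)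
    · intro hc
      refine trivialZModule_hom_ext (𝒰.cochainModule_ext fun y x hx => ?_)
      rw [h', hc x hx]
      refine (𝒰.coboundary_apply _ y hx).trans ?_
      exact congrArg (fun c => alternatingFaceSum c x) (h _)
  have hd0 : ∀ {m : ℕ} (φ : T ⟶ K m) (c), (∀ y, (φ.hom (trivialGenerator B)).1 y = c) →
      (φ ≫ d m = 0 ↔ ∀ x, IsSimplexOf 𝒰.F x → alternatingFaceSum c x = 0) := by
    intro m φ c h
    rw [hd φ 0 c 0 h fun y => rfl]
    exact forall₂_congr fun x _ => eq_comm
  cases n with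
  | zero =>
    -- Here `Ext⁰` is Hom from the trivial module into `V`, and `V` is the kernel of the first
    -- coboundary.
    have h1 : Subsingleton (MonoidCohomology.{v, w} B V 0) ↔
        ∀ φ : T ⟶ K 0, φ ≫ d 0 = 0 → φ = 0 := by
      rw [ext_zero_subsingleton_iff]
      constructor
      · intro h φ hφ
        obtain ⟨t, ht⟩ := (𝒰.coboundary_zero_eq_zero_iff hV (φ.hom (trivialGenerator B))).1 (by
          have := congrArg (fun ψ => ψ.hom (trivialGenerator B)) hφ
          exact this)
        obtain ⟨ψ, hψ⟩ := exists_trivialZModule_hom t fun b => by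
          apply 𝒰.augmentation_injective hV
          rw [map_smul, ht]
          exact single_smul_hom_trivialGenerator φ b
        rw [h ψ] at hψ
        refine trivialZModule_hom_ext ?_
        rw [← ht, ← hψ]
        exact map_zero _
      · intro h φ
        rw [← cancel_mono ι, Limits.zero_comp]
        refine h _ (trivialZModule_hom_ext ?_)
        exact (𝒰.coboundary_zero_eq_zero_iff hV _).2 ⟨_, rfl⟩
    rw [h1]
    constructor
    · intro h c hc hdc
      obtain ⟨φ, hφ⟩ := hfrom hc
      rw [← hφ 1, h φ ((hd0 φ c hφ).2 hdc)]
      rfl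
    · intro h φ hφ
      obtain ⟨c, hc, hφc⟩ := hto φ
      refine trivialZModule_hom_ext (Subtype.ext (funext fun y => ?_))
      rw [hφc y, h c hc ((hd0 φ c hφc).1 hφ)]
      rfl
  | succ n =>
    have h1 := ext_subsingleton_iff_of_coresolution T n (V := V) (K := K) (d := d) (ι := ι)
      (ModuleCat.hom_ext (LinearMap.ext fun t =>
        (𝒰.coboundary_zero_eq_zero_iff hV _).2 ⟨t, rfl⟩))
      (ModuleCat.shortComplex_exact _ fun f => 𝒰.coboundary_zero_eq_zero_iff hV f)
      (fun m => ModuleCat.hom_ext (LinearMap.ext fun f => 𝒰.coboundary_coboundary f))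
      (fun m => ModuleCat.shortComplex_exact _ fun f => ⟨fun h => 𝒰.exists_coboundary_eq f h,
        fun ⟨g, hg⟩ => hg ▸ 𝒰.coboundary_coboundary g⟩)
      (fun m q => ext_subsingleton_of_extension
        (fun X L r hr φ => 𝒰.exists_extension L r hr φ) q T)
    refine h1.trans ?_
    constructor
    · intro h c hc hdc
      obtain ⟨φ, hφ⟩ := hfrom hc
      obtain ⟨ψ, hψ⟩ := h φ ((hd0 φ c hφ).2 hdc)
      obtain ⟨g, hg, hψg⟩ := hto ψ
      exact ⟨g, hg, (hd ψ φ g c hψg hφ).1 hψ⟩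
    · intro h φ hφ
      obtain ⟨c, hc, hφc⟩ := hto φ
      obtain ⟨g, hg, hgc⟩ := h c hc ((hd0 φ c hφc).1 hφ)
      obtain ⟨ψ, hψ⟩ := hfrom hg
      exact ⟨ψ, (hd ψ φ g c hψ hφc).2 hgc⟩

end RightIdealCover

end Concentrated

/-! ### The cohomological dimension of a left regular band -/

section CohomologicalDimension

variable (k : Type u) [CommRing k] {B : Type v} [Monoid B]

/-- The integral module underlying a `kB`-module. -/
noncomputable abbrev toIntModule (V : ModuleCat.{w} k[B]) : ModuleCat.{w} ℤ[B] :=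
  (ModuleCat.restrictScalars (intToMonoidAlgebra k B)).obj V

variable {k}

theorem toIntModule_single_smul {V : ModuleCat.{w} k[B]} (b : B) (x : V) :
    (MonoidAlgebra.single b 1 : ℤ[B]) • (show toIntModule k V from x) =
      (MonoidAlgebra.single b 1 : k[B]) • x := by
  have h : intToMonoidAlgebra k B (MonoidAlgebra.single b 1) = MonoidAlgebra.single b 1 := by
    simp [intToMonoidAlgebra]
  change intToMonoidAlgebra k B (MonoidAlgebra.single b 1) • x = _
  rw [h]

theorem single_eq_one_mul (b : B) (r : k) : (MonoidAlgebra.single b r : k[B]) =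
    MonoidAlgebra.single 1 r * MonoidAlgebra.single b 1 := by
  rw [MonoidAlgebra.single_mul_single, one_mul, mul_one]

/-- The short exact sequence of integral modules attached to a submodule of a `kB`-module. -/
theorem exists_shortExact_toIntModule {V W : ModuleCat.{w} k[B]} (π : V →ₗ[k[B]] W)
    (hπ : Function.Surjective π) : ∃ E : ShortComplex (ModuleCat.{w} ℤ[B]), E.ShortExact ∧
      E.X₁ = toIntModule k (ModuleCat.of k[B] (LinearMap.ker π)) ∧ E.X₂ = toIntModule k V ∧
      E.X₃ = toIntModule k W := by
  let E := π.shortComplexKer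
  have hE := LinearMap.shortExact_shortComplexKer hπ
  refine ⟨E.map (ModuleCat.restrictScalars (intToMonoidAlgebra k B)), ?_, rfl, rfl, rfl⟩
  refine ModuleCat.shortComplex_shortExact _ ?_ ?_ ?_
  · exact (ShortComplex.ShortExact.moduleCat_exact_iff_function_exact E).1 hE.exact
  · exact Subtype.val_injective
  · exact hπ

theorem cohomologicalDimension_le_iff (N : ℕ) : cohomologicalDimension k B ≤ N ↔
    ∀ n, N < n → ∀ V : ModuleCat.{max u v} k[B],
      Subsingleton (MonoidCohomology.{v, u} B (toIntModule k V) n) := by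
  unfold cohomologicalDimension
  rw [sSup_le_iff]
  constructor
  · intro h n hn V
    by_contra h1
    rw [not_subsingleton_iff_nontrivial] at h1
    have := h n ⟨n, rfl, V, h1⟩
    rw [Nat.cast_le] at this
    lia
  · rintro h d ⟨n, rfl, V, hV⟩
    rw [Nat.cast_le]
    by_contra h1
    exact not_subsingleton_iff_nontrivial.2 hV (h n (by lia) V)

theorem isConcentratedAt_toIntModule_iff {e : B} {V : ModuleCat.{w} k[B]} :
    IsConcentratedAt e (toIntModule k V) ↔ ∀ (b : B) (x : V),
      (e * b = e → (MonoidAlgebra.single b 1 : k[B]) • x = x) ∧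
        (e * b ≠ e → (MonoidAlgebra.single b 1 : k[B]) • x = 0) := by
  refine forall₂_congr fun b x => ?_
  have h := toIntModule_single_smul (V := V) b x
  exact ⟨fun H => ⟨fun hb => h.symm.trans (H.1 hb), fun hb => h.symm.trans (H.2 hb)⟩,
    fun H => ⟨fun hb => h.trans (H.1 hb), fun hb => h.trans (H.2 hb)⟩⟩

section Character

variable (k) [IsLeftRegularBand B]

open Classical in
/-- The character of a left regular band that is `1` on the elements `b` with `e b = e`, and `0`
on the others. -/
noncomputable def supportCharacter (e : B) : B →* k where
  toFun b := if e * b = e then 1 else 0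
  map_one' := by simp
  map_mul' b c := by
    by_cases hb : e * b = e
    · by_cases hc : e * c = e <;> simp [hb, hc, ← mul_assoc]
    -- Multiplicativity: `e b c = e` forces `e b = e`, because `b c b = b c`.
    · have : e * (b * c) ≠ e := fun h => hb (by
        calc e * b = e * (b * c) * b := by rw [h]
          _ = e * (b * c * b) := by rw [mul_assoc]
          _ = e := by rw [IsLeftRegularBand.mul_mul_self, h])
      simp [hb, this]

/-- A `k`-module, as a `kB`-module concentrated at `e`. -/
noncomputable def concentratedModule (e : B) (A : Type w) [AddCommGroup A] [Module k A] :
    ModuleCat.{w} k[B] :=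
  (ModuleCat.restrictScalars
    (MonoidAlgebra.lift k k B (supportCharacter k e)).toRingHom).obj (ModuleCat.of k A)

variable {k}

/-- The identification of a `k`-module with the underlying group of a concentrated module. -/
noncomputable def toConcentratedModule (e : B) (A : Type w) [AddCommGroup A] [Module k A] :
    A ≃+ concentratedModule k e A := AddEquiv.refl A

theorem single_smul_toConcentratedModule (e : B) (A : Type w) [AddCommGroup A] [Module k A] (b : B)
    (r : k) (x : A) : (MonoidAlgebra.single b r : k[B]) • toConcentratedModule (k := k) e A x =
      toConcentratedModule (k := k) e A ((r * supportCharacter k e b) • x) := by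
  have h : MonoidAlgebra.lift k k B (supportCharacter k e) (MonoidAlgebra.single b r) =
    r * supportCharacter k e b := by simp
  change MonoidAlgebra.lift k k B (supportCharacter k e) (MonoidAlgebra.single b r) • x = _
  rw [h]
  rfl

theorem isConcentratedAt_concentratedModule (e : B) (A : Type w) [AddCommGroup A] [Module k A] :
    IsConcentratedAt e (toIntModule k (concentratedModule k e A)) := by
  rw [isConcentratedAt_toIntModule_iff]
  intro b x
  obtain ⟨x, rfl⟩ := (toConcentratedModule (k := k) e A).surjective x
  rw [single_smul_toConcentratedModule, one_mul]
  constructor <;> intro h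
  · have : supportCharacter k e b = 1 := if_pos h
    rw [this, one_smul]
  · have : supportCharacter k e b = 0 := if_neg h
    rw [this, zero_smul, map_zero]

/-- A module concentrated at `e` is a quotient of a free `k`-module, concentrated at `e`. -/
theorem exists_surjective_concentratedModule {e : B} {V : ModuleCat.{w} k[B]}
    (hV : IsConcentratedAt e (toIntModule k V)) :
    ∃ π : concentratedModule k e (V →₀ k) →ₗ[k[B]] V, Function.Surjective π := by
  rw [isConcentratedAt_toIntModule_iff] at hV
  let _ : Module k V := Module.compHom V (algebraMap k k[B])
  have hsmul : ∀ (r : k) (x : V), r • x = (MonoidAlgebra.single 1 r : k[B]) • x := fun r x => rfl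
  let f : (V →₀ k) →ₗ[k] V := Finsupp.linearCombination k id
  let f' : concentratedModule k e (V →₀ k) →+ V :=
    f.toAddMonoidHom.comp (toConcentratedModule e (V →₀ k)).symm.toAddMonoidHom
  have hf' : ∀ x, f' (toConcentratedModule e (V →₀ k) x) = f x := fun x => rfl
  refine ⟨linearMapOfComm f' fun b r x => ?_, Finsupp.linearCombination_id_surjective k V⟩
  obtain ⟨x, rfl⟩ := (toConcentratedModule (k := k) e (V →₀ k)).surjective x
  rw [single_smul_toConcentratedModule, hf', hf', map_smul, single_eq_one_mul, mul_smul, mul_smul,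
    hsmul]
  congr 1
  by_cases h : e * b = e
  · have : supportCharacter k e b = 1 := if_pos h
    rw [this, one_smul, (hV b _).1 h]
  · have : supportCharacter k e b = 0 := if_neg h
    rw [this, zero_smul, (hV b _).2 h]

end Character

/-! ### From concentrated coefficients to all coefficients. -/

section Cover

variable [IsLeftRegularBand B]

/-- If the cohomology of the nerve vanishes above `N` for coefficients in `k`, then it does so
for the coefficients in all modules concentrated at `e`. -/
theorem subsingleton_of_isConcentratedAt {e : B} {S : Type v} [Finite S]
    (𝒰 : RightIdealCover e S) {N : ℕ} (hN : ∀ n, N < n → IsAcyclicAt 𝒰.F k n) (j : ℕ) :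
    ∀ n, N < n → Nat.card S < n + j → ∀ V : ModuleCat.{max u v} k[B],
      IsConcentratedAt e (toIntModule k V) →
      Subsingleton (MonoidCohomology.{v, u} B (toIntModule k V) n) := by
  induction j with
  | zero =>
    intro n _ hn V hV
    exact (𝒰.monoidCohomology_subsingleton_iff _ hV n).2 (isAcyclicAt_of_card_lt hn)
  | succ j ih =>
    intro n hNn hn V hV
    -- The free cover is handled by `hN`. The kernel is concentrated but need not be free over `k`;
    -- its vanishing is needed one degree higher, where the induction descending from degrees above
    -- `Nat.card S` supplies it.
    obtain ⟨π, hπ⟩ := exists_surjective_concentratedModule hV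
    obtain ⟨E, hE, h₁, h₂, h₃⟩ := exists_shortExact_toIntModule π hπ
    rw [← h₃]
    refine ShortExact.ext_subsingleton_right hE _ ?_ ?_
    · rw [h₂]
      exact (𝒰.monoidCohomology_subsingleton_iff _ (isConcentratedAt_concentratedModule e _) n).2
        ((hN n hNn).finsupp V)
    · rw [h₁]
      refine ih (n + 1) (by lia) (by lia) _ fun b x => ?_
      have h := isConcentratedAt_concentratedModule (k := k) e (V →₀ k) b x.1
      exact ⟨fun hb => Subtype.ext (h.1 hb), fun hb => Subtype.ext (h.2 hb)⟩

/-- The elements of a `kB`-module that are annihilated by `e`, if every proper multiple `eb` of `e`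
acts as zero or as `e`. -/
noncomputable def annihilatedSubmodule (V : ModuleCat.{w} k[B]) (e : B)
    (h : ∀ b, e * b ≠ e → ∀ x : V, (MonoidAlgebra.single (e * b) 1 : k[B]) • x = 0) :
    Submodule k[B] V where
  carrier := {x | (MonoidAlgebra.single e 1 : k[B]) • x = 0}
  add_mem' {x y} hx hy := by
    change _ • (x + y) = (0 : V)
    rw [smul_add, hx, hy, add_zero]
  zero_mem' := smul_zero _
  smul_mem' a x hx := by
    change _ • a • x = (0 : V)
    induction a using MonoidAlgebra.induction_linear with
    | zero => simp
    | add a b ha hb => rw [add_smul, smul_add, ha, hb, add_zero]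
    | single b r =>
      rw [← mul_smul, MonoidAlgebra.single_mul_single, one_mul, single_eq_one_mul, mul_smul]
      by_cases hb : e * b = e
      · rw [hb, hx, smul_zero]
      · rw [h b hb, smul_zero]

variable [Finite B] {I : Type*} {e : I → B} (hfam : ∀ b, ∃ i, b * e i = b ∧ e i * b = e i)
include hfam

/-- Every module has a filtration with concentrated subquotients. -/
theorem subsingleton_of_forall_isConcentratedAt {n : ℕ}
    (hn : ∀ (i : I) (V : ModuleCat.{max u v} k[B]), IsConcentratedAt (e i) (toIntModule k V) →
      Subsingleton (MonoidCohomology.{v, u} B (toIntModule k V) n)) (m : ℕ) :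
    ∀ V : ModuleCat.{max u v} k[B],
      Nat.card {b : B | ∃ x : V, (MonoidAlgebra.single b 1 : k[B]) • x ≠ 0} < m →
      Subsingleton (MonoidCohomology.{v, u} B (toIntModule k V) n) := by
  induction m with
  | zero => intro V h; lia
  | succ m ih =>
    intro V hm
    by_cases hV : ∀ x : V, x = 0
    · obtain ⟨i, -⟩ := hfam 1
      exact hn i V fun b x => ⟨fun _ => (hV _).trans (hV _).symm, fun _ => hV _⟩
    obtain ⟨x₀, hx₀⟩ := not_forall.1 hV
    -- an idempotent of minimal support that does not act as zero
    have hmul : ∀ (b c : B) (x : V), (MonoidAlgebra.single (b * c) 1 : k[B]) • x =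
        (MonoidAlgebra.single b 1 : k[B]) • (MonoidAlgebra.single c 1 : k[B]) • x := by
      intro b c x
      rw [← mul_smul, MonoidAlgebra.single_mul_single, one_mul]
    let Z : Set I := {i | ∃ x : V, (MonoidAlgebra.single (e i) 1 : k[B]) • x ≠ 0}
    have hZ : ∀ b (x : V), (MonoidAlgebra.single b 1 : k[B]) • x ≠ 0 → ∀ i, b * e i = b →
        i ∈ Z := by
      intro b x hx i hi
      refine ⟨x, fun h => hx ?_⟩
      rw [← hi, hmul, h, smul_zero]
    have hZne : Z.Nonempty := by
      obtain ⟨i, hi, -⟩ := hfam 1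
      exact ⟨i, hZ 1 x₀ (by rwa [← MonoidAlgebra.one_def, one_smul]) i hi⟩
    -- The set of `c` with `c e = c` is the left ideal `Be`, so this picks a smallest support whose
    -- idempotent acts nontrivially.
    obtain ⟨i, hiZ, hi⟩ := exists_minimalFor_of_wellFoundedLT (· ∈ Z)
      (fun i => Nat.card {c : B | c * e i = c}) hZne
    have hact : ∀ b, e i * b ≠ e i → ∀ x : V,
        (MonoidAlgebra.single (e i * b) 1 : k[B]) • x = 0 := by
      intro b hb x
      by_contra hx
      -- The representative of `e i * b` would act nontrivially with a strictly smaller left ideal.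
      obtain ⟨j, hj1, hj2⟩ := hfam (e i * b)
      have hlt : {c : B | c * e j = c} ⊂ {c : B | c * e i = c} := by
        have hsub : ∀ c, c * e j = c → c * (e i * b) = c := fun c hc => by
          rw [← hc, mul_assoc, hj2]
        refine ⟨fun c hc => ?_, fun h => hb ?_⟩
        · have h1 := hsub c hc
          change c * e i = c
          calc c * e i = c * (e i * b) * e i := by rw [h1]
            _ = c * (e i * b * e i) := by rw [mul_assoc]
            _ = c := by rw [IsLeftRegularBand.mul_mul_self, h1]
        · have h1 : e i * e j = e i := h (IsLeftRegularBand.mul_self (e i))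
          have h2 := hsub _ h1
          rwa [← mul_assoc, IsLeftRegularBand.mul_self] at h2
      have hcard : Nat.card {c : B | c * e j = c} < Nat.card {c : B | c * e i = c} :=
        Set.ncard_lt_ncard hlt (Set.toFinite _)
      have := hi (hZ _ x hx j hj1) hcard.le
      exact absurd hcard (not_lt.2 this)
    -- On `U` the element `e i` acts as zero, so fewer elements of `B` act nontrivially than on `V`.
    -- On `V ⧸ U` the module is concentrated at `e i`, since `b x - x` is killed by `e i` whenever
    -- `e i * b = e i`.
    let U := annihilatedSubmodule V (e i) hact
    obtain ⟨E, hE, h₁, h₂, h₃⟩ := exists_shortExact_toIntModule (W := ModuleCat.of k[B] (V ⧸ U))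
      U.mkQ U.mkQ_surjective
    rw [← h₂]
    refine ShortExact.ext_subsingleton_middle hE _ ?_ ?_
    · rw [h₁]
      refine ih _ (lt_of_lt_of_le (Set.ncard_lt_ncard ⟨?_, ?_⟩ (Set.toFinite _)) (Nat.lt_succ_iff.1 hm))
      · rintro b ⟨x, hx⟩
        exact ⟨x.1, fun h => hx (Subtype.ext h)⟩
      · intro h
        obtain ⟨x, hx⟩ := h hiZ
        refine hx (Subtype.ext ?_)
        exact (Submodule.Quotient.mk_eq_zero U).1 x.2
    · rw [h₃]
      refine hn i _ (isConcentratedAt_toIntModule_iff.2 fun b x => ?_)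
      obtain ⟨x, rfl⟩ := U.mkQ_surjective x
      constructor
      · intro hb
        rw [← map_smul]
        refine (Submodule.Quotient.eq U).2 ?_
        change (MonoidAlgebra.single (e i) 1 : k[B]) • (_ - x) = 0
        rw [smul_sub, ← hmul, hb, sub_self]
      · intro hb
        rw [← map_smul]
        refine (Submodule.Quotient.mk_eq_zero U).2 ?_
        change (MonoidAlgebra.single (e i) 1 : k[B]) • _ = 0
        rw [← hmul, hact b hb]

/-- The cohomological dimension of a finite left regular band is determined by the reduced
cohomology of the nerves of covers of the sets `∂eB` by right ideals. -/
theorem cohomologicalDimension_le_iff_isAcyclicAt {S : I → Type v} [∀ i, Finite (S i)]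
    (𝒰 : ∀ i, RightIdealCover (e i) (S i)) (N : ℕ) :
    cohomologicalDimension k B ≤ N ↔ ∀ n, N < n → ∀ i, IsAcyclicAt (𝒰 i).F k n := by
  rw [cohomologicalDimension_le_iff]
  constructor
  · intro h n hn i
    -- The test module is `k` concentrated at `e i`, lifted to the required universe.
    have h1 := ((𝒰 i).monoidCohomology_subsingleton_iff _
      (isConcentratedAt_concentratedModule (k := k) (e i) (ULift.{v} k)) n).1 (h n hn _)
    exact h1.congr_equiv (AddEquiv.ulift : ULift.{v} k ≃+ k)
  · intro h n hn V
    refine subsingleton_of_forall_isConcentratedAt hfam (fun i W hW => ?_) _ V (Nat.lt_succ_self _)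
    exact subsingleton_of_isConcentratedAt (𝒰 i) (fun n hn => h n hn i) (Nat.card (S i) + 1) n hn
      (by lia) W hW

end Cover

end CohomologicalDimension

/-! ### The order complex of the boundary of a principal right ideal -/

/-- Extended naturals are determined by their natural upper bounds, so only statements of the form
`cd ≤ N` have to be analysed. -/
theorem enat_eq_of_forall_le_natCast {a b : ℕ∞} (h : ∀ N : ℕ, a ≤ N ↔ b ≤ N) : a = b := by
  refine le_antisymm ?_ ?_
  · induction b using ENat.recTopCoe with
    | top => exact le_top
    | coe b => exact (h b).2 le_rfl
  · induction a using ENat.recTopCoe with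
    | top => exact le_top
    | coe a => exact (h a).1 le_rfl

theorem AbstractSimplicialComplex.IsFaceOrEmpty.mono {V : Type v} {K : AbstractSimplicialComplex V}
    {s t : Set V} (hs : K.IsFaceOrEmpty s) (hts : t ⊆ s) : K.IsFaceOrEmpty t := by
  rcases t.eq_empty_or_nonempty with rfl | ht
  · exact Or.inl rfl
  · rcases hs with rfl | ⟨s', hs', rfl⟩
    · exact absurd (Set.subset_empty_iff.1 hts) ht.ne_empty
    · refine Or.inr ⟨(s'.finite_toSet.subset hts).toFinset, (K.isRelLowerSet_faces hs').2 ?_ ?_, ?_⟩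
      · intro x hx
        exact hts ((Set.Finite.mem_toFinset _).1 hx)
      · exact (Set.Finite.toFinset_nonempty _).2 ht
      · simp

section RightIdealCover

variable {B : Type v} [Monoid B] [IsLeftRegularBand B]

open Classical in
/-- A cover by the right ideals labelled by the vertices of a simplicial complex. -/
noncomputable def AbstractSimplicialComplex.rightIdealCover {e : B} {S : Type*}
    (K : AbstractSimplicialComplex S) (ψ : S → B)
    (hz : ∀ s, K.IsFaceOrEmpty s → ∃ z, ∀ y, z * y = y ↔ e * y = y ∧ ∀ v ∈ s, ψ v * y = y)
    (hψ : ∀ v, ψ v * e ≠ e)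
    (ha : ∀ y, e * y = y → y ≠ e → ∃ a, ψ a * y = y ∧
      ∀ s, K.IsFaceOrEmpty s → (∀ v ∈ s, ψ v * y = y) → K.IsFaceOrEmpty (insert a s)) :
    RightIdealCover e S where
  F := K.IsFaceOrEmpty
  ψ := ψ
  z s := if h : K.IsFaceOrEmpty s then (hz s h).choose else 1
  lower _ _ hs hts := hs.mono hts
  empty := Or.inl rfl
  z_mul s hs := by
    rw [dif_pos hs]
    exact (hz s hs).choose_spec
  mul_ne _ _ v _ := hψ v
  apex := ha

theorem isFaceOrEmpty_boundaryComplex_iff [Finite B] (e : B) (s : Set (boundary e)) :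
    (boundaryComplex e).IsFaceOrEmpty s ↔
      ∀ x ∈ s, ∀ y ∈ s, (y : B) * x = x ∨ (x : B) * y = y := by
  let _ : PartialOrder B := lrbPartialOrder B
  constructor
  · rintro (rfl | ⟨t, ⟨-, ht⟩, rfl⟩)
    · simp
    · exact fun x hx y hy => ht.total hx hy
  · intro h
    rcases s.eq_empty_or_nonempty with rfl | hs
    · exact Or.inl rfl
    · refine Or.inr ⟨s.toFinite.toFinset, ⟨by simpa using hs, ?_⟩, by simp⟩
      intro x hx y hy _
      exact h x (by simpa using hx) y (by simpa using hy)

/-- The boundary `∂eB` is covered by the principal right ideals of its elements. -/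
noncomputable def boundaryCover [Finite B] (e : B) : RightIdealCover e (boundary e) :=
  (boundaryComplex e).rightIdealCover Subtype.val
    (by
      intro s hs
      rw [isFaceOrEmpty_boundaryComplex_iff] at hs
      rcases s.eq_empty_or_nonempty with rfl | hne
      · exact ⟨e, fun y => by simp⟩
      · let _ : PartialOrder B := lrbPartialOrder B
        -- The right ideals of a finite chain intersect in the ideal of its least element.
        obtain ⟨z, hz, hmin⟩ := s.toFinite.exists_minimalFor (Subtype.val : boundary e → B) s hne
        have hle : ∀ v ∈ s, (v : B) * z = z := fun v hv => by
          rcases hs z hz v hv with h | h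
          · exact h
          · exact hmin hv h
        obtain ⟨⟨a, ha⟩, -⟩ := z.2
        have hez : e * (z : B) = z := by rw [ha, ← mul_assoc, IsLeftRegularBand.mul_self]
        refine ⟨z, fun y => ⟨fun h => ⟨?_, fun v hv => ?_⟩, fun h => h.2 z hz⟩⟩
        · rw [← h, ← mul_assoc, hez]
        · rw [← h, ← mul_assoc, hle v hv])
    (by
      rintro ⟨v, ⟨a, rfl⟩, hv⟩ h
      rw [IsLeftRegularBand.mul_mul_self] at h
      exact hv h)
    (by
      intro y hy hne
      -- The apex of `y` is `y` itself: it is comparable to every vertex above it.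
      refine ⟨⟨y, ⟨y, hy.symm⟩, hne⟩, IsLeftRegularBand.mul_self y, fun s hs h => ?_⟩
      rw [isFaceOrEmpty_boundaryComplex_iff] at hs ⊢
      rintro a (rfl | ha) b (rfl | hb)
      · exact Or.inl (IsLeftRegularBand.mul_self _)
      · exact Or.inl (h b hb)
      · exact Or.inr (h a ha)
      · exact hs a ha b hb)

/-- A minimal element of `B` is a left zero, and so is any other generator of its left ideal. The
empty complex has cohomology in degree `-1`, so the set of degrees whose maximum is sought is
nonempty. -/
theorem exists_boundary_eq_empty [Finite B] (e : supportSemilattice B → B)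
    (he : ∀ Y, principalLeftIdeal (e Y) = (Y : Set B)) : ∃ Y, boundary (e Y) = ∅ := by
  let _ : PartialOrder B := lrbPartialOrder B
  obtain ⟨x, -, hx⟩ := Set.finite_univ.exists_minimalFor (id : B → B) Set.univ ⟨1, trivial⟩
  have hx' : ∀ y, x * y = x := fun y => by
    have h : x * (x * y) = x * y := by rw [← mul_assoc, IsLeftRegularBand.mul_self]
    have h2 : x * y * x = x := hx (j := x * y) trivial h
    rwa [IsLeftRegularBand.mul_mul_self] at h2
  refine ⟨⟨_, x, rfl⟩, Set.eq_empty_iff_forall_notMem.2 ?_⟩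
  set Y : supportSemilattice B := ⟨_, x, rfl⟩
  rintro _ ⟨⟨a, rfl⟩, hne⟩
  have h1 : e Y ∈ principalLeftIdeal x := by
    have : e Y ∈ principalLeftIdeal (e Y) := ⟨1, (one_mul _).symm⟩
    rwa [he Y] at this
  obtain ⟨b, hb⟩ := h1
  apply hne
  rw [hb, mul_assoc, hx']

theorem exists_cohomologicalDimension_eq (k : Type u) [CommRing k] [Nontrivial k] [Finite B]
    (e : supportSemilattice B → B) (he : ∀ Y, principalLeftIdeal (e Y) = (Y : Set B)) :
    ∃ N : ℕ, cohomologicalDimension k B = N ∧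
      IsGreatest {n : ℕ | ∃ Y : supportSemilattice B,
        Nontrivial ((boundaryComplex (e Y)).ReducedCohomologySubOne k n)} N := by
  have hfam : ∀ b, ∃ Y, b * e Y = b ∧ e Y * b = e Y := by
    intro b
    refine ⟨⟨_, b, rfl⟩, ?_⟩
    set Y : supportSemilattice B := ⟨_, b, rfl⟩
    have h := he Y
    have h1 : b ∈ principalLeftIdeal (e Y) := by rw [h]; exact ⟨1, (one_mul b).symm⟩
    have h2 : e Y ∈ principalLeftIdeal b := by
      have : e Y ∈ principalLeftIdeal (e Y) := ⟨1, (one_mul _).symm⟩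
      rwa [h] at this
    obtain ⟨a, ha⟩ := h1
    obtain ⟨a', ha'⟩ := h2
    constructor
    · calc b * e Y = a * (e Y * e Y) := by rw [← mul_assoc, ← ha]
        _ = b := by rw [IsLeftRegularBand.mul_self, ← ha]
    · calc e Y * b = a' * (b * b) := by rw [← mul_assoc, ← ha']
        _ = e Y := by rw [IsLeftRegularBand.mul_self, ← ha']
  have hcd := cohomologicalDimension_le_iff_isAcyclicAt (k := k) hfam fun Y => boundaryCover (e Y)
  have hmem : ∀ n Y, Nontrivial ((boundaryComplex (e Y)).ReducedCohomologySubOne k n) ↔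
      ¬ IsAcyclicAt (boundaryCover (e Y)).F k n := fun n Y => by
    rw [← not_subsingleton_iff_nontrivial,
      AbstractSimplicialComplex.subsingleton_reducedCohomologySubOne_iff]
    rfl
  set s := {n : ℕ | ∃ Y : supportSemilattice B,
    Nontrivial ((boundaryComplex (e Y)).ReducedCohomologySubOne k n)}
  have hne : s.Nonempty := by
    obtain ⟨Y, hY⟩ := exists_boundary_eq_empty e he
    refine ⟨0, Y, (hmem 0 Y).2 (not_isAcyclicAt_zero (Or.inl rfl) fun x => ?_)⟩
    exact ((Set.eq_empty_iff_forall_notMem.1 hY) _ (x 0).2).elim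
  have hbdd : BddAbove s := by
    refine ⟨Nat.card B, ?_⟩
    rintro n ⟨Y, hY⟩
    by_contra h
    exact (hmem n Y).1 hY (isAcyclicAt_of_card_lt (lt_of_le_of_lt
      (Nat.card_le_card_of_injective _ Subtype.val_injective) (not_le.1 h)))
  have hgreatest : IsGreatest s (sSup s) := ⟨Nat.sSup_mem hne hbdd, fun n hn => le_csSup hbdd hn⟩
  refine ⟨sSup s, enat_eq_of_forall_le_natCast fun N => ?_, hgreatest⟩
  rw [hcd, Nat.cast_le]
  constructor
  · intro h
    by_contra h1
    obtain ⟨Y, hY⟩ := hgreatest.1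
    exact (hmem _ Y).1 hY (h _ (not_le.1 h1) Y)
  · intro h n hn Y
    by_contra h1
    exact absurd (hgreatest.2 ⟨Y, (hmem n Y).2 h1⟩) (not_le.2 (lt_of_le_of_lt h hn))

end RightIdealCover

/-! ### Free partially commutative left regular bands -/

/-- The left regular band of first letters: `x * y = x` unless `x = 1`. -/
def FirstLetter (V : Type v) : Type v := Option V

instance (V : Type v) : Monoid (FirstLetter V) where
  mul x y := Option.elim x y fun a => some a
  one := (none : Option V)
  mul_assoc x y z := by cases x <;> rfl
  one_mul x := rfl
  mul_one x := by cases x <;> rfl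

/-- A letter. -/
def FirstLetter.letter {V : Type v} (x : V) : FirstLetter V := (some x : Option V)

theorem FirstLetter.letter_mul {V : Type v} (x : V) (y : FirstLetter V) :
    letter x * y = letter x := rfl

theorem FirstLetter.letter_ne_one {V : Type v} (x : V) : letter x ≠ 1 := Option.some_ne_none x

theorem FirstLetter.letter_injective {V : Type v} : Function.Injective (letter (V := V)) :=
  Option.some_injective V

instance (V : Type v) : IsLeftRegularBand (FirstLetter V) where
  mul_self x := by cases x <;> rfl
  mul_mul_self x y := by cases x <;> cases y <;> rfl

namespace FreePCLeftRegularBand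

variable {V : Type v} {Γ : SimpleGraph V}

/-- The generators of `B(Γ)`. -/
def of (Γ : SimpleGraph V) (x : V) : FreePCLeftRegularBand Γ := PresentedMonoid.of _ x

theorem of_mul_of {x y : V} (h : Γ.Adj x y) : of Γ x * of Γ y = of Γ y * of Γ x := by
  have := PresentedMonoid.mk_eq_mk_of_rel (FreePCRel.comm (Γ := Γ) x y h)
  rwa [map_mul, map_mul] at this

/-- The product of a list of generators. -/
def word (Γ : SimpleGraph V) (l : List V) : FreePCLeftRegularBand Γ := (l.map (of Γ)).prod

@[simp] theorem word_nil : word Γ [] = 1 := rfl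

@[simp] theorem word_cons (x : V) (l : List V) : word Γ (x :: l) = of Γ x * word Γ l := by
  simp [word]

@[simp] theorem word_append (l l' : List V) : word Γ (l ++ l') = word Γ l * word Γ l' := by
  simp [word]

theorem exists_word (b : FreePCLeftRegularBand Γ) : ∃ l, b = word Γ l := by
  obtain ⟨a, rfl⟩ := PresentedMonoid.surjective_mk b
  refine ⟨a.toList, ?_⟩
  induction a using FreeMonoid.recOn with
  | one => rfl
  | of_mul x l ih => rw [map_mul, ih]; simp [of, PresentedMonoid.of]

/-- Homomorphisms from `B(Γ)` to left regular bands. -/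
def lift {L : Type*} [Monoid L] [IsLeftRegularBand L] (f : V → L)
    (hf : ∀ x y, Γ.Adj x y → f x * f y = f y * f x) : FreePCLeftRegularBand Γ →* L :=
  PresentedMonoid.lift f (rels := FreePCRel Γ) fun a b h => by
    induction h with
    | mul_self a => rw [map_mul, IsLeftRegularBand.mul_self]
    | mul_mul_self a b => rw [map_mul, map_mul, IsLeftRegularBand.mul_mul_self]
    | comm x y h => simpa using hf x y h

open Classical in
/-- The homomorphism that reads the first letter in an independent set `T`. -/
noncomputable def firstLetter (T : Set V) (hT : ∀ x ∈ T, ∀ y ∈ T, ¬ Γ.Adj x y) :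
    FreePCLeftRegularBand Γ →* FirstLetter V :=
  lift (fun x => if x ∈ T then FirstLetter.letter x else 1) fun x y h => by
    by_cases hx : x ∈ T
    · have hy : y ∉ T := fun hy => hT x hx y hy h
      simp only [if_pos hx, if_neg hy, mul_one, one_mul]
    · simp only [if_neg hx, mul_one, one_mul]

theorem firstLetter_of_mem {T : Set V} (hT : ∀ x ∈ T, ∀ y ∈ T, ¬ Γ.Adj x y) {x : V} (hx : x ∈ T) :
    firstLetter T hT (of Γ x) = FirstLetter.letter x := if_pos hx

theorem firstLetter_word {T : Set V} (hT : ∀ x ∈ T, ∀ y ∈ T, ¬ Γ.Adj x y) {l : List V}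
    (hl : ∀ x ∈ l, x ∉ T) : firstLetter T hT (word Γ l) = 1 := by
  induction l with
  | nil => simp
  | cons x l ih =>
    rw [word_cons, map_mul, ih fun y hy => hl y (List.mem_cons_of_mem _ hy), mul_one]
    exact if_neg (hl x List.mem_cons_self)

/-- If `x` occurs, `x y x = x y` absorbs it. If not, the first-letter homomorphism for `{x}` sends
the word to `1` but the product to the letter `x`. -/
theorem word_mul_of_iff {l : List V} {x : V} : word Γ l * of Γ x = word Γ l ↔ x ∈ l := by
  constructor
  · intro h
    by_contra hx
    have hT : ∀ y ∈ ({x} : Set V), ∀ z ∈ ({x} : Set V), ¬ Γ.Adj y z := by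
      rintro y rfl z rfl
      exact Γ.irrefl
    have h1 := congrArg (firstLetter {x} hT) h
    rw [map_mul, firstLetter_word hT (by rintro y hy rfl; exact hx hy), one_mul,
      firstLetter_of_mem hT rfl] at h1
    exact FirstLetter.letter_ne_one _ h1
  · intro h
    obtain ⟨l₁, l₂, rfl⟩ := List.append_of_mem h
    rw [word_append, word_cons, mul_assoc, IsLeftRegularBand.mul_mul_self]

theorem word_mul_word {l l' : List V} (h : ∀ x ∈ l', x ∈ l) : word Γ l * word Γ l' = word Γ l := by
  induction l' with
  | nil => simp
  | cons x l' ih =>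
    rw [word_cons, ← mul_assoc, word_mul_of_iff.2 (h x List.mem_cons_self),
      ih fun y hy => h y (List.mem_cons_of_mem _ hy)]

theorem exists_nodup_word (l : List V) : ∃ l' : List V, l'.Nodup ∧ word Γ l' = word Γ l := by
  induction l using List.reverseRecOn with
  | nil => exact ⟨[], List.nodup_nil, rfl⟩
  | append_singleton l x ih =>
    obtain ⟨l', hl', h⟩ := ih
    by_cases hx : x ∈ l'
    · refine ⟨l', hl', ?_⟩
      rw [word_append, ← h]
      simp [word_mul_of_iff.2 hx]
    · refine ⟨l' ++ [x], ?_, by rw [word_append, word_append, h]⟩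
      rw [List.nodup_append]
      exact ⟨hl', List.nodup_singleton x, by simpa using fun a ha => by rintro rfl; exact hx ha⟩

instance [Finite V] : Finite (FreePCLeftRegularBand Γ) := by
  have := Fintype.ofFinite V
  refine Finite.of_surjective (fun l : {l : List V // l.Nodup} => word Γ l.1) fun b => ?_
  obtain ⟨l, rfl⟩ := exists_word b
  obtain ⟨l', hl', h⟩ := exists_nodup_word (Γ := Γ) l
  exact ⟨⟨l', hl'⟩, h⟩

/-- Letters of a clique commute, so `x` travels to its own occurrence and is absorbed there. -/
theorem of_mul_word_of_isClique {l : List V} (hl : Γ.IsClique {x | x ∈ l}) {x : V} (hx : x ∈ l) :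
    of Γ x * word Γ l = word Γ l := by
  induction l with
  | nil => simp at hx
  | cons y l ih =>
    rw [word_cons, ← mul_assoc]
    by_cases hxy : x = y
    · rw [hxy, IsLeftRegularBand.mul_self]
    · have hx' : x ∈ l := (List.mem_cons.1 hx).resolve_left hxy
      rw [of_mul_of (hl hx List.mem_cons_self hxy), mul_assoc,
        ih (hl.subset fun z hz => List.mem_cons_of_mem _ hz) hx']

/-- Since `e x e = e x`, the element `e x w` is the product of `e x` and `e w`, and both fix `y`. So
the common elements of the ideals `e x B` lie in the ideal of `e w`. -/
theorem word_mul_eq_of_forall {e y : FreePCLeftRegularBand Γ} (hy : e * y = y) {l : List V}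
    (hl : ∀ x ∈ l, e * of Γ x * y = y) : e * word Γ l * y = y := by
  induction l with
  | nil => simpa using hy
  | cons x l ih =>
    have h1 := ih fun z hz => hl z (List.mem_cons_of_mem _ hz)
    have h2 := hl x List.mem_cons_self
    calc e * word Γ (x :: l) * y = e * of Γ x * e * word Γ l * y := by
          rw [word_cons, IsLeftRegularBand.mul_mul_self, ← mul_assoc]
      _ = e * of Γ x * (e * word Γ l * y) := by simp only [mul_assoc]
      _ = y := by rw [h1, h2]

/-- A word either is absorbed by `e`, or has a first letter that is not. -/
theorem mul_word_eq_or (e : FreePCLeftRegularBand Γ) (l : List V) : e * word Γ l = e ∨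
    ∃ x, e * of Γ x ≠ e ∧ e * of Γ x * (e * word Γ l) = e * word Γ l := by
  induction l with
  | nil => left; simp
  | cons x l ih =>
    rw [word_cons, ← mul_assoc]
    by_cases hx : e * of Γ x = e
    · rwa [hx]
    · refine Or.inr ⟨x, hx, ?_⟩
      rw [← mul_assoc, IsLeftRegularBand.mul_self]

theorem isFaceOrEmpty_cliqueComplex_induced_iff [Finite V] (W : Set V) (s : Set W) :
    ((cliqueComplex Γ).induced W).IsFaceOrEmpty s ↔ Γ.IsClique (Subtype.val '' s) := by
  constructor
  · rintro (rfl | ⟨t, ⟨-, ht⟩, rfl⟩)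
    · simp
    · simpa using ht
  · intro h
    rcases s.eq_empty_or_nonempty with rfl | hs
    · exact Or.inl rfl
    · refine Or.inr ⟨s.toFinite.toFinset, ⟨by simpa using hs, ?_⟩, by simp⟩
      simpa using h

variable [Finite V]

/-- A list of the elements of a set of vertices. -/
noncomputable def listOf (W : Set V) : List V := W.toFinite.toFinset.toList

theorem mem_listOf {W : Set V} {x : V} : x ∈ listOf W ↔ x ∈ W := by simp [listOf]

/-- The product of the generators that do not belong to `W`. -/
noncomputable def complementWord (Γ : SimpleGraph V) (W : Set V) : FreePCLeftRegularBand Γ :=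
  word Γ (listOf Wᶜ)

theorem complementWord_mul_of_iff {W : Set V} {x : V} :
    complementWord Γ W * of Γ x = complementWord Γ W ↔ x ∉ W := by
  rw [complementWord, word_mul_of_iff, mem_listOf]
  rfl

/-- The clique complex of the graph induced on `W` is the nerve of a cover of the boundary of the
right ideal generated by the product of the other generators. -/
noncomputable def cliqueCover (Γ : SimpleGraph V) (W : Set V) :
    RightIdealCover (complementWord Γ W) W :=
  ((cliqueComplex Γ).induced W).rightIdealCover (fun v => complementWord Γ W * of Γ v)
    (by
      set e := complementWord Γ W
      intro s hs
      rw [isFaceOrEmpty_cliqueComplex_induced_iff] at hs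
      have hl : ∀ x, x ∈ listOf (Subtype.val '' s) ↔ x ∈ Subtype.val '' s := fun x => mem_listOf
      have hcl : Γ.IsClique {x | x ∈ listOf (Subtype.val '' s)} := by
        simp only [hl]
        exact hs
      -- The ideals of the vertices of a clique intersect in the ideal generated by `e` times the
      -- product of the clique.
      refine ⟨e * word Γ (listOf (Subtype.val '' s)), fun y => ⟨fun h => ⟨?_, fun v hv => ?_⟩,
        fun h => ?_⟩⟩
      · rw [← h, ← mul_assoc, ← mul_assoc, IsLeftRegularBand.mul_self]
      · have h1 : e * of Γ v * (e * word Γ (listOf (Subtype.val '' s))) =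
            e * word Γ (listOf (Subtype.val '' s)) := by
          rw [← mul_assoc, IsLeftRegularBand.mul_mul_self, mul_assoc,
            of_mul_word_of_isClique hcl ((hl v).2 ⟨v, hv, rfl⟩)]
        rw [← h, ← mul_assoc, h1]
      · refine word_mul_eq_of_forall h.1 fun x hx => ?_
        obtain ⟨v, hv, rfl⟩ := (hl x).1 hx
        exact h.2 v hv)
    (by
      intro v h
      rw [IsLeftRegularBand.mul_mul_self, complementWord_mul_of_iff] at h
      exact h v.2)
    (by
      set e := complementWord Γ W with he
      intro y hy hne
      obtain ⟨l, rfl⟩ := exists_word y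
      rcases mul_word_eq_or e l with h | ⟨x, hx, hxy⟩
      · exact absurd (hy.symm.trans h) hne
      · have hxW : x ∈ W := by
          by_contra h
          exact hx (complementWord_mul_of_iff.2 h)
        rw [hy] at hxy
        -- The apex is the first letter of `y` not absorbed by `e`.
        refine ⟨⟨x, hxW⟩, hxy, fun s hs hsy => ?_⟩
        rw [isFaceOrEmpty_cliqueComplex_induced_iff] at hs ⊢
        rw [Set.image_insert_eq, SimpleGraph.isClique_insert]
        refine ⟨hs, ?_⟩
        rintro _ ⟨v, hv, rfl⟩ hxv
        by_contra hadj
        -- If `x` and `v` were distinct and not adjacent, the first letter of `y` in `{x, v}` would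
        -- be well defined. As `e` involves no letter of `W`, that letter would have to be both `x`
        -- and `v`.
        have hT : ∀ a ∈ ({x, v.1} : Set V), ∀ b ∈ ({x, v.1} : Set V), ¬ Γ.Adj a b := by
          rintro a (rfl | rfl) b (rfl | rfl)
          · exact Γ.irrefl
          · exact hadj
          · exact fun h => hadj h.symm
          · exact Γ.irrefl
        have h1 : firstLetter _ hT e = 1 := firstLetter_word hT fun z hz => by
          rintro (rfl | rfl)
          · exact mem_listOf.1 hz hxW
          · exact mem_listOf.1 hz v.2
        have hfirst : ∀ z ∈ ({x, v.1} : Set V), e * of Γ z * word Γ l = word Γ l →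
            firstLetter _ hT (word Γ l) = FirstLetter.letter z := by
          intro z hz h
          rw [← h, map_mul, map_mul, h1, one_mul, firstLetter_of_mem hT hz,
            FirstLetter.letter_mul]
        have h2 := hfirst x (by simp) hxy
        rw [hfirst v.1 (by simp) (hsy v hv)] at h2
        exact hxv (FirstLetter.letter_injective h2.symm))

/-- The left ideal of a word depends only on the set of its letters; `W` is the set of letters that
do not occur in `b`. -/
theorem exists_complementWord (b : FreePCLeftRegularBand Γ) :
    ∃ W, b * complementWord Γ W = b ∧ complementWord Γ W * b = complementWord Γ W := by
  obtain ⟨l, rfl⟩ := exists_word b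
  refine ⟨{x | x ∉ l}, word_mul_word fun x hx => ?_, word_mul_word fun x hx => ?_⟩
  · simpa using mem_listOf.1 hx
  · exact mem_listOf.2 (by simpa using hx)

theorem cohomologicalDimension_le_iff (k : Type u) [CommRing k] (N : ℕ) :
    cohomologicalDimension k (FreePCLeftRegularBand Γ) ≤ N ↔
      ∀ n, N < n → ∀ W, IsAcyclicAt ((cliqueComplex Γ).induced W).IsFaceOrEmpty k n :=
  cohomologicalDimension_le_iff_isAcyclicAt exists_complementWord (cliqueCover Γ) N

end FreePCLeftRegularBand

/-- Index `n` stands for degree `n - 1`, so the degrees `i ≥ N` are the indices `n > N`; degree `-1`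
is never involved. -/
theorem AbstractSimplicialComplex.lerayNumber_le_iff {V : Type v} (k : Type u) [CommRing k]
    (K : AbstractSimplicialComplex V) (N : ℕ) : K.lerayNumber k ≤ N ↔
      ∀ n, N < n → ∀ W, IsAcyclicAt (K.induced W).IsFaceOrEmpty k n := by
  simp only [← subsingleton_reducedCohomologySubOne_iff]
  constructor
  · intro h n hn W
    have hne : {d : ℕ∞ | ∃ m : ℕ, d = m ∧ ∀ i : ℕ, m ≤ i → ∀ W : Set V,
        Subsingleton ((K.induced W).ReducedCohomologySubOne k (i + 1))}.Nonempty := by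
      by_contra h1
      rw [Set.not_nonempty_iff_eq_empty] at h1
      rw [lerayNumber, h1, sInf_empty, top_le_iff] at h
      exact ENat.natCast_ne_top N h
    obtain ⟨m, hm, hm'⟩ := csInf_mem hne
    rw [lerayNumber, hm, Nat.cast_le] at h
    obtain ⟨i, rfl⟩ : ∃ i, n = i + 1 := ⟨n - 1, by lia⟩
    exact hm' i (by lia) W
  · intro h
    exact sInf_le ⟨N, rfl, fun i hi W => h (i + 1) (by lia) W⟩

theorem FreePCLeftRegularBand.cohomologicalDimension_eq_lerayNumber (k : Type u) [CommRing k]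
    {V : Type v} [Finite V] (Γ : SimpleGraph V) :
    cohomologicalDimension k (FreePCLeftRegularBand Γ) = (cliqueComplex Γ).lerayNumber k :=
  enat_eq_of_forall_le_natCast fun N => by
    rw [cohomologicalDimension_le_iff, AbstractSimplicialComplex.lerayNumber_le_iff]

/-! ### Chordal graphs -/

section Chordal

variable {V : Type v} {A : Type*} [AddCommGroup A]

theorem fin_sub_val_eq_one_iff {n : ℕ} (a b : Fin (n + 2)) :
    (a - b).val = 1 ↔ a.val = b.val + 1 ∨ (a.val = 0 ∧ b.val + 1 = n + 2) := by
  obtain ⟨a, ha⟩ := a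
  obtain ⟨b, hb⟩ := b
  rw [Fin.sub_def]
  simp only
  by_cases h : b ≤ a
  · have : n + 2 - b + a = n + 2 + (a - b) := by lia
    rw [this, Nat.add_mod_left, Nat.mod_eq_of_lt (by lia)]
    lia
  · rw [Nat.mod_eq_of_lt (by lia)]
    lia

/-- In a chordal graph, a path with ends adjacent to a vertex `v`, in the complement of `v`, can be
replaced by a path in the neighbourhood of `v`: a function on the neighbours which is constant along
edges takes the same value at both ends. -/
theorem eq_of_path_of_isChordalGraph {Γ : SimpleGraph V} (hΓ : IsChordalGraph Γ) {W : Set V} {v : V}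
    (hv : v ∉ W) {X : Type*} (f : V → X)
    (hf : ∀ a ∈ W, ∀ b ∈ W, Γ.Adj v a → Γ.Adj v b → Γ.Adj a b → f a = f b) (d : ℕ) :
    ∀ p : ℕ → V, (∀ i ≤ d, p i ∈ W) → (∀ i < d, Γ.Adj (p i) (p (i + 1))) → Γ.Adj v (p 0) →
      Γ.Adj v (p d) → f (p 0) = f (p d) := by
  induction d using Nat.strong_induction_on with
  | _ d ih =>
    intro p hpW hp h0 hd
    by_contra hne
    -- An interior neighbour of `v` would split the path into two shorter ones.
    have hint : ∀ i, 0 < i → i < d → ¬ Γ.Adj v (p i) := by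
      intro i hi0 hid hadj
      apply hne
      rw [ih i hid p (fun j hj => hpW j (by lia)) (fun j hj => hp j (by lia)) h0 hadj]
      have := ih (d - i) (by lia) (fun t => p (i + t)) (fun j hj => hpW _ (by lia))
        (fun j hj => hp (i + j) (by lia)) hadj (by rwa [Nat.add_sub_cancel' hid.le])
      simpa [Nat.add_sub_cancel' hid.le] using this
    -- no shortcuts
    have hcut : ∀ i j, i < j → j ≤ d → (∃ q : V, q = p j ∧ (p i = q ∨ (i + 1 < j ∧ Γ.Adj (p i) q))) →
        False := by
      rintro i j hij hjd ⟨_, rfl, h | ⟨hij', h⟩⟩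
      · rcases Nat.eq_zero_or_pos (d - j) with hdj | hdj
        · have hdj : j = d := by lia
          subst hdj
          rcases Nat.eq_zero_or_pos i with rfl | hi
          · exact hne (congrArg f h)
          · exact hint i hi hij (h ▸ hd)
        · apply hne
          -- A repeated vertex allows the loop between its two occurrences to be cut out.
          have := ih (d - (j - i)) (by lia) (fun t => if t ≤ i then p t else p (t + (j - i)))
            (fun t ht => by
              split_ifs
              · exact hpW _ (by lia)
              · exact hpW _ (by lia))
            (fun t ht => by
              by_cases h1 : t + 1 ≤ i
              · rw [if_pos (by lia), if_pos h1]
                exact hp t (by lia)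
              · rw [if_neg h1]
                by_cases h2 : t ≤ i
                · have : t = i := by lia
                  subst this
                  rw [if_pos le_rfl, h, show t + 1 + (j - t) = j + 1 by lia]
                  exact hp j (by lia)
                · rw [if_neg h2, show t + 1 + (j - i) = t + (j - i) + 1 by lia]
                  exact hp _ (by lia))
            (by simpa using h0)
            (by
              rwa [if_neg (by lia), show d - (j - i) + (j - i) = d by lia])
          beta_reduce at this
          rwa [if_pos (Nat.zero_le _), if_neg (by lia), show d - (j - i) + (j - i) = d by lia] at this
      · apply hne
        -- A chord allows the vertices strictly between its ends to be skipped.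
        have := ih (d - (j - i - 1)) (by lia) (fun t => if t ≤ i then p t else p (t + (j - i - 1)))
          (fun t ht => by
            split_ifs
            · exact hpW _ (by lia)
            · exact hpW _ (by lia))
          (fun t ht => by
            by_cases h1 : t + 1 ≤ i
            · rw [if_pos (by lia), if_pos h1]
              exact hp t (by lia)
            · rw [if_neg h1]
              by_cases h2 : t ≤ i
              · have : t = i := by lia
                subst this
                rwa [if_pos le_rfl, show t + 1 + (j - t - 1) = j by lia]
              · rw [if_neg h2, show t + 1 + (j - i - 1) = t + (j - i - 1) + 1 by lia]
                exact hp _ (by lia))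
          (by simpa using h0)
          (by
            rwa [if_neg (by lia), show d - (j - i - 1) + (j - i - 1) = d by lia])
        beta_reduce at this
        rwa [if_pos (Nat.zero_le _), if_neg (by lia),
          show d - (j - i - 1) + (j - i - 1) = d by lia] at this
    -- Thus the cycle formed by `v` and `p 0, …, p d` has `d + 2 ≥ 4` vertices.
    have hd2 : 2 ≤ d := by
      by_contra h
      obtain rfl | rfl : d = 0 ∨ d = 1 := by lia
      · exact hne rfl
      · exact hne (hf _ (hpW 0 (by lia)) _ (hpW 1 le_rfl) h0 hd (hp 0 (by lia)))
    -- the induced cycle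
    let g : Fin (d + 2) → V := fun i => if i.val = 0 then v else p (i.val - 1)
    have hvp : ∀ i ≤ d, v ≠ p i := fun i hi h => hv (h ▸ hpW i hi)
    have hpp : ∀ i j, i < j → j ≤ d → (Γ.Adj (p i) (p j) ↔ j = i + 1) := by
      intro i j hij hjd
      constructor
      · intro h
        by_contra hj
        exact hcut i j hij hjd ⟨_, rfl, Or.inr ⟨by lia, h⟩⟩
      · rintro rfl
        exact hp i (by lia)
    have hvadj : ∀ i ≤ d, (Γ.Adj v (p i) ↔ i = 0 ∨ i = d) := by
      intro i hi
      constructor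
      · intro h
        by_contra h1
        exact hint i (by lia) (by lia) h
      · rintro (rfl | rfl)
        · exact h0
        · exact hd
    have hlt : ∀ i j : Fin (d + 2), i.val < j.val → (g i ≠ g j ∧
        (Γ.Adj (g i) (g j) ↔ (j.val = i.val + 1 ∨ (i.val = 0 ∧ j.val + 1 = d + 2)))) := by
      intro i j hij
      have hj := j.2
      by_cases hi : i.val = 0
      · simp only [g, if_pos hi, if_neg (show ¬ j.val = 0 by lia)]
        refine ⟨hvp _ (by lia), ?_⟩
        rw [hvadj _ (by lia)]
        lia
      · simp only [g, if_neg hi, if_neg (show ¬ j.val = 0 by lia)]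
        refine ⟨fun h => hcut (i.val - 1) (j.val - 1) (by lia) (by lia) ⟨_, rfl, Or.inl h⟩, ?_⟩
        rw [hpp _ _ (by lia) (by lia)]
        lia
    refine (hΓ (d + 2) (by lia)).false ⟨⟨g, fun i j h => ?_⟩, fun {i j} => ?_⟩
    · rcases lt_trichotomy i.val j.val with h1 | h1 | h1
      · exact absurd h (hlt i j h1).1
      · exact Fin.ext h1
      · exact absurd h.symm (hlt j i h1).1
    · change Γ.Adj (g i) (g j) ↔ _
      rw [SimpleGraph.cycleGraph_adj', fin_sub_val_eq_one_iff, fin_sub_val_eq_one_iff]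
      rcases lt_trichotomy i.val j.val with h1 | h1 | h1
      · rw [(hlt i j h1).2]
        lia
      · obtain rfl := Fin.ext h1
        simp only [SimpleGraph.irrefl, false_iff]
        lia
      · rw [SimpleGraph.adj_comm, (hlt j i h1).2]
        lia

/-- A function on the neighbours of `v` in `W` which is constant along edges extends to a function
on `W` which is constant along edges. -/
theorem exists_extension_of_isChordalGraph {Γ : SimpleGraph V} (hΓ : IsChordalGraph Γ) {W : Set V}
    {v : V} (hv : v ∉ W) (f : V → A)
    (hf : ∀ a ∈ W, ∀ b ∈ W, Γ.Adj v a → Γ.Adj v b → Γ.Adj a b → f a = f b) :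
    ∃ h : V → A, (∀ a ∈ W, Γ.Adj v a → h a = f a) ∧
      ∀ a ∈ W, ∀ b ∈ W, Γ.Adj a b → h a = h b := by
  classical
  let H : SimpleGraph V :=
    { Adj := fun x y => Γ.Adj x y ∧ x ∈ W ∧ y ∈ W
      symm := ⟨fun x y h => ⟨h.1.symm, h.2.2, h.2.1⟩⟩
      loopless := ⟨fun x h => Γ.irrefl h.1⟩ }
  have key : ∀ a ∈ W, ∀ b ∈ W, Γ.Adj v a → Γ.Adj v b → H.Reachable a b → f a = f b := by
    rintro a ha b hb hva hvb ⟨q⟩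
    have h1 : ∀ i, i < q.length → H.Adj (q.getVert i) (q.getVert (i + 1)) := fun i hi =>
      q.adj_getVert_succ hi
    have := eq_of_path_of_isChordalGraph hΓ hv f hf q.length q.getVert
      (fun i hi => by
        rcases hi.lt_or_eq with h | rfl
        · exact (h1 i h).2.1
        · rwa [q.getVert_length])
      (fun i hi => (h1 i hi).1) (by rwa [q.getVert_zero]) (by rwa [q.getVert_length])
    rwa [q.getVert_zero, q.getVert_length] at this
  let P : V → V → Prop := fun a b => b ∈ W ∧ Γ.Adj v b ∧ H.Reachable a b
  -- On each component of `W` meeting the neighbourhood of `v`, the common value of `f` on the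
  -- neighbours there; on the other components, zero.
  let h : V → A := fun a => if h : ∃ b, P a b then f h.choose else 0
  have hh : ∀ a b, P a b → h a = f b := by
    intro a b hb
    have hex : ∃ b, P a b := ⟨b, hb⟩
    have hc := hex.choose_spec
    simp only [h, dif_pos hex]
    exact key _ hc.1 _ hb.1 hc.2.1 hb.2.1 (hc.2.2.symm.trans hb.2.2)
  refine ⟨h, fun a ha hva => hh a a ⟨ha, hva, SimpleGraph.Reachable.refl a⟩, fun a ha b hb hab => ?_⟩
  have hr : H.Reachable a b := SimpleGraph.Adj.reachable (show H.Adj a b from ⟨hab, ha, hb⟩)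
  by_cases hex : ∃ c, P a c
  · obtain ⟨c, hc⟩ := hex
    rw [hh a c hc, hh b c ⟨hc.1, hc.2.1, hr.symm.trans hc.2.2⟩]
  · have hex' : ¬ ∃ c, P b c := fun ⟨c, hc⟩ => hex ⟨c, hc.1, hc.2.1, hr.trans hc.2.2⟩
    simp only [h, dif_neg hex, dif_neg hex']

/-- The cliques of a graph in a set of vertices. -/
def CliqueIn (Γ : SimpleGraph V) (W s : Set V) : Prop := Γ.IsClique s ∧ s ⊆ W

theorem CliqueIn.mono {Γ : SimpleGraph V} {W s t : Set V} (h : CliqueIn Γ W s) (hts : t ⊆ s) :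
    CliqueIn Γ W t := ⟨h.1.subset hts, hts.trans h.2⟩

theorem IsCochain.of_imp {F G : Set V → Prop} {n : ℕ} {c : (Fin n → V) → A} (h : IsCochain F c)
    (hFG : ∀ s, F s → G s) : IsCochain G c :=
  ⟨fun x hx => h.1 x fun h1 => hx ⟨h1.1, hFG _ h1.2⟩, h.2⟩

open Classical in
/-- The restriction of an alternating cochain to a smaller family of simplices. -/
noncomputable def restrictCochain (G : Set V → Prop) {n : ℕ} (c : (Fin n → V) → A) :
    (Fin n → V) → A := fun x => if IsSimplexOf G x then c x else 0

theorem isCochain_restrictCochain {G : Set V → Prop} {n : ℕ} {c : (Fin n → V) → A}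
    (h : ∀ (x : Fin n → V) (σ : Equiv.Perm (Fin n)),
      c (x ∘ σ) = ((Equiv.Perm.sign σ : ℤˣ) : ℤ) • c x) : IsCochain G (restrictCochain G c) := by
  classical
  refine ⟨fun x hx => if_neg hx, fun x σ => ?_⟩
  by_cases hx : IsSimplexOf G x
  · simp only [restrictCochain, if_pos hx, if_pos ((isSimplexOf_comp_perm σ).2 hx), h]
  · simp only [restrictCochain, if_neg hx, if_neg (mt (isSimplexOf_comp_perm σ).1 hx), smul_zero]

theorem restrictCochain_apply {G : Set V → Prop} {n : ℕ} (c : (Fin n → V) → A) {x : Fin n → V}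
    (hx : IsSimplexOf G x) : restrictCochain G c x = c x := if_pos hx

theorem alternatingFaceSum_restrictCochain {G : Set V → Prop} (hG : ∀ s t, G s → t ⊆ s → G t) {n : ℕ}
    (c : (Fin n → V) → A) {x : Fin (n + 1) → V} (hx : IsSimplexOf G x) :
    alternatingFaceSum (restrictCochain G c) x = alternatingFaceSum c x :=
  Finset.sum_congr rfl fun i _ => by rw [restrictCochain_apply _ (hx.succAbove hG i)]

/-- Alternating functions that agree on the lists beginning with `v`. -/
theorem eq_of_forall_cons {n : ℕ} {F : Set V → Prop} {v : V} {c c' : (Fin (n + 1) → V) → A}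
    (hc : ∀ x, IsSimplexOf F x → ∀ σ : Equiv.Perm (Fin (n + 1)),
      c (x ∘ σ) = ((Equiv.Perm.sign σ : ℤˣ) : ℤ) • c x)
    (hc' : ∀ x, IsSimplexOf F x → ∀ σ : Equiv.Perm (Fin (n + 1)),
      c' (x ∘ σ) = ((Equiv.Perm.sign σ : ℤˣ) : ℤ) • c' x)
    (h : ∀ x : Fin n → V, IsSimplexOf F (Fin.cons v x : Fin (n + 1) → V) →
      c (Fin.cons v x) = c' (Fin.cons v x)) {x : Fin (n + 1) → V} (hx : IsSimplexOf F x)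
    (hv : v ∈ Set.range x) : c x = c' x := by
  obtain ⟨j, rfl⟩ := hv
  have h2 : x ∘ Equiv.swap 0 j = Fin.cons (x j) (Fin.tail (x ∘ Equiv.swap 0 j)) := by
    conv_lhs => rw [← Fin.cons_self_tail (x ∘ Equiv.swap 0 j)]
    simp
  have h3 := h (Fin.tail (x ∘ Equiv.swap 0 j)) (by
    rw [← h2]
    exact (isSimplexOf_comp_perm _).2 hx)
  rw [← h2, hc x hx, hc' x hx] at h3
  have h4 := congrArg (fun t => ((Equiv.Perm.sign (Equiv.swap 0 j) : ℤˣ) : ℤ) • t) h3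
  simp only [smul_smul] at h4
  rwa [← Units.val_mul, Int.units_mul_self, Units.val_one, one_smul, one_smul] at h4

/-- Mayer–Vietoris for the deletion of a vertex `v`: the complex on `W` is the complex on `W' = W \
{v}` with a cone over that on `L`, the neighbours of `v`, attached. In degree at least 2 the
cohomology of both smaller complexes vanishes by induction. In degree 1, that of `W'` vanishes by
induction, and what is needed besides is that locally constant functions extend from `L` to `W'`. -/
theorem isAcyclicAt_cliqueIn_of_isChordalGraph [Finite V] {Γ : SimpleGraph V}
    (hΓ : IsChordalGraph Γ) (N : ℕ) : ∀ (W : Set V), W.ncard < N → ∀ n,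
      IsAcyclicAt (CliqueIn Γ W) A (n + 2) := by
  classical
  induction N with
  | zero => intro W hW; lia
  | succ N ih =>
    intro W hW n
    rcases W.eq_empty_or_nonempty with rfl | ⟨v, hv⟩
    · exact isAcyclicAt_of_isEmpty fun x hx => hx.2.2 ⟨0, rfl⟩
    intro c hc hdc
    set F := CliqueIn Γ W with hF
    set W' := W \ {v} with hW'
    set L : Set V := {x | x ∈ W' ∧ Γ.Adj v x} with hL
    have hFl : ∀ s t, F s → t ⊆ s → F t := fun s t hs hts => CliqueIn.mono hs hts
    have hcard : W'.ncard < W.ncard := Set.ncard_sdiff_singleton_lt_of_mem hv W.toFinite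
    have hLW : L ⊆ W' := fun x hx => hx.1
    have hW'F : ∀ s, CliqueIn Γ W' s → F s := fun s hs => ⟨hs.1, hs.2.trans Set.sdiff_subset⟩
    have hLF' : ∀ s, CliqueIn Γ L s → CliqueIn Γ W' s := fun s hs => ⟨hs.1, hs.2.trans hLW⟩
    have hvW' : v ∉ W' := fun h => h.2 rfl
    have hcons : ∀ {m : ℕ} {x : Fin m → V},
        IsSimplexOf F (Fin.cons v x : Fin (m + 1) → V) ↔ IsSimplexOf (CliqueIn Γ L) x := by
      intro m x
      unfold IsSimplexOf
      rw [Fin.cons_injective_iff, Fin.range_cons, hF, CliqueIn, CliqueIn,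
        SimpleGraph.isClique_insert]
      constructor
      · rintro ⟨⟨h1, h2⟩, ⟨h3, h4⟩, h5⟩
        refine ⟨h2, h3, fun y hy => ?_⟩
        have hvy : v ≠ y := fun h => h1 (h ▸ hy)
        exact ⟨⟨h5 (Set.mem_insert_of_mem _ hy), hvy.symm⟩, h4 y hy hvy⟩
      · rintro ⟨h2, h3, h4⟩
        refine ⟨⟨fun h => hvW' (h4 h).1, h2⟩, ⟨h3, fun y hy _ => (h4 hy).2⟩, ?_⟩
        rintro y (rfl | hy)
        · exact hv
        · exact (h4 hy).1.1
    -- make the cochain vanish on the star of `v`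
    let g₀ : (Fin (n + 1) → V) → A := restrictCochain F fun x => c (Fin.cons v x)
    have hg₀ : IsCochain F g₀ := isCochain_restrictCochain fun x σ => alternating_cons hc.2 v x σ
    let c₁ : (Fin (n + 2) → V) → A := c - restrictCochain F (alternatingFaceSum g₀)
    have hdg₀ : IsCochain F (restrictCochain F (alternatingFaceSum g₀)) := by
      exact hg₀.coboundary
    have hc₁ : IsCochain F c₁ := hc.sub hdg₀
    have hc₁v : ∀ x, IsSimplexOf F (Fin.cons v x : Fin (n + 2) → V) → c₁ (Fin.cons v x) = 0 := by
      intro x hx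
      change c _ - restrictCochain F _ _ = 0
      rw [restrictCochain_apply _ hx, alternatingFaceSum_restrictCochain hFl _ hx,
        alternatingFaceSum_cons_of_mem hc.2 (fun t ht => hc.1 t fun h => ht h.1)
          ⟨0, Fin.cons_zero _ _⟩, sub_self]
    have hdc₁ : ∀ x, IsSimplexOf F x → alternatingFaceSum c₁ x = 0 := by
      intro x hx
      rw [alternatingFaceSum_sub, hdc x hx, alternatingFaceSum_restrictCochain hFl _ hx,
        alternatingFaceSum_alternatingFaceSum, sub_zero]
    -- A cocycle that vanishes on the simplices through `v` also vanishes on the link of `v`.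
    have hc₁L : ∀ x, IsSimplexOf (CliqueIn Γ L) x → c₁ x = 0 := by
      intro x hx
      have hx' := hcons.2 hx
      have h1 := hdc₁ _ hx'
      rw [alternatingFaceSum_cons, sub_eq_zero] at h1
      rw [h1]
      refine Finset.sum_eq_zero fun i _ => ?_
      beta_reduce
      rw [hc₁v _ (hcons.2 (hx.succAbove (fun s t hs hts => hs.mono hts) i)), smul_zero]
    -- a cochain on the complement of `v`
    obtain ⟨g₁, hg₁, hg₁c⟩ := ih W' (by lia) n (restrictCochain (CliqueIn Γ W') c₁)
      (isCochain_restrictCochain hc₁.2) fun x hx => by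
        rw [alternatingFaceSum_restrictCochain (fun s t hs hts => hs.mono hts) _ hx]
        exact hdc₁ x ⟨hx.1, hW'F _ hx.2⟩
    have hg₁L : ∀ x : Fin (n + 2) → V, IsSimplexOf (CliqueIn Γ L) x →
        alternatingFaceSum g₁ x = 0 := by
      intro x hx
      have hx' : IsSimplexOf (CliqueIn Γ W') x := ⟨hx.1, hLF' _ hx.2⟩
      rw [← hg₁c x hx', restrictCochain_apply _ hx', hc₁L x hx]
    -- The primitive `g₁` on `W'` restricts to a cocycle on the link. Subtracting a cocycle `h` on
    -- `W'` that agrees with it there makes the primitive vanish on the link, so that it can be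
    -- extended by zero over the star of `v`.
    obtain ⟨h, hh, hdh, hhL⟩ : ∃ h : (Fin (n + 1) → V) → A, IsCochain (CliqueIn Γ W') h ∧
        (∀ x, IsSimplexOf (CliqueIn Γ W') x → alternatingFaceSum h x = 0) ∧
        ∀ x, IsSimplexOf (CliqueIn Γ L) x → h x = g₁ x := by
      cases n with
      | zero =>
        have hpair : ∀ {U : Set V} {a b : V}, a ∈ U → b ∈ U → Γ.Adj a b →
            IsSimplexOf (CliqueIn Γ U) ![a, b] := by
          intro U a b ha hb hab
          refine ⟨?_, ?_⟩
          · intro i j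
            fin_cases i <;> fin_cases j <;> simp [hab.ne, hab.ne.symm]
          · simp only [CliqueIn, Matrix.range_cons, Matrix.range_empty, Set.union_empty]
            refine ⟨?_, ?_⟩
            · rw [Set.singleton_union, SimpleGraph.isClique_pair]
              exact fun _ => hab
            · rintro x (rfl | rfl) <;> assumption
        have hsum : ∀ (f : (Fin 1 → V) → A) (a b : V),
            alternatingFaceSum f ![a, b] = f ![b] - f ![a] := by
          intro f a b
          have h0 : ![a, b] ∘ Fin.succAbove 0 = ![b] := by
            funext i; fin_cases i; rfl
          have h1 : ![a, b] ∘ Fin.succAbove 1 = ![a] := by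
            funext i; fin_cases i; rfl
          unfold alternatingFaceSum
          rw [Fin.sum_univ_two, h0, h1]
          simp [sub_eq_add_neg]
        have heta : ∀ x : Fin 2 → V, x = ![x 0, x 1] := fun x => by
          funext i; fin_cases i <;> rfl
        have heta1 : ∀ x : Fin 1 → V, x = ![x 0] := fun x => by
          funext i; fin_cases i; rfl
        obtain ⟨f, hf1, hf2⟩ := exists_extension_of_isChordalGraph hΓ hvW' (fun a => g₁ ![a])
          fun a ha b hb hva hvb hab => by
            have h1 := hg₁L _ (hpair (U := L) ⟨ha, hva⟩ ⟨hb, hvb⟩ hab)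
            rw [hsum, sub_eq_zero] at h1
            exact h1.symm
        refine ⟨restrictCochain (CliqueIn Γ W') fun x => f (x 0),
          isCochain_restrictCochain fun x σ => ?_, fun x hx => ?_, fun x hx => ?_⟩
        · obtain rfl : σ = 1 := Equiv.ext fun i => Subsingleton.elim (α := Fin 1) _ _
          simp
        · rw [alternatingFaceSum_restrictCochain (fun s t hs hts => hs.mono hts) _ hx, heta x, hsum,
            sub_eq_zero]
          refine (hf2 _ (hx.2.2 ⟨0, rfl⟩) _ (hx.2.2 ⟨1, rfl⟩) ?_).symm
          exact hx.2.1 ⟨0, rfl⟩ ⟨1, rfl⟩ (hx.1.ne (by simp))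
        · rw [restrictCochain_apply _ ⟨hx.1, hLF' _ hx.2⟩]
          have h1 := hx.2.2 ⟨0, rfl⟩
          rw [hf1 _ h1.1 h1.2, ← heta1]
      | succ n =>
        -- On the link `g₁` is the coboundary of some `g₂`; the coboundary of `g₂`, extended by
        -- zero, is a cocycle on all of `W'`.
        obtain ⟨g₂, hg₂, hg₂c⟩ := ih L (by
            have := Set.ncard_le_ncard hLW W'.toFinite
            lia) n (restrictCochain (CliqueIn Γ L) g₁) (isCochain_restrictCochain hg₁.2) fun x hx => by
              rw [alternatingFaceSum_restrictCochain (fun s t hs hts => hs.mono hts) _ hx, hg₁L x hx]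
        refine ⟨restrictCochain (CliqueIn Γ W') (alternatingFaceSum g₂),
          isCochain_restrictCochain fun x σ => alternatingFaceSum_comp_perm x
            (fun i τ => hg₂.2 _ τ) σ, fun x hx => ?_, fun x hx => ?_⟩
        · rw [alternatingFaceSum_restrictCochain (fun s t hs hts => hs.mono hts) _ hx,
            alternatingFaceSum_alternatingFaceSum]
        · rw [restrictCochain_apply _ ⟨hx.1, hLF' _ hx.2⟩, ← hg₂c x hx, restrictCochain_apply _ hx]
    have hg : IsCochain F (g₁ - h) := (hg₁.sub hh).of_imp hW'F
    refine ⟨g₀ + (g₁ - h), hg₀.add hg, fun x hx => ?_⟩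
    have hx₁ : c x = c₁ x + alternatingFaceSum g₀ x := by
      change _ = c x - restrictCochain F (alternatingFaceSum g₀) x + _
      rw [restrictCochain_apply _ hx, sub_add_cancel]
    rw [alternatingFaceSum_add, hx₁, add_comm]
    congr 1
    by_cases hvx : v ∈ Set.range x
    · refine eq_of_forall_cons (F := F) (v := v) (fun x _ => hc₁.2 x)
        (fun x _ σ => alternatingFaceSum_comp_perm x (fun i τ => hg.2 _ τ) σ) (fun y hy => ?_) hx hvx
      rw [hc₁v y hy, alternatingFaceSum_cons]
      have hyL := hcons.1 hy
      have h1 : (g₁ - h) y = 0 := by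
        rw [Pi.sub_apply, hhL y hyL, sub_self]
      rw [h1, zero_sub, eq_comm, neg_eq_zero]
      refine Finset.sum_eq_zero fun i _ => ?_
      have : (g₁ - h) (Fin.cons v (y ∘ i.succAbove)) = 0 :=
        (hg₁.sub hh).1 _ fun h2 => hvW' (h2.2.2 ⟨0, Fin.cons_zero _ _⟩)
      beta_reduce
      rw [this, smul_zero]
    · have hx' : IsSimplexOf (CliqueIn Γ W') x :=
        ⟨hx.1, hx.2.1, fun y hy => ⟨hx.2.2 hy, fun h1 => hvx (h1 ▸ hy)⟩⟩
      rw [alternatingFaceSum_sub, hdh x hx', sub_zero, ← hg₁c x hx', restrictCochain_apply _ hx']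

end Chordal

/-! ### Cohomology classes of facets -/

section Facet

variable {V : Type v}

open Classical in
/-- The alternating cochain with value `1` on the list `v` and supported on the permutations of
`v`. -/
noncomputable def facetCochain {n : ℕ} (v x : Fin n → V) : ℤ :=
  (Matrix.of fun i j => if x i = v j then (1 : ℤ) else 0).det

theorem facetCochain_comp_perm {n : ℕ} (v x : Fin n → V) (σ : Equiv.Perm (Fin n)) :
    facetCochain v (x ∘ σ) = ((Equiv.Perm.sign σ : ℤˣ) : ℤ) • facetCochain v x := by
  classical
  unfold facetCochain
  have h := Matrix.det_permute σ (Matrix.of fun i j => if x i = v j then (1 : ℤ) else 0)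
  rwa [Int.cast_id] at h

theorem facetCochain_self {n : ℕ} {v : Fin n → V} (hv : Function.Injective v) :
    facetCochain v v = 1 := by
  classical
  unfold facetCochain
  rw [← Matrix.det_one (R := ℤ) (n := Fin n)]
  congr 1
  ext i j
  simp [Matrix.one_apply, hv.eq_iff]

theorem injective_and_range_eq_of_facetCochain_ne_zero {n : ℕ} {v x : Fin n → V}
    (h : facetCochain v x ≠ 0) : Function.Injective x ∧ Set.range x = Set.range v := by
  classical
  refine ⟨fun i j hij => ?_, Set.Subset.antisymm ?_ ?_⟩
  · by_contra hne
    exact h (Matrix.det_zero_of_row_eq hne (by funext a; simp [hij]))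
  · rintro _ ⟨i, rfl⟩
    by_contra hi
    exact h (Matrix.det_eq_zero_of_row_eq_zero i fun j =>
      if_neg fun hij => hi ⟨j, hij.symm⟩)
  · rintro _ ⟨j, rfl⟩
    by_contra hj
    exact h (Matrix.det_eq_zero_of_column_eq_zero j fun i =>
      if_neg fun hij => hj ⟨i, hij⟩)

/-- A simplicial complex with a facet `v` has non-trivial cohomology if a functional that vanishes on
all coboundaries does not vanish on the cochain of `v`. -/
theorem not_isAcyclicAt_of_facet {F : Set V → Prop} {n : ℕ} {v : Fin (n + 1) → V}
    (hv : IsSimplexOf F v) (hmax : ∀ s, F s → Set.range v ⊆ s → s ⊆ Set.range v)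
    {ι : Type*} [Fintype ι] (w : ι → ℤ) (y : ι → Fin (n + 1) → V) (hy : ∀ i, IsSimplexOf F (y i))
    (hcob : ∀ b : (Fin n → V) → ℤ, IsCochain F b → ∑ i, w i * alternatingFaceSum b (y i) = 0)
    (hval : ∑ i, w i * facetCochain v (y i) ≠ 0) : ¬ IsAcyclicAt F ℤ (n + 1) := by
  intro h
  obtain ⟨b, hb, hvb⟩ := h (facetCochain v) ⟨fun x hx => by
    by_contra h0
    obtain ⟨h1, h2⟩ := injective_and_range_eq_of_facetCochain_ne_zero h0
    exact hx ⟨h1, h2 ▸ hv.2⟩, facetCochain_comp_perm v⟩ fun x hx => by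
      -- The facet cochain is a cocycle: a simplex with a face on the vertices of `v` would properly
      -- contain the facet.
      refine Finset.sum_eq_zero fun i _ => ?_
      by_contra h0
      have h1 := (injective_and_range_eq_of_facetCochain_ne_zero (right_ne_zero_of_smul h0)).2
      have h2 : Set.range v ⊆ Set.range x := h1 ▸ Set.range_comp_subset_range _ _
      have h3 := hmax _ hx.2 h2 ⟨i, rfl⟩
      rw [← h1] at h3
      obtain ⟨j, hj⟩ := h3
      exact Fin.succAbove_ne i j (hx.1 hj)
  refine hval ?_
  rw [← hcob b hb]
  exact Finset.sum_congr rfl fun i _ => by rw [hvb _ (hy i)]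

/-- The sum of the edges `[i, i + 1]` is a cycle on which coboundaries telescope to zero, while the
cochain of the edge `[0, 1]` takes the value 1. With at least four vertices there are no triangles,
so this edge is a facet. -/
theorem not_isAcyclicAt_isClique_cycleGraph (n : ℕ) :
    ¬ IsAcyclicAt (SimpleGraph.cycleGraph (n + 4)).IsClique ℤ 2 := by
  have hadj : ∀ i j : Fin (n + 4), (SimpleGraph.cycleGraph (n + 4)).Adj i j ↔
      (i.val = j.val + 1 ∨ (i.val = 0 ∧ j.val + 1 = n + 4)) ∨
      (j.val = i.val + 1 ∨ (j.val = 0 ∧ i.val + 1 = n + 4)) := by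
    intro i j
    rw [SimpleGraph.cycleGraph_adj', fin_sub_val_eq_one_iff, fin_sub_val_eq_one_iff]
  have hval : ∀ i : Fin (n + 4), (i + 1).val = if i.val + 1 = n + 4 then 0 else i.val + 1 := by
    intro i
    rw [Fin.val_add, Fin.val_one]
    split_ifs with h
    · rw [h, Nat.mod_self]
    · exact Nat.mod_eq_of_lt (by lia)
  have hsucc : ∀ i : Fin (n + 4), (SimpleGraph.cycleGraph (n + 4)).Adj i (i + 1) := by
    intro i
    rw [hadj, hval]
    split_ifs <;> lia
  have hedge : ∀ i : Fin (n + 4),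
      IsSimplexOf (SimpleGraph.cycleGraph (n + 4)).IsClique ![i, i + 1] := by
    intro i
    refine ⟨?_, ?_⟩
    · intro a b
      have := (hsucc i).ne
      fin_cases a <;> fin_cases b <;> simp [this, this.symm]
    · simp only [Matrix.range_cons, Matrix.range_empty, Set.union_empty]
      rw [Set.singleton_union, SimpleGraph.isClique_pair]
      exact fun _ => hsucc i
  refine not_isAcyclicAt_of_facet (v := ![0, 0 + 1]) (hedge 0) (fun s hs h0 z hz => ?_)
    (fun _ : Fin (n + 4) => 1) (fun i => ![i, i + 1]) hedge (fun b _ => ?_) ?_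
  · by_contra hz'
    have h1 : ∀ a : Fin 2, (SimpleGraph.cycleGraph (n + 4)).Adj (![0, 0 + 1] a) z := fun a =>
      hs (h0 ⟨a, rfl⟩) hz fun h => hz' ⟨a, h⟩
    have h2 := (hadj _ _).1 (h1 0)
    have h3 := (hadj _ _).1 (h1 1)
    simp only [Matrix.cons_val_zero, Matrix.cons_val_one, hval, Fin.val_zero] at h2 h3
    split_ifs at h3 <;> lia
  · have hface : ∀ i : Fin (n + 4), alternatingFaceSum b ![i, i + 1] = b ![i + 1] - b ![i] := by
      intro i
      have h0 : ![i, i + 1] ∘ Fin.succAbove 0 = ![i + 1] := by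
        funext i; fin_cases i; rfl
      have h1 : ![i, i + 1] ∘ Fin.succAbove 1 = ![i] := by
        funext i; fin_cases i; rfl
      unfold alternatingFaceSum
      rw [Fin.sum_univ_two, h0, h1]
      simp [sub_eq_add_neg]
    simp only [hface, one_mul, Finset.sum_sub_distrib]
    rw [sub_eq_zero]
    exact Equiv.sum_comp (Equiv.addRight (1 : Fin (n + 4))) fun i => b ![i]
  · rw [Finset.sum_eq_single 0]
    · rw [facetCochain_self (hedge 0).1]
      simp
    · intro i _ hi
      rw [one_mul]
      by_contra h0
      have h1 := (injective_and_range_eq_of_facetCochain_ne_zero h0).2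
      simp only [Matrix.range_cons, Matrix.range_empty, Set.union_empty] at h1
      have h2 : i ∈ ({0} ∪ {0 + 1} : Set (Fin (n + 4))) := h1 ▸ Or.inl rfl
      have h3 : i + 1 ∈ ({0} ∪ {0 + 1} : Set (Fin (n + 4))) := h1 ▸ Or.inr rfl
      have hi1 : i = 0 + 1 := h2.resolve_left hi
      subst hi1
      rcases h3 with h3 | h3 <;>
      · have := congrArg Fin.val h3
        rw [hval, zero_add, Fin.val_one] at this
        simp at this
    · simp

variable {Γ : SimpleGraph V}

theorem isAcyclicAt_induced_cliqueComplex_iff [Finite V] {A : Type*} [AddCommGroup A] (W : Set V)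
    (n : ℕ) : IsAcyclicAt ((cliqueComplex Γ).induced W).IsFaceOrEmpty A n ↔
      IsAcyclicAt (CliqueIn Γ W) A n :=
  isAcyclicAt_comap_iff Subtype.val_injective (fun s hs => by simpa using hs.2) (fun s => by
    rw [FreePCLeftRegularBand.isFaceOrEmpty_cliqueComplex_induced_iff, CliqueIn,
      and_iff_left (by simp)]) n

theorem FreePCLeftRegularBand.cohomologicalDimension_le_one_iff [Finite V] :
    cohomologicalDimension ℤ (FreePCLeftRegularBand Γ) ≤ 1 ↔ IsChordalGraph Γ := by
  rw [← Nat.cast_one, FreePCLeftRegularBand.cohomologicalDimension_le_iff]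
  simp only [isAcyclicAt_induced_cliqueComplex_iff]
  refine ⟨fun h n hn => ⟨fun f => ?_⟩, fun h n hn W => ?_⟩
  · obtain ⟨n, rfl⟩ : ∃ m, n = m + 4 := ⟨n - 4, by lia⟩
    refine not_isAcyclicAt_isClique_cycleGraph n
      ((isAcyclicAt_comap_iff f.injective (fun s hs => hs.2) (fun s => ?_) 2).2
        (h 2 (by lia) (Set.range f)))
    rw [CliqueIn, and_iff_left (Set.image_subset_range _ _)]
    constructor
    · rintro hs _ ⟨a, ha, rfl⟩ _ ⟨b, hb, rfl⟩ hab
      exact f.map_adj_iff.2 (hs ha hb fun h => hab (congrArg f h))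
    · intro hs a ha b hb hab
      exact f.map_adj_iff.1 (hs ⟨a, ha, rfl⟩ ⟨b, hb, rfl⟩ (f.injective.ne hab))
  · obtain ⟨n, rfl⟩ : ∃ m, n = m + 2 := ⟨n - 2, by lia⟩
    exact isAcyclicAt_cliqueIn_of_isChordalGraph h (W.ncard + 1) W (Nat.lt_succ_self _) n

end Facet

/-! ### Cocktail party graphs -/

/-- The graph with vertex set `Fin m × Bool` in which `(i, a)` and `(j, b)` are adjacent if and only
if `i ≠ j`: its clique complex is the boundary of the `m`-dimensional cross-polytope. -/
def cocktailPartyGraph (m : ℕ) : SimpleGraph (Fin m × Bool) where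
  Adj x y := x.1 ≠ y.1
  symm := ⟨fun _ _ => Ne.symm⟩
  loopless := ⟨fun _ h => h rfl⟩

/-- The functional is the fundamental cycle of the boundary of the cross-polytope: the facets are
the sign vectors `ε`, weighted by the product of their signs. -/
theorem not_isAcyclicAt_isClique_cocktailPartyGraph (n : ℕ) :
    ¬ IsAcyclicAt (cocktailPartyGraph (n + 1)).IsClique ℤ (n + 1) := by
  have hy : ∀ ε : Fin (n + 1) → Bool,
      IsSimplexOf (cocktailPartyGraph (n + 1)).IsClique fun i => (i, ε i) := by
    refine fun ε => ⟨fun i j h => (Prod.ext_iff.1 h).1, ?_⟩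
    rintro _ ⟨i, rfl⟩ _ ⟨j, rfl⟩ hij
    exact fun h => hij (by rw [show i = j from h])
  refine not_isAcyclicAt_of_facet (v := fun i => (i, true)) (hy fun _ => true)
    (fun s hs h0 z hz => ?_)
    (fun ε : Fin (n + 1) → Bool => ∏ i, if ε i then (1 : ℤ) else -1) (fun ε i => (i, ε i)) hy
    (fun b _ => ?_) ?_
  · by_contra hz'
    exact hs (h0 ⟨z.1, rfl⟩) hz (fun h => hz' ⟨z.1, h⟩) rfl
  · simp only [alternatingFaceSum, Finset.mul_sum]
    rw [Finset.sum_comm]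
    refine Finset.sum_eq_zero fun j _ => ?_
    -- Flipping `ε j` leaves the face that omits `j` unchanged and reverses the weight.
    refine Finset.sum_involution (fun ε _ => Function.update ε j (!ε j)) (fun ε _ => ?_)
      (fun ε _ _ h => ?_) (fun _ _ => Finset.mem_univ _) fun ε _ => by simp
    · have h1 : (fun i => (i, Function.update ε j (!ε j) i)) ∘ j.succAbove =
          (fun i => (i, ε i)) ∘ j.succAbove := by
        funext i
        simp
      rw [h1, Fin.prod_univ_succAbove _ j, Fin.prod_univ_succAbove _ j]
      simp only [Function.update_self, Function.update_of_ne (Fin.succAbove_ne j _)]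
      cases ε j <;> simp
    · simpa using congrFun h j
  · rw [Finset.sum_eq_single fun _ => true]
    · rw [facetCochain_self (hy fun _ => true).1]
      simp
    · intro ε _ hε
      by_contra h0
      have h1 := (injective_and_range_eq_of_facetCochain_ne_zero (right_ne_zero_of_mul h0)).2
      refine hε (funext fun i => ?_)
      obtain ⟨j, hj⟩ : (i, ε i) ∈ Set.range fun i : Fin (n + 1) => (i, true) := h1 ▸ ⟨i, rfl⟩
      exact (Prod.ext_iff.1 hj).2.symm
    · simp

/-- Cliques have at most one vertex from each of the `m` antipodal pairs, which bounds the degree;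
the full vertex set attains it. -/
theorem cohomologicalDimension_cocktailPartyGraph (m : ℕ) :
    cohomologicalDimension ℤ (FreePCLeftRegularBand (cocktailPartyGraph m)) = m := by
  refine le_antisymm ?_ ?_
  · rw [FreePCLeftRegularBand.cohomologicalDimension_le_iff]
    intro n hn W
    obtain ⟨n, rfl⟩ : ∃ l, n = l + 1 := ⟨n - 1, by lia⟩
    rw [isAcyclicAt_induced_cliqueComplex_iff]
    refine isAcyclicAt_of_isEmpty fun x hx => ?_
    have := Fintype.card_le_of_injective (fun i => (x i).1) fun i j hij => by
      by_contra hne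
      exact hx.2.1 ⟨i, rfl⟩ ⟨j, rfl⟩ (hx.1.ne hne) hij
    simp at this
    lia
  · cases m with
    | zero => simp
    | succ n =>
      by_contra h
      have h1 : cohomologicalDimension ℤ (FreePCLeftRegularBand (cocktailPartyGraph (n + 1))) ≤ n :=
        Order.le_of_lt_succ (by simpa [Order.succ_eq_add_one] using h)
      rw [FreePCLeftRegularBand.cohomologicalDimension_le_iff] at h1
      refine not_isAcyclicAt_isClique_cocktailPartyGraph n ?_
      have h2 : CliqueIn (cocktailPartyGraph (n + 1)) Set.univ =
          (cocktailPartyGraph (n + 1)).IsClique :=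
        funext fun s => propext (and_iff_left (Set.subset_univ s))
      rw [← h2]
      exact (isAcyclicAt_induced_cliqueComplex_iff _ _).1
        (h1 (n + 1) (Nat.lt_succ_self n) Set.univ)

/-! ### Inflation along a retraction of monoids -/

/-- A retraction `π` of a monoid `P` onto a monoid `N`, with an element `p` of the kernel on which `P`
acts by left multiplication through `π`. -/
structure AbsorbingRetraction (P N : Type v) [Monoid P] [Monoid N] where
  /-- The retraction. -/
  π : P →* N
  /-- The section. -/
  i : N →* P
  /-- The absorbing element. -/
  p : P
  π_i : ∀ x, π (i x) = x
  π_p : π p = 1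
  mul_p : ∀ q, q * p = i (π q) * p

theorem shortExact_restrictScalars {R S : Type*} [Ring R] [Ring S] (f : R →+* S)
    {E : ShortComplex (ModuleCat.{w} S)} (hE : E.ShortExact) :
    (E.map (ModuleCat.restrictScalars f)).ShortExact := by
  have := hE.mono_f
  have := hE.epi_g
  exact ModuleCat.shortComplex_shortExact _
    ((ShortComplex.ShortExact.moduleCat_exact_iff_function_exact E).1 hE.exact)
    ((ModuleCat.mono_iff_injective E.f).1 inferInstance)
    ((ModuleCat.epi_iff_surjective E.g).1 inferInstance)

namespace AbsorbingRetraction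

variable {P N : Type v} [Monoid P] [Monoid N] (A : AbsorbingRetraction P N)

/-- The pull-back of modules along the retraction. -/
noncomputable abbrev inflate (T : ModuleCat.{w} ℤ[N]) : ModuleCat.{w} ℤ[P] :=
  (ModuleCat.restrictScalars (MonoidAlgebra.mapDomainRingHom ℤ A.π)).obj T

theorem single_smul_inflate {T : ModuleCat.{w} ℤ[N]} (q : P) (t : T) :
    (MonoidAlgebra.single q 1 : ℤ[P]) • (show A.inflate T from t) =
      (MonoidAlgebra.single (A.π q) 1 : ℤ[N]) • t := by
  have h : MonoidAlgebra.mapDomainRingHom ℤ A.π (MonoidAlgebra.single q 1) =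
      MonoidAlgebra.single (A.π q) 1 := by simp
  change MonoidAlgebra.mapDomainRingHom ℤ A.π (MonoidAlgebra.single q 1) • t = _
  rw [h]

/-- The elements of a module that are fixed by the absorbing element. -/
noncomputable def fixedSubmodule (V : Type w) [AddCommGroup V] [Module ℤ[P] V] :
    Submodule ℤ[P] V :=
  submoduleOfStable (DistribSMul.toAddMonoidHom V (MonoidAlgebra.single A.p 1 : ℤ[P])
    |>.eqLocus (AddMonoidHom.id V)) fun q x hx => by
      have hx' : (MonoidAlgebra.single A.p 1 : ℤ[P]) • x = x := hx
      change (MonoidAlgebra.single A.p 1 : ℤ[P]) • (MonoidAlgebra.single q 1 : ℤ[P]) • x =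
        (MonoidAlgebra.single q 1 : ℤ[P]) • x
      conv_lhs => rw [← hx']
      conv_rhs => rw [← hx']
      simp only [← mul_smul, MonoidAlgebra.single_mul_single, mul_one]
      -- Stability is the identity `p q p = q p`: both sides are `i (π q) p`, because `π p = 1`.
      rw [← mul_assoc, A.mul_p (A.p * q), A.mul_p q]
      simp [A.π_p]

theorem mem_fixedSubmodule {V : Type w} [AddCommGroup V] [Module ℤ[P] V] {x : V} :
    x ∈ A.fixedSubmodule V ↔ (MonoidAlgebra.single A.p 1 : ℤ[P]) • x = x := Iff.rfl

theorem p_smul_mem_fixedSubmodule {V : Type w} [AddCommGroup V] [Module ℤ[P] V] (x : V) :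
    (MonoidAlgebra.single A.p 1 : ℤ[P]) • x ∈ A.fixedSubmodule V := by
  rw [mem_fixedSubmodule, ← mul_smul, MonoidAlgebra.single_mul_single, mul_one, A.mul_p, A.π_p,
    map_one, one_mul]

theorem smul_of_mem {V : Type w} [AddCommGroup V] [Module ℤ[P] V] {x : V}
    (hx : x ∈ A.fixedSubmodule V) (q : P) :
    (MonoidAlgebra.single q 1 : ℤ[P]) • x = (MonoidAlgebra.single (A.i (A.π q)) 1 : ℤ[P]) • x := by
  rw [← A.mem_fixedSubmodule.1 hx, ← mul_smul, ← mul_smul, MonoidAlgebra.single_mul_single,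
    MonoidAlgebra.single_mul_single, A.mul_p]

/-- The right adjoint of inflation. -/
noncomputable abbrev deflate (V : ModuleCat.{w} ℤ[P]) : ModuleCat.{w} ℤ[N] :=
  (ModuleCat.restrictScalars (MonoidAlgebra.mapDomainRingHom ℤ A.i)).obj
    (ModuleCat.of ℤ[P] (A.fixedSubmodule V))

theorem single_smul_deflate {V : ModuleCat.{w} ℤ[P]} (x : N) (t : A.deflate V) :
    ((MonoidAlgebra.single x 1 : ℤ[N]) • t).1 = (MonoidAlgebra.single (A.i x) 1 : ℤ[P]) • t.1 := by
  have h : MonoidAlgebra.mapDomainRingHom ℤ A.i (MonoidAlgebra.single x 1) =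
      MonoidAlgebra.single (A.i x) 1 := by simp
  change MonoidAlgebra.mapDomainRingHom ℤ A.i (MonoidAlgebra.single x 1) • t.1 = _
  rw [h]

/-- One half of the adjunction: `p` acts as the identity on an inflated module, so homomorphisms out
of it land in the part fixed by `p`. The other half, `exists_inflate_hom`, uses that `P` acts on
this part through `π`. -/
theorem exists_deflate_hom {T : ModuleCat.{w} ℤ[N]} {V : ModuleCat.{w} ℤ[P]}
    (φ : A.inflate T ⟶ V) : ∃ ψ : T ⟶ A.deflate V, ∀ t : T, (ψ.hom t).1 = φ.hom t := by
  have h : ∀ (q : P) (t : T), (MonoidAlgebra.single q 1 : ℤ[P]) • φ.hom t =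
      φ.hom ((MonoidAlgebra.single (A.π q) 1 : ℤ[N]) • t) := by
    intro q t
    rw [← A.single_smul_inflate]
    exact (map_smul φ.hom _ _).symm
  let f : T →+ A.deflate V := AddMonoidHom.mk'
    (fun t => (⟨φ.hom t, by
      rw [mem_fixedSubmodule, h, A.π_p, ← MonoidAlgebra.one_def, one_smul]⟩ : A.fixedSubmodule V))
    fun a b => Subtype.ext (map_add φ.hom a b)
  let g : T →ₗ[ℤ[N]] A.deflate V := intLinearMapOfComm f fun x t => Subtype.ext (by
    rw [single_smul_deflate]
    change φ.hom _ = _ • φ.hom t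
    rw [h, A.π_i])
  let ψ := ModuleCat.ofHom g
  exact ⟨ψ, fun t => rfl⟩

theorem exists_inflate_hom {T : ModuleCat.{w} ℤ[N]} {V : ModuleCat.{w} ℤ[P]}
    (ψ : T ⟶ A.deflate V) : ∃ φ : A.inflate T ⟶ V, ∀ t : T, φ.hom t = (ψ.hom t).1 := by
  let f : A.inflate T →+ V := AddMonoidHom.mk' (fun t : T => (ψ.hom t).1)
    fun a b => congrArg Subtype.val (map_add ψ.hom a b)
  let g : A.inflate T →ₗ[ℤ[P]] V := intLinearMapOfComm f fun q t => by
    refine (congrArg f (A.single_smul_inflate q (show T from t))).trans ?_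
    change (ψ.hom _).1 = _ • (ψ.hom _).1
    rw [map_smul, single_smul_deflate]
    exact (A.smul_of_mem (ψ.hom _).2 q).symm
  let φ := ModuleCat.ofHom g
  exact ⟨φ, fun t => rfl⟩

/-- A left adjoint preserves projectives if its right adjoint preserves epimorphisms. It does here:
if `y` lifts an element fixed by `p`, then `p y` is a lift fixed by `p`. -/
theorem projective_inflate (F : ModuleCat.{w} ℤ[N]) [Projective F] : Projective (A.inflate F) where
  factors {E X} f e he := by
    obtain ⟨g, hg⟩ := A.exists_deflate_hom f
    obtain ⟨e', he'⟩ : ∃ e' : A.deflate E ⟶ A.deflate X, ∀ t, (e'.hom t).1 = e.hom t.1 :=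
      ⟨(ModuleCat.restrictScalars _).map (ModuleCat.ofHom (e.hom.restrict fun t ht => by
        rw [mem_fixedSubmodule, ← map_smul, A.mem_fixedSubmodule.1 ht])), fun t => rfl⟩
    have : Epi e' := by
      rw [ModuleCat.epi_iff_surjective] at he ⊢
      rintro ⟨x, hx⟩
      obtain ⟨y, rfl⟩ := he x
      refine ⟨(⟨_, A.p_smul_mem_fixedSubmodule y⟩ : A.fixedSubmodule E), Subtype.ext ?_⟩
      refine (he' _).trans ?_
      exact (map_smul e.hom _ _).trans (A.mem_fixedSubmodule.1 hx)
    obtain ⟨l, hl⟩ := A.exists_inflate_hom (Projective.factorThru g e')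
    refine ⟨l, ?_⟩
    ext t
    change e.hom (l.hom t) = f.hom t
    refine (congrArg e.hom (hl t)).trans ((he' _).symm.trans (Eq.trans ?_ (hg t)))
    exact congrArg (fun φ => (φ.hom t).1) (Projective.factorThru_comp g e')

/-- Free covers of `T` inflate to covers by projectives, so dimension shifting on both sides reduces
to the adjunction between homomorphisms. -/
theorem ext_subsingleton_iff (V : ModuleCat.{v} ℤ[P]) (n : ℕ) : ∀ T : ModuleCat.{v} ℤ[N],
    Subsingleton (Ext.{v} (A.inflate T) V n) ↔ Subsingleton (Ext.{v} T (A.deflate V) n) := by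
  have key : ∀ T : ModuleCat.{v} ℤ[N], ∃ (E : ShortComplex (ModuleCat.{v} ℤ[N])) (_ : E.ShortExact),
      E.X₃ = T ∧ Projective E.X₂ := by
    intro T
    let π : (T →₀ ℤ[N]) →ₗ[ℤ[N]] T := Finsupp.linearCombination _ id
    exact ⟨π.shortComplexKer, LinearMap.shortExact_shortComplexKer
      (Finsupp.linearCombination_id_surjective _ _), rfl,
      ModuleCat.projective_of_free (Finsupp.basisSingleOne (R := ℤ[N]) (ι := T))⟩
  induction n with
  | zero =>
    intro T
    rw [ext_zero_subsingleton_iff, ext_zero_subsingleton_iff]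
    constructor
    · intro h ψ
      obtain ⟨φ, hφ⟩ := A.exists_inflate_hom ψ
      rw [h φ] at hφ
      ext t
      exact Subtype.ext (hφ t).symm
    · intro h φ
      obtain ⟨ψ, hψ⟩ := A.exists_deflate_hom φ
      rw [h ψ] at hψ
      ext t
      exact (hψ t).symm
  | succ n ih =>
    intro T
    obtain ⟨E, hE, rfl, hP⟩ := key T
    have hE' := shortExact_restrictScalars (MonoidAlgebra.mapDomainRingHom ℤ A.π) hE
    have hP' : Projective (A.inflate E.X₂) := A.projective_inflate E.X₂
    cases n with
    | zero =>
      refine (ShortExact.ext_one_subsingleton_contra_iff hE' V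
        (Ext.subsingleton_of_projective (A.inflate E.X₂) V 0)).trans (Iff.trans ?_
        (ShortExact.ext_one_subsingleton_contra_iff hE (A.deflate V)
          (Ext.subsingleton_of_projective _ _ _)).symm)
      constructor
      · intro h φ
        obtain ⟨φ', hφ'⟩ := A.exists_inflate_hom φ
        obtain ⟨ψ', hψ'⟩ := h φ'
        obtain ⟨ψ, hψ⟩ := A.exists_deflate_hom ψ'
        refine ⟨ψ, ?_⟩
        ext t
        refine Subtype.ext ((hψ _).trans (Eq.trans ?_ (hφ' t)))
        exact congrArg (fun α => α.hom t) hψ'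
      · intro h φ
        obtain ⟨φ', hφ'⟩ := A.exists_deflate_hom φ
        obtain ⟨ψ', hψ'⟩ := h φ'
        obtain ⟨ψ, hψ⟩ := A.exists_inflate_hom ψ'
        refine ⟨ψ, ?_⟩
        ext t
        refine (hψ _).trans (Eq.trans ?_ (hφ' t))
        exact congrArg (fun α => (α.hom t).1) hψ'
    | succ n =>
      refine (ShortExact.ext_subsingleton_contra_shift_iff hE' V
        (fun q => Ext.subsingleton_of_projective (A.inflate E.X₂) V q) n).trans (Iff.trans ?_
        (ShortExact.ext_subsingleton_contra_shift_iff hE (A.deflate V)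
          (fun q => Ext.subsingleton_of_projective _ _ _) n).symm)
      exact ih E.X₁

theorem nonempty_inflate_trivialZModule_iso :
    Nonempty (A.inflate (trivialZModule.{v, w} N) ≅ trivialZModule.{v, w} P) := by
  let f : A.inflate (trivialZModule.{v, w} N) →+ trivialZModule.{v, w} P :=
    AddMonoidHom.id (ULift.{w} ℤ)
  let g := intLinearMapOfComm f fun q t => by
    rw [trivialZModule_smul]
    exact (congrArg f (A.single_smul_inflate q _)).trans (congrArg f (trivialZModule_smul _ _))
  exact ⟨(LinearEquiv.ofBijective g Function.bijective_id).toModuleIso⟩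

/-- Every `N`-module is thus a deflation, so testing over all `P`-modules tests over all
`N`-modules. -/
theorem nonempty_deflate_inflate_iso (W : ModuleCat.{w} ℤ[N]) :
    Nonempty (A.deflate (A.inflate W) ≅ W) := by
  let f : A.deflate (A.inflate W) →+ W := (A.fixedSubmodule (A.inflate W)).subtype.toAddMonoidHom
  let g := intLinearMapOfComm f fun x t => by
    refine (A.single_smul_deflate x t).trans ((A.single_smul_inflate _ _).trans ?_)
    rw [A.π_i]
    rfl
  refine ⟨(LinearEquiv.ofBijective g ⟨Subtype.val_injective, fun t => ⟨⟨t, ?_⟩, rfl⟩⟩).toModuleIso⟩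
  refine A.mem_fixedSubmodule.2 ((A.single_smul_inflate A.p t).trans ?_)
  rw [A.π_p, ← MonoidAlgebra.one_def, one_smul]

end AbsorbingRetraction

theorem nonempty_toIntModule_int_iso {B : Type v} [Monoid B] (V : ModuleCat.{w} ℤ[B]) :
    Nonempty (toIntModule ℤ V ≅ V) := by
  let f : toIntModule ℤ V →+ V := AddMonoidHom.id V
  let g := intLinearMapOfComm f fun b x => toIntModule_single_smul (V := V) b x
  exact ⟨(LinearEquiv.ofBijective g Function.bijective_id).toModuleIso⟩

theorem cohomologicalDimension_int_le_iff {B : Type v} [Monoid B] (N : ℕ) :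
    cohomologicalDimension ℤ B ≤ N ↔ ∀ n, N < n → ∀ V : ModuleCat.{v} ℤ[B],
      Subsingleton (Ext.{v} (trivialZModule.{v, v} B) V n) := by
  rw [cohomologicalDimension_le_iff]
  exact forall₂_congr fun n _ => forall_congr' fun V =>
    ext_subsingleton_congr_of_iso (Iso.refl _) (nonempty_toIntModule_int_iso V).some n

theorem AbsorbingRetraction.cohomologicalDimension_eq {P N : Type v} [Monoid P] [Monoid N]
    (A : AbsorbingRetraction P N) : cohomologicalDimension ℤ P = cohomologicalDimension ℤ N := by
  have key : ∀ V n, Subsingleton (Ext.{v} (trivialZModule.{v, v} P) V n) ↔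
      Subsingleton (Ext.{v} (trivialZModule.{v, v} N) (A.deflate V) n) := fun V n =>
    (ext_subsingleton_congr_of_iso A.nonempty_inflate_trivialZModule_iso.some.symm (Iso.refl V) n).trans
      (A.ext_subsingleton_iff V n _)
  refine enat_eq_of_forall_le_natCast fun d => ?_
  rw [cohomologicalDimension_int_le_iff, cohomologicalDimension_int_le_iff]
  refine forall₂_congr fun n _ => ⟨fun h W => ?_, fun h V => (key V n).2 (h _)⟩
  exact (ext_subsingleton_congr_of_iso (Iso.refl _) (A.nonempty_deflate_inflate_iso W).some n).1
    ((key (A.inflate W) n).1 (h _))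

/-! ### Products of a left regular band and a right regular band -/

section Product

variable {L R : Type v} [Monoid L] [Monoid R]

/-- The projection of `L × Rᵐᵒᵖ` to `L`, when `R` has a left zero. -/
def AbsorbingRetraction.prodFst {z : R} (hz : ∀ x, z * x = z) :
    AbsorbingRetraction (L × Rᵐᵒᵖ) L where
  π := MonoidHom.fst L Rᵐᵒᵖ
  i := MonoidHom.inl L Rᵐᵒᵖ
  p := (1, MulOpposite.op z)
  π_i _ := rfl
  π_p := rfl
  mul_p q := Prod.ext rfl (MulOpposite.unop_injective (by simp [hz]))

/-- The projection of `(L × Rᵐᵒᵖ)ᵐᵒᵖ` to `R`, when `L` has a left zero. -/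
def AbsorbingRetraction.prodSndOp {z : L} (hz : ∀ x, z * x = z) :
    AbsorbingRetraction (L × Rᵐᵒᵖ)ᵐᵒᵖ R where
  π :=
    { toFun := fun q => q.unop.2.unop
      map_one' := rfl
      map_mul' := fun _ _ => rfl }
  i :=
    { toFun := fun r => MulOpposite.op (1, MulOpposite.op r)
      map_one' := rfl
      map_mul' := fun r s => MulOpposite.unop_injective (by simp) }
  p := MulOpposite.op (z, 1)
  π_i _ := rfl
  π_p := rfl
  mul_p q := MulOpposite.unop_injective (by ext <;> simp [hz])

instance [IsLeftRegularBand R] : IsRightRegularBand Rᵐᵒᵖ where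
  mul_self x := MulOpposite.unop_injective (IsLeftRegularBand.mul_self x.unop)
  mul_mul_self x y := MulOpposite.unop_injective (by
    simpa [mul_assoc] using IsLeftRegularBand.mul_mul_self x.unop y.unop)

theorem isRegularBand_prod (L R : Type v) [Semigroup L] [Semigroup R] [IsLeftRegularBand L]
    [IsRightRegularBand R] [Nonempty L] [Nonempty R] : IsRegularBand (L × R) :=
  ⟨L, R, inferInstance, inferInstance, MulHom.fst L R, MulHom.snd L R, inferInstance, inferInstance,
    Prod.fst_surjective, Prod.snd_surjective, fun _ _ h => h⟩

/-- The product of all vertices absorbs every letter. -/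
theorem FreePCLeftRegularBand.exists_leftZero {V : Type v} [Finite V] (Γ : SimpleGraph V) :
    ∃ z : FreePCLeftRegularBand Γ, ∀ x, z * x = z := by
  refine ⟨word Γ (listOf Set.univ), fun x => ?_⟩
  obtain ⟨l, rfl⟩ := exists_word x
  exact word_mul_word fun x _ => mem_listOf.2 trivial

/-- In the product of `B(Γ)` for one cocktail party graph with the opposite of `B(Γ)` for another,
the left zero of each factor removes that factor on one of the two sides. -/
theorem exists_isRegularBand_cohomologicalDimension_eq (m n : ℕ) :
    ∃ (B : Type) (_ : Monoid B) (_ : Finite B), IsRegularBand B ∧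
      cohomologicalDimension ℤ B = m ∧ cohomologicalDimension ℤ Bᵐᵒᵖ = n := by
  obtain ⟨z, hz⟩ := FreePCLeftRegularBand.exists_leftZero (cocktailPartyGraph m)
  obtain ⟨z', hz'⟩ := FreePCLeftRegularBand.exists_leftZero (cocktailPartyGraph n)
  have : Finite (FreePCLeftRegularBand (cocktailPartyGraph n))ᵐᵒᵖ :=
    Finite.of_equiv _ MulOpposite.opEquiv
  refine ⟨FreePCLeftRegularBand (cocktailPartyGraph m) ×
    (FreePCLeftRegularBand (cocktailPartyGraph n))ᵐᵒᵖ, inferInstance, inferInstance,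
    isRegularBand_prod _ _, ?_, ?_⟩
  · rw [(AbsorbingRetraction.prodFst hz').cohomologicalDimension_eq,
      cohomologicalDimension_cocktailPartyGraph]
  · rw [(AbsorbingRetraction.prodSndOp hz).cohomologicalDimension_eq,
      cohomologicalDimension_cocktailPartyGraph]

end Product

theorem theoremt :
    -- the cohomological dimension of a finite left regular band monoid
    (∀ (k : Type u) [CommRing k] [Nontrivial k]
        (B : Type v) [Monoid B] [IsLeftRegularBand B] [Finite B]
        (e : supportSemilattice B → B)
        (_ : ∀ Y : supportSemilattice B, principalLeftIdeal (e Y) = (Y : Set B)),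
      ∃ N : ℕ, cohomologicalDimension k B = N ∧
        IsGreatest {n : ℕ | ∃ Y : supportSemilattice B,
          Nontrivial ((boundaryComplex (e Y)).ReducedCohomologySubOne k n)} N) ∧
    -- free partially commutative left regular bands and Leray numbers
    (∀ (k : Type u) [CommRing k] (V : Type v) [Finite V] (Γ : SimpleGraph V),
      cohomologicalDimension k (FreePCLeftRegularBand Γ) = (cliqueComplex Γ).lerayNumber k) ∧
    (∀ (V : Type v) [Finite V] (Γ : SimpleGraph V),
      cohomologicalDimension ℤ (FreePCLeftRegularBand Γ) ≤ 1 ↔ IsChordalGraph Γ) ∧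
    -- regular bands with prescribed left and right cohomological dimensions
    (∀ m n : ℕ, ∃ (B : Type) (_ : Monoid B) (_ : Finite B), IsRegularBand B ∧
      cohomologicalDimension ℤ B = m ∧ cohomologicalDimension ℤ Bᵐᵒᵖ = n) := by
  refine ⟨fun k _ _ B _ _ _ e he => exists_cohomologicalDimension_eq k e he,
    fun k _ V _ Γ => FreePCLeftRegularBand.cohomologicalDimension_eq_lerayNumber k Γ,
    fun V _ Γ => FreePCLeftRegularBand.cohomologicalDimension_le_one_iff,
    exists_isRegularBand_cohomologicalDimension_eq⟩
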